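/- Let $p,q$ be odd primes with $q-p=2^m$, $m\ge 1$, and let $D=D_1\cdots D_n$ be a product of distinct odd primes $D_i\notin\{p,q\}$ (the empty product $D=1$ is allowed), numbered so that, for some $0\le s\le n$, $\left(\frac{pq}{D_i}\right)=1$ for $i\le s$ and $\left(\frac{pq}{D_i}\right)=-1$ for $s<i\le n$. Consider the elliptic curves over $\mathbb Q$ $$E_-:\ y^2=x(x-pD)(x-qD),\qquad E'_-:\ y^2=x^3+2(p+q)Dx^2+4^mD^2x,$$ and the isogeny $\widehat\varphi:E'_-\to E_-$, $(x,y)\mapsto\left(\frac{y^2}{4x^2},\frac{y(4^mD^2-x^2)}{8x^2}\right)$, with kernel $E'_-[\widehat\varphi]=\{O,(0,0)\}$. Let $$S^{(\widehat\varphi)}(E'_- /\mathbb Q)=\ker\Big(H^1(\mathbb Q,E'_-[\widehat\varphi])\to\prod_v H^1(\mathbb Q_v,E'_-)\Big)$$ be its Selmer group ($v$ runs through all places of $\mathbb Q$, including $\infty$). Define a directed graph $g(-D)$ as follows. Its vertices are $p,D_1,\dots,D_n$ and the elements of a set $A\subseteq\{-1,2,-2\}$, where 1. $A=\emptyset$ if: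 $m=1$, $p-D\equiv 2,4\ (8)$; or $m=2$, $pD\equiv 3\ (4)$; or $m=2$, $D\equiv1\ (4)$, $pD\equiv5\ (8)$; or $m=2$, $D\equiv3\ (4)$, $pD\equiv1\ (8)$; or $m=3$, $pD\equiv3\ (4)$. 2. $A=\{-2\}$ if: $m=1$, $p\equiv1\ (4)$, $p-D\equiv0,6\ (8)$; or $m\ge4$, $pD\equiv3\ (8)$. 3. $A=\{2\}$ if: $m=1$, $p\equiv3\ (4)$, $p-D\equiv0,6\ (8)$; or $m\ge4$, $pD\equiv7\ (8)$. 4. $A=\{-1\}$ if: $m=2$, $D\equiv1\ (4)$, $pD\equiv1\ (8)$; or $m=2$, $D\equiv3\ (4)$, $pD\equiv5\ (8)$; or $m\ge3$, $pD\equiv5\ (8)$; or $m=4$, $pD\equiv1\ (8)$. 5. $A=\{-1,2\}$ if: $m=3$, $pD\equiv1\ (8)$; or $m\ge5$, $pD\equiv1\ (8)$. (Exactly one of these cases occurs.) Its edges are: $D_i\to D_j$ for $i\le s$, $1\le j\le n$ with $\left(\frac{D_j}{D_i}\right)=-1$; $D_i\to p$ for $i\le s$ with $\left(\frac{p}{D_i}\right)=-1$;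 and, for every $a\in A$, $a\to D_k$ for $1\le k\le n$ with $\left(\frac{a}{D_k}\right)=-1$ and $a\to p$ if $\left(\frac ap\right)=-1$. An ordered partition $(V_1,V_2)$ of the vertex set (either part may be empty) is called even if from every vertex of $V_1$ the number of edges to $V_2$ is even and from every vertex of $V_2$ the number of edges to $V_1$ is even. Then $$\#S^{(\widehat\varphi)}(E'_- /\mathbb Q)=2\cdot\#\{(V_1,V_2)\text{ an even partition of } g(-D):\ -1,2,-2\notin V_1\}.$$ -/

import Mathlib

noncomputable section

namespace TwoIsogenySelmer

open WeierstrassCurve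

/-! ### The curves and the isogeny -/

/-- The standing assumptions on the parameters: `p` and `q` are odd primes with `q - p = 2 ^ m`,
`m ≥ 1`, and `D` is an odd positive square-free integer prime to `p` and `q`. -/
structure Admissible (p q m D : ℕ) : Prop where
  prime_p : p.Prime
  prime_q : q.Prime
  odd_p : Odd p
  odd_q : Odd q
  one_le_m : 1 ≤ m
  diff : q = p + 2 ^ m
  squarefree_D : Squarefree D
  odd_D : Odd D
  not_dvd_p : ¬ p ∣ D
  not_dvd_q : ¬ q ∣ D

/-- The curve `E_ε : y² = x (x + ε p D) (x + ε q D) = x³ + ε (p + q) D x² + p q D² x`. -/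
def curveE (ε : ℤˣ) (p q D : ℕ) : WeierstrassCurve ℚ where
  a₁ := 0
  a₂ := ((ε : ℤ) : ℚ) * (p + q) * D
  a₃ := 0
  a₄ := p * q * D ^ 2
  a₆ := 0

/-- The curve `E'_ε : y² = x³ - 2 ε (p + q) D x² + 4 ^ m D² x`. -/
def curveE' (ε : ℤˣ) (p q m D : ℕ) : WeierstrassCurve ℚ where
  a₁ := 0
  a₂ := -2 * ((ε : ℤ) : ℚ) * (p + q) * D
  a₃ := 0
  a₄ := 4 ^ m * D ^ 2
  a₆ := 0

section Isogeny

variable {ε : ℤˣ} {p q m D : ℕ} {K : Type*} [Field K] [Algebra ℚ K]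

theorem curveE_baseChange : (curveE ε p q D)⁄K =
    ⟨0, ((ε : ℤ) : K) * (p + q) * D, 0, p * q * D ^ 2, 0⟩ := by
  have := algebraRat.charZero K
  ext <;> simp [curveE]

theorem curveE'_baseChange : (curveE' ε p q m D)⁄K =
    ⟨0, -2 * ((ε : ℤ) : K) * (p + q) * D, 0, 4 ^ m * D ^ 2, 0⟩ := by
  have := algebraRat.charZero K
  ext <;> simp [curveE']

/-- The affine formula of the dual isogeny maps points of `E'` with `x ≠ 0` to points of `E`. -/
theorem phiHat_nonsingular (h : Admissible p q m D) {x y : K} (hx : x ≠ 0)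
    (hxy : ((curveE' ε p q m D)⁄K).toAffine.Nonsingular x y) :
    ((curveE ε p q D)⁄K).toAffine.Nonsingular (y ^ 2 / (4 * x ^ 2))
      (y * (4 ^ m * (D : K) ^ 2 - x ^ 2) / (8 * x ^ 2)) := by
  have : CharZero K := algebraRat.charZero K
  have hp : (p : K) ≠ 0 := Nat.cast_ne_zero.mpr h.prime_p.ne_zero
  have hq : (q : K) ≠ 0 := Nat.cast_ne_zero.mpr h.prime_q.ne_zero
  have hD : (D : K) ≠ 0 := Nat.cast_ne_zero.mpr h.squarefree_D.ne_zero
  have hqp : (q : K) - p = 2 ^ m := by rw [h.diff]; push_cast; ring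
  have h4 : (4 : K) ^ m = (q - p) ^ 2 := by
    rw [hqp, ← pow_mul, mul_comm, pow_mul]; norm_num
  have he : (((ε : ℤ) : K)) ^ 2 = 1 := by
    rcases Int.units_eq_one_or ε with rfl | rfl <;> simp
  have hd : (q : K) - p ≠ 0 := by rw [hqp]; exact pow_ne_zero _ two_ne_zero
  have hxy' := hxy.1
  rw [curveE'_baseChange, Affine.equation_iff] at hxy'
  rw [curveE_baseChange]
  refine (Affine.equation_iff_nonsingular_of_Δ_ne_zero ?_).mp ?_
  · have : (⟨0, ((ε : ℤ) : K) * (p + q) * D, 0, p * q * D ^ 2, 0⟩ : WeierstrassCurve K).Δ =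
        16 * (p * q * D ^ 2) ^ 2 * (D ^ 2 * (((ε : ℤ) : K) ^ 2 * (p + q) ^ 2 - 4 * p * q)) := by
      simp only [WeierstrassCurve.Δ, WeierstrassCurve.b₂,
        WeierstrassCurve.b₄, WeierstrassCurve.b₆, WeierstrassCurve.b₈]
      ring
    rw [this, he, show (1 * (p + q) ^ 2 - 4 * p * q : K) = (q - p) ^ 2 by ring]
    have : (16 : K) ≠ 0 := by norm_num
    simp [*]
  · rw [Affine.equation_iff]
    simp only [zero_mul, add_zero, h4] at hxy' ⊢
    have h2 : (2 : K) ≠ 0 := two_ne_zero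
    generalize ((ε : ℤ) : K) = e at *
    have h8 : (8 : K) ≠ 0 := by norm_num
    have h4 : (4 : K) ≠ 0 := by norm_num
    field_simp
    linear_combination (-64 * y ^ 2 * (y ^ 2 + (x ^ 3 + -2 * e * (p + q) * D * x ^ 2 +
      (q - p) ^ 2 * D ^ 2 * x) + 4 * (e * (p + q) * D) * x ^ 2)) * hxy' +
      (64 * y ^ 2 * (4 * x ^ 4 * D ^ 2 * (p + q) ^ 2)) * he

open scoped Classical in
/-- The dual isogeny `φ̂ : E' → E`,
`(x, y) ↦ (y² / (4 x²), y (4 ^ m D² - x²) / (8 x²))`, on `K`-points; the point at infinity `O` and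
the point `(0, 0)` are sent to `O`. -/
def phiHat (h : Admissible p q m D) :
    ((curveE' ε p q m D)⁄K).toAffine.Point → ((curveE ε p q D)⁄K).toAffine.Point
  | .zero => .zero
  | .some x y hxy =>
    if hx : x = 0 then .zero
    else .some (y ^ 2 / (4 * x ^ 2)) (y * (4 ^ m * (D : K) ^ 2 - x ^ 2) / (8 * x ^ 2))
      (phiHat_nonsingular h hx hxy)

theorem phiHat_eq_zero_iff (h : Admissible p q m D)
    (P : ((curveE' ε p q m D)⁄K).toAffine.Point) :
    phiHat h P = 0 ↔ P = 0 ∨ ∃ hxy, P = .some 0 0 hxy := by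
  rcases P with _ | ⟨x, y, hxy⟩
  · exact iff_of_true rfl (Or.inl rfl)
  · by_cases hx : x = 0
    · subst hx
      have hy : y = 0 := by
        have h1 := hxy.1
        rw [curveE'_baseChange, Affine.equation_iff] at h1
        simpa using h1
      subst hy
      refine iff_of_true ?_ (Or.inr ⟨hxy, rfl⟩)
      simp only [phiHat, dif_pos]
      rfl
    · refine iff_of_false ?_ ?_
      · simp only [phiHat, dif_neg hx]
        exact Affine.Point.some_ne_zero _
      · rintro (h1 | ⟨h1, h2⟩)
        · exact Affine.Point.some_ne_zero _ h1
        · exact hx (Affine.Point.some.inj h2).1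

open scoped Classical in
/-- The kernel `E'[φ̂]` of the dual isogeny, as a subgroup of `E'(K)`. -/
def kerPhiHat (ε : ℤˣ) (K : Type*) [Field K] [Algebra ℚ K] (h : Admissible p q m D) :
    AddSubgroup ((curveE' ε p q m D)⁄K).toAffine.Point where
  carrier := {P | phiHat h P = 0}
  zero_mem' := rfl
  add_mem' := by
    intro P Q hP hQ
    rw [Set.mem_ofPred_eq, phiHat_eq_zero_iff] at hP hQ
    rcases hP with rfl | ⟨h1, rfl⟩
    · rw [zero_add]
      exact (phiHat_eq_zero_iff h Q).2 hQ
    rcases hQ with rfl | ⟨h2, rfl⟩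
    · rw [add_zero]
      exact (phiHat_eq_zero_iff h _).2 (Or.inr ⟨h1, rfl⟩)
    · refine (phiHat_eq_zero_iff h _).2 (Or.inl ?_)
      rw [Affine.Point.add_of_Y_eq rfl]
      rw [curveE'_baseChange]
      simp [Affine.negY]
  neg_mem' := by
    intro P hP
    rw [Set.mem_ofPred_eq, phiHat_eq_zero_iff] at hP
    rcases hP with rfl | ⟨h1, rfl⟩
    · rw [neg_zero]
      rfl
    · refine (phiHat_eq_zero_iff h _).2 (Or.inr ?_)
      have : ((curveE' ε p q m D)⁄K).toAffine.negY 0 0 = 0 := by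
        rw [curveE'_baseChange]
        simp [Affine.negY]
      refine ⟨h1, ?_⟩
      rw [Affine.Point.neg_some]
      simp only [this]

end Isogeny

/-! ### Galois cohomology and the Selmer group -/

section Selmer

open scoped Classical

variable (W : WeierstrassCurve ℚ)

/-- An algebraic closure of `ℚ`. -/
abbrev QBar : Type := AlgebraicClosure ℚ

/-- Continuous 1-cocycles `c : Gal(ℚ̄/ℚ) → Φ`, `c (σ τ) = c σ + σ (c τ)`, with values in a
subgroup `Φ` of `W(ℚ̄)` with the discrete topology (so that continuous means locally constant for
the Krull topology). -/
def cocycles (Φ : AddSubgroup (W⁄QBar).toAffine.Point) :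
    AddSubgroup ((QBar ≃ₐ[ℚ] QBar) → (W⁄QBar).toAffine.Point) where
  carrier := {c | (∀ σ, c σ ∈ Φ) ∧ IsLocallyConstant c ∧
    ∀ σ τ, c (σ * τ) = c σ + Affine.Point.map (W' := W.toAffine) σ.toAlgHom (c τ)}
  zero_mem' := ⟨fun _ => Φ.zero_mem, IsLocallyConstant.const 0, fun _ _ => by simp⟩
  add_mem' := by
    rintro c d ⟨hc, hc', hc''⟩ ⟨hd, hd', hd''⟩
    refine ⟨fun σ => Φ.add_mem (hc σ) (hd σ), hc'.add hd', fun σ τ => ?_⟩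
    simp only [Pi.add_apply, hc'', hd'', map_add]
    abel
  neg_mem' := by
    rintro c ⟨hc, hc', hc''⟩
    refine ⟨fun σ => Φ.neg_mem (hc σ), hc'.neg, fun σ τ => ?_⟩
    simp only [Pi.neg_apply, hc'', map_neg]
    abel

/-- The coboundaries `σ ↦ σ T - T` with `T ∈ Φ`. -/
def coboundaries (Φ : AddSubgroup (W⁄QBar).toAffine.Point) : AddSubgroup (cocycles W Φ) where
  carrier := {c | ∃ T ∈ Φ, ∀ σ, c.1 σ = Affine.Point.map (W' := W.toAffine) σ.toAlgHom T - T}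
  zero_mem' := ⟨0, Φ.zero_mem, fun _ => by simp⟩
  add_mem' := by
    rintro c d ⟨T, hT, hc⟩ ⟨U, hU, hd⟩
    refine ⟨T + U, Φ.add_mem hT hU, fun σ => ?_⟩
    simp only [AddSubgroup.coe_add, Pi.add_apply, hc, hd, map_add]
    abel
  neg_mem' := by
    rintro c ⟨T, hT, hc⟩
    refine ⟨-T, Φ.neg_mem hT, fun σ => ?_⟩
    simp only [AddSubgroup.coe_neg, Pi.neg_apply, hc, map_neg]
    abel

/-- The Galois cohomology group `H¹(ℚ, Φ)`. -/
abbrev H1 (Φ : AddSubgroup (W⁄QBar).toAffine.Point) : Type :=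
  cocycles W Φ ⧸ coboundaries W Φ

/-- The class of the cocycle `c` becomes trivial in `H¹(L, W)`, where `L` is a completion of `ℚ`
(or any other extension field): for an embedding `ι : ℚ̄ → L̄`, the cocycle
`τ ↦ ι (c (τ|ℚ̄))` of `Gal(L̄/L)` is the coboundary `τ ↦ τ P - P` of a point `P ∈ W(L̄)`.
Here `τ|ℚ̄` is the unique `σ ∈ Gal(ℚ̄/ℚ)` with `ι ∘ σ = τ ∘ ι`. -/
def LocallyTrivial (L : Type) [Field L] [Algebra ℚ L]
    (c : (QBar ≃ₐ[ℚ] QBar) → (W⁄QBar).toAffine.Point) : Prop :=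
  ∀ ι : QBar →ₐ[ℚ] AlgebraicClosure L, ∃ P : (W⁄(AlgebraicClosure L)).toAffine.Point,
    ∀ (τ : AlgebraicClosure L ≃ₐ[L] AlgebraicClosure L) (σ : QBar ≃ₐ[ℚ] QBar),
      (∀ x, ι (σ x) = τ (ι x)) →
        Affine.Point.map (W' := W.toAffine) ι (c σ) =
          Affine.Point.map (W' := W.toAffine) τ.toAlgHom P - P

theorem locallyTrivial_zero (L : Type) [Field L] [Algebra ℚ L] : LocallyTrivial W L 0 :=
  fun _ => ⟨0, fun _ _ _ => by simp⟩

theorem locallyTrivial_add (L : Type) [Field L] [Algebra ℚ L]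
    {c d : (QBar ≃ₐ[ℚ] QBar) → (W⁄QBar).toAffine.Point}
    (hc : LocallyTrivial W L c) (hd : LocallyTrivial W L d) : LocallyTrivial W L (c + d) := by
  intro ι
  obtain ⟨P, hP⟩ := hc ι
  obtain ⟨Q, hQ⟩ := hd ι
  refine ⟨P + Q, fun τ σ hστ => ?_⟩
  simp only [Pi.add_apply, map_add, hP τ σ hστ, hQ τ σ hστ]
  abel

theorem locallyTrivial_neg (L : Type) [Field L] [Algebra ℚ L]
    {c : (QBar ≃ₐ[ℚ] QBar) → (W⁄QBar).toAffine.Point}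
    (hc : LocallyTrivial W L c) : LocallyTrivial W L (-c) := by
  intro ι
  obtain ⟨P, hP⟩ := hc ι
  refine ⟨-P, fun τ σ hστ => ?_⟩
  simp only [Pi.neg_apply, map_neg, hP τ σ hστ]
  abel

/-- The cocycles that become trivial in `H¹(ℚ_v, W)` at every place `v` of `ℚ`, that is, for
`ℚ_v = ℝ` and for `ℚ_v = ℚ_ℓ`, `ℓ` a prime number. -/
def selmerCocycles (Φ : AddSubgroup (W⁄QBar).toAffine.Point) : AddSubgroup (cocycles W Φ) where
  carrier := {c | LocallyTrivial W ℝ c.1 ∧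
    ∀ (l : ℕ) [Fact l.Prime], LocallyTrivial W ℚ_[l] c.1}
  zero_mem' := ⟨locallyTrivial_zero W ℝ, fun l _ => locallyTrivial_zero W ℚ_[l]⟩
  add_mem' := fun hc hd =>
    ⟨locallyTrivial_add W ℝ hc.1 hd.1, fun l _ => locallyTrivial_add W ℚ_[l] (hc.2 l) (hd.2 l)⟩
  neg_mem' := fun hc =>
    ⟨locallyTrivial_neg W ℝ hc.1, fun l _ => locallyTrivial_neg W ℚ_[l] (hc.2 l)⟩

/-- The subgroup `ker (H¹(ℚ, Φ) → ∏_v H¹(ℚ_v, W))` of `H¹(ℚ, Φ)`. -/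
def selmerSubgroup (Φ : AddSubgroup (W⁄QBar).toAffine.Point) : AddSubgroup (H1 W Φ) :=
  (selmerCocycles W Φ).map (QuotientAddGroup.mk' (coboundaries W Φ))

/-- The `φ̂`-Selmer group
`S^(φ̂)(E'_ε/ℚ) = ker (H¹(ℚ, E'_ε[φ̂]) → ∏_v H¹(ℚ_v, E'_ε))`. -/
def selmerPhiHat (ε : ℤˣ) {p q m D : ℕ} (h : Admissible p q m D) :
    AddSubgroup (H1 (curveE' ε p q m D) (kerPhiHat ε QBar h)) :=
  selmerSubgroup (curveE' ε p q m D) (kerPhiHat ε QBar h)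

end Selmer

/-! ### Even partitions and the graph `g(-D)` -/

/-- `(V₁, V₂)` is an even partition of the vertices of the directed graph `G`: from every vertex in
one part there is an even number of edges to the other part. (A part may be empty.) -/
def IsEvenPartition {V : Type*} (G : Digraph V) (V₁ V₂ : Set V) : Prop :=
  IsCompl V₁ V₂ ∧
    (∀ P ∈ V₁, Even {Q | Q ∈ V₂ ∧ G.Adj P Q}.ncard) ∧
    (∀ P ∈ V₂, Even {Q | Q ∈ V₁ ∧ G.Adj P Q}.ncard)

/-- Case 1 of the definition of `g(-D)`. -/
abbrev GraphCase1 (m p D : ℕ) : Prop :=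
  (m = 1 ∧ ((p : ℤ) - D ≡ 2 [ZMOD 8] ∨ (p : ℤ) - D ≡ 4 [ZMOD 8])) ∨
  (m = 2 ∧ p * D ≡ 3 [MOD 4]) ∨
  (m = 2 ∧ D ≡ 1 [MOD 4] ∧ p * D ≡ 5 [MOD 8]) ∨
  (m = 2 ∧ D ≡ 3 [MOD 4] ∧ p * D ≡ 1 [MOD 8]) ∨
  (m = 3 ∧ p * D ≡ 3 [MOD 4])

/-- Case 2 of the definition of `g(-D)`. -/
abbrev GraphCase2 (m p D : ℕ) : Prop :=
  (m = 1 ∧ p ≡ 1 [MOD 4] ∧ ((p : ℤ) - D ≡ 0 [ZMOD 8] ∨ (p : ℤ) - D ≡ 6 [ZMOD 8])) ∨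
  (4 ≤ m ∧ p * D ≡ 3 [MOD 8])

/-- Case 3 of the definition of `g(-D)`. -/
abbrev GraphCase3 (m p D : ℕ) : Prop :=
  (m = 1 ∧ p ≡ 3 [MOD 4] ∧ ((p : ℤ) - D ≡ 0 [ZMOD 8] ∨ (p : ℤ) - D ≡ 6 [ZMOD 8])) ∨
  (4 ≤ m ∧ p * D ≡ 7 [MOD 8])

/-- Case 4 of the definition of `g(-D)`. -/
abbrev GraphCase4 (m p D : ℕ) : Prop :=
  (m = 2 ∧ D ≡ 1 [MOD 4] ∧ p * D ≡ 1 [MOD 8]) ∨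
  (m = 2 ∧ D ≡ 3 [MOD 4] ∧ p * D ≡ 5 [MOD 8]) ∨
  (3 ≤ m ∧ p * D ≡ 5 [MOD 8]) ∨
  (m = 4 ∧ p * D ≡ 1 [MOD 8])

/-- Case 5 of the definition of `g(-D)`. -/
abbrev GraphCase5 (m p D : ℕ) : Prop :=
  (m = 3 ∧ p * D ≡ 1 [MOD 8]) ∨
  (5 ≤ m ∧ p * D ≡ 1 [MOD 8])

/-- The vertices of `g(-D)` besides `p, D₁, …, Dₙ`. For `p`, `D` odd and `m ≥ 1` exactly one of the
five cases holds. -/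
def extraVertices (m p D : ℕ) : Set ℤ :=
  if GraphCase1 m p D then ∅
  else if GraphCase2 m p D then {-2}
  else if GraphCase3 m p D then {2}
  else if GraphCase4 m p D then {-1}
  else if GraphCase5 m p D then {-1, 2}
  else ∅

/-- The vertex set of `g(-D)`, `D = D₁ ⋯ Dₙ`, as a set of integers: `p, D₁, …, Dₙ` and the extra
vertices among `-1, 2, -2`. -/
def gVertices (m p : ℕ) {n : ℕ} (D : Fin n → ℕ) : Set ℤ :=
  {(p : ℤ)} ∪ Set.range (fun i => (D i : ℤ)) ∪ extraVertices m p (∏ i, D i)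

/-- The directed graph `g(-D)`, `D = D₁ ⋯ Dₙ`. Its edges are
* `Dᵢ → Dⱼ` for `i ≤ s`, `(Dⱼ / Dᵢ) = -1`, and `Dᵢ → p` for `i ≤ s`, `(p / Dᵢ) = -1`;
* for every extra vertex `a`: `a → Dₖ` if `(a / Dₖ) = -1`, and `a → p` if `(a / p) = -1`.

The index `i` runs through `0, …, n - 1` here, so that `i ≤ s` becomes `i < s`. All denominators
are odd primes in the application, so that the Jacobi symbol is the Legendre symbol. -/
def gMinus (m p : ℕ) {n : ℕ} (s : ℕ) (D : Fin n → ℕ) : Digraph (gVertices m p D) where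
  Adj P Q :=
    (∃ i j : Fin n, (i : ℕ) < s ∧ (P : ℤ) = D i ∧ (Q : ℤ) = D j ∧ jacobiSym (D j) (D i) = -1) ∨
    (∃ i : Fin n, (i : ℕ) < s ∧ (P : ℤ) = D i ∧ (Q : ℤ) = p ∧ jacobiSym p (D i) = -1) ∨
    (∃ k : Fin n, (P : ℤ) ∈ extraVertices m p (∏ i, D i) ∧ (Q : ℤ) = D k ∧
      jacobiSym P (D k) = -1) ∨
    ((P : ℤ) ∈ extraVertices m p (∏ i, D i) ∧ (Q : ℤ) = p ∧ jacobiSym P p = -1)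

end TwoIsogenySelmer

end

namespace TwoIsogenySelmer

/-! ### Squares in `ℚ_[ℓ]` -/

section PadicSquares

variable {l : ℕ} [Fact l.Prime]

/-! The proof is a descent via the isogeny, made explicit at every place. Write `a = pD`, `b = qD`.
The kernel of the dual isogeny is `{O, T}` with `T = (0, 0)`, a trivial Galois module of order two,
so its `H¹` is `ℚˣ/ℚˣ²`: every cocycle records the signs `σ(√d)/√d` (`exists_eq_quadCocycle`,
`quadCocycle_eq_iff`). The class of `d` dies in `H¹(ℚ_v, E')` exactly when `d` lies in the image of
`E(ℚ_v) → ℚ_vˣ/ℚ_vˣ²`, `(X, Y) ↦ X`, because a point trivialising the cocycle amounts to a solution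
of `d t² = (d s² - a)(d s² - b)` (`locallyTrivial_quadCocycle_iff`, `localImage_iff_quartic`).

The local images are as follows. Over `ℝ` the image is the positive classes. At `p`, at `q` and at
primes `ℓ ∣ D` with `(pq/ℓ) = -1` it is everything. At odd primes of good reduction it is the
classes of even valuation. At `ℓ ∣ D` with `(pq/ℓ) = 1` it is `{1, a}`. At `2` it contains only
classes of even valuation, and which odd integers it contains depends on `m` and on `p`, `D` modulo
`8`; the set `A` is chosen so that the odd positive `d` in the image are those with `(x/d) = 1` for
all `x ∈ A` (`localImage_two_iff_jacobiSym`).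

A Selmer class is therefore positive and supported on the primes dividing `pqD`. Multiplying by
`pq`, the class of the rational point `(0, 0)` of `E`, removes `q`, which produces the factor `2`
and leaves the positive divisors `d` of `pD` (`card_selmerPhiHat_eq_two_mul`). Such a `d` is encoded
by the set `V₁` of its prime divisors. The surviving conditions are `(d/Dᵢ) = 1` or `((pD/d)/Dᵢ) =
1` for `i ≤ s`, according to whether `Dᵢ ∤ d` or `Dᵢ ∣ d`, and `(x/d) = 1` for `x ∈ A`. Expanded
multiplicatively over primes, each says that the number of edges from one vertex to the opposite
part is even (`isSelmer_iff_isEvenPartition`). -/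

open Polynomial in
theorem isSquare_padic_of_norm_sub_one_lt {z : ℚ_[l]} (hz : ‖z - 1‖ < ‖(2 : ℚ_[l])‖ ^ 2) :
    IsSquare z := by
  have h2 : ‖(2 : ℚ_[l])‖ ≤ 1 := by exact_mod_cast Padic.norm_int_le_one (p := l) 2
  have hz1 : ‖z‖ ≤ 1 := by
    have h := Padic.nonarchimedean (z - 1) (1 : ℚ_[l])
    rw [sub_add_cancel, norm_one] at h
    exact h.trans (max_le (hz.le.trans (pow_le_one₀ (norm_nonneg _) h2)) le_rfl)
  let y : ℤ_[l] := ⟨z, hz1⟩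
  -- Newton's method for `X² - z` starts at `1`, where the derivative is `2`; the hypothesis is
  -- exactly `‖F(1)‖ < ‖F'(1)‖²`, uniformly in `ℓ`, including `ℓ = 2`.
  obtain ⟨r, hr, -⟩ := hensels_lemma (F := (X ^ 2 - C y : Polynomial ℤ_[l])) (a := 1) (by
    have h1 : aeval (1 : ℤ_[l]) (X ^ 2 - C y : Polynomial ℤ_[l]) = 1 - y := by simp
    have h2 : aeval (1 : ℤ_[l]) (derivative (X ^ 2 - C y : Polynomial ℤ_[l])) = 2 := by
      simp [one_add_one_eq_two]
    rw [h1, h2, ← norm_neg, neg_sub]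
    exact hz)
  have hr' : r ^ 2 = y := by simpa [sub_eq_zero] using hr
  refine ⟨r, ?_⟩
  rw [← PadicInt.coe_mul, ← sq, hr']

theorem isSquare_mul_iff_right {K : Type*} [Field K] {x y : K} (hx : x ≠ 0) (h : IsSquare x) :
    IsSquare (x * y) ↔ IsSquare y := by
  refine ⟨fun h' => ?_, fun h' => h.mul h'⟩
  have := h'.div h
  rwa [mul_div_cancel_left₀ _ hx] at this

theorem isSquare_iff_of_isSquare_mul {K : Type*} [Field K] {x y : K} (hx : x ≠ 0) (hy : y ≠ 0)
    (h : IsSquare (x * y)) : IsSquare x ↔ IsSquare y := by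
  constructor
  · intro h'
    exact (isSquare_mul_iff_right hx h').1 h
  · intro h'
    rw [mul_comm] at h
    exact (isSquare_mul_iff_right hy h').1 h

/-- Square classes are open: `y / x` is close enough to `1` to be a square. Equality of the classes
of `x` and `y` is expressed throughout as `IsSquare (x * y)`. -/
theorem isSquare_mul_of_norm_sub_lt {x y : ℚ_[l]}
    (h : ‖x - y‖ < ‖(2 : ℚ_[l])‖ ^ 2 * ‖x‖) : IsSquare (x * y) := by
  have hx : x ≠ 0 := by
    rintro rfl
    simp only [norm_zero, mul_zero] at h
    exact absurd h (not_lt.2 (norm_nonneg _))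
  have h1 : IsSquare (y / x) := by
    apply isSquare_padic_of_norm_sub_one_lt
    have : y / x - 1 = -(x - y) / x := by field_simp; ring
    rw [this, norm_div, norm_neg, div_lt_iff₀ (norm_pos_iff.2 hx)]
    exact h
  have : x * y = x * x * (y / x) := by field_simp
  rw [this]
  exact (IsSquare.mul_self x).mul h1

theorem even_valuation_of_isSquare {x : ℚ_[l]} (h : IsSquare x) : Even x.valuation := by
  obtain ⟨y, rfl⟩ := h
  by_cases hy : y = 0
  · simp [hy]
  · rw [Padic.valuation_mul hy hy]
    exact ⟨_, rfl⟩

theorem norm_two_of_odd (hl : l ≠ 2) : ‖(2 : ℚ_[l])‖ = 1 := by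
  have := (Padic.norm_intCast_eq_one_iff (p := l) (z := 2)).2 (by
    have h := (Nat.coprime_primes Nat.prime_two Fact.out).2 (Ne.symm hl)
    exact_mod_cast Nat.isCoprime_iff_coprime.2 h)
  exact_mod_cast this

theorem norm_eq_one_iff_valuation {x : ℚ_[l]} (hx : x ≠ 0) : ‖x‖ = 1 ↔ x.valuation = 0 := by
  have h1 : (1 : ℝ) < l := by exact_mod_cast (Fact.out : l.Prime).one_lt
  rw [Padic.norm_eq_zpow_neg_valuation hx]
  constructor
  · intro h
    have := (zpow_right_injective₀ (zero_lt_one.trans h1) h1.ne') (h.trans (zpow_zero (l : ℝ)).symm)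
    simpa using this
  · intro h
    simp [h]

theorem norm_lt_norm_iff_valuation {x y : ℚ_[l]} (hx : x ≠ 0) (hy : y ≠ 0) :
    ‖x‖ < ‖y‖ ↔ y.valuation < x.valuation := by
  have h1 : (1 : ℝ) < l := by exact_mod_cast (Fact.out : l.Prime).one_lt
  rw [Padic.norm_eq_zpow_neg_valuation hx, Padic.norm_eq_zpow_neg_valuation hy,
    zpow_lt_zpow_iff_right₀ h1, neg_lt_neg_iff]

theorem norm_intCast_eq_one_iff_not_dvd {n : ℤ} : ‖(n : ℚ_[l])‖ = 1 ↔ ¬ (l : ℤ) ∣ n := by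
  rw [← Padic.norm_intCast_lt_one_iff]
  exact ⟨fun h => h ▸ lt_irrefl _, fun h => le_antisymm (Padic.norm_int_le_one n) (not_lt.1 h)⟩

theorem exists_int_norm_sub_lt {x : ℚ_[l]} (hx : ‖x‖ ≤ 1) {ε : ℝ} (hε : 0 < ε) :
    ∃ n : ℤ, ‖x - n‖ < ε := by
  let x' : ℤ_[l] := ⟨x, hx⟩
  obtain ⟨n, hn⟩ := Metric.denseRange_iff.1 (PadicInt.denseRange_intCast (p := l)) x' ε hε
  rw [dist_eq_norm] at hn
  refine ⟨n, ?_⟩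
  exact hn

theorem isSquare_intCast_of_zmod (hl : l ≠ 2) {n : ℤ} (hn : ¬ (l : ℤ) ∣ n)
    (h : IsSquare (n : ZMod l)) : IsSquare (n : ℚ_[l]) := by
  obtain ⟨r, hr⟩ := h
  obtain ⟨r, rfl⟩ := ZMod.intCast_surjective r
  have h1 : (l : ℤ) ∣ n - r * r := by
    rw [← Int.cast_mul] at hr
    exact (ZMod.intCast_eq_intCast_iff_dvd_sub _ _ _).1 hr.symm
  have hn1 := (norm_intCast_eq_one_iff_not_dvd (l := l)).2 hn
  have h2 : IsSquare ((n : ℚ_[l]) * ((r * r : ℤ) : ℚ_[l])) := by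
    apply isSquare_mul_of_norm_sub_lt
    rw [norm_two_of_odd hl, hn1, ← Int.cast_sub]
    simpa using Padic.norm_intCast_lt_one_iff.2 h1
  have hr0 : (r : ℚ_[l]) ≠ 0 := by
    intro h0
    have : r = 0 := by exact_mod_cast h0
    subst this
    apply hn
    simpa using h1
  rw [Int.cast_mul, mul_comm] at h2
  exact (isSquare_mul_iff_right (mul_ne_zero hr0 hr0) (IsSquare.mul_self _)).1 h2

theorem exists_padicInt_of_isSquare {n : ℤ} (h : IsSquare (n : ℚ_[l])) :
    ∃ y : ℤ_[l], (n : ℤ_[l]) = y * y := by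
  obtain ⟨y, hy⟩ := h
  have : ‖y‖ ≤ 1 := by
    have h1 := Padic.norm_int_le_one (p := l) n
    rw [hy, norm_mul] at h1
    nlinarith [norm_nonneg y]
  let y' : ℤ_[l] := ⟨y, this⟩
  refine ⟨y', ?_⟩
  apply PadicInt.ext
  rw [PadicInt.coe_mul, PadicInt.coe_intCast]
  exact hy

theorem isSquare_intCast_iff_zmod (hl : l ≠ 2) {n : ℤ} (hn : ¬ (l : ℤ) ∣ n) :
    IsSquare (n : ℚ_[l]) ↔ IsSquare (n : ZMod l) := by
  refine ⟨fun h => ?_, isSquare_intCast_of_zmod hl hn⟩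
  obtain ⟨y, hy⟩ := exists_padicInt_of_isSquare h
  refine ⟨PadicInt.toZMod y, ?_⟩
  rw [← map_mul, ← hy, map_intCast]

theorem isSquare_intCast_padic_two_of_zmod {n : ℤ} (h : n % 8 = 1) : IsSquare (n : ℚ_[2]) := by
  apply isSquare_padic_of_norm_sub_one_lt
  have h1 : ‖((n - 1 : ℤ) : ℚ_[2])‖ ≤ (2 : ℕ) ^ (-(3 : ℕ) : ℤ) := by
    apply (Padic.norm_int_le_pow_iff_dvd _ _).2
    norm_num
    omega
  have h2 : ‖(2 : ℚ_[2])‖ = 2⁻¹ := by exact_mod_cast Padic.norm_p (p := 2)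
  rw [h2]
  push_cast at h1
  refine h1.trans_lt ?_
  norm_num

theorem emod_eight_of_isSquare {n : ℤ} (hn : n % 2 = 1) (h : IsSquare (n : ℚ_[2])) :
    n % 8 = 1 := by
  obtain ⟨y, hy⟩ := exists_padicInt_of_isSquare h
  have h1 : (n : ZMod (2 ^ 3)) = PadicInt.toZModPow 3 y * PadicInt.toZModPow 3 y := by
    rw [← map_mul, ← hy, map_intCast]
  -- The condition `x * 4 ≠ 0` singles out the odd residues modulo `8`, whose only square is `1`.
  have h2 : ∀ x z : ZMod (2 ^ 3), x = z * z → x * 4 ≠ 0 → x = 1 := by decide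
  have h3 : (n : ZMod (2 ^ 3)) = 1 := by
    apply h2 _ _ h1
    intro h0
    have : ((n * 4 : ℤ) : ZMod (2 ^ 3)) = 0 := by exact_mod_cast h0
    rw [ZMod.intCast_zmod_eq_zero_iff_dvd] at this
    norm_num at this
    omega
  have h4 : ((n - 1 : ℤ) : ZMod (2 ^ 3)) = 0 := by push_cast; rw [h3, sub_self]
  rw [ZMod.intCast_zmod_eq_zero_iff_dvd] at h4
  norm_num at h4
  omega

theorem not_isSquare_two_mul_odd {n : ℤ} (hn : n % 2 = 1) :
    ¬ IsSquare ((2 * n : ℤ) : ℚ_[2]) := by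
  intro h
  have h0 : ((n : ℤ) : ℚ_[2]) ≠ 0 := by
    have : n ≠ 0 := by omega
    exact_mod_cast this
  have h1 := even_valuation_of_isSquare h
  have h2 : ‖(n : ℚ_[2])‖ = 1 := norm_intCast_eq_one_iff_not_dvd.2 (by push_cast; omega)
  rw [norm_eq_one_iff_valuation h0] at h2
  rw [Int.cast_mul, Padic.valuation_mul (by norm_num) h0, h2] at h1
  have h3 : (((2 : ℤ) : ℚ_[2])).valuation = 1 := by exact_mod_cast Padic.valuation_p (p := 2)
  rw [h3] at h1
  simp at h1

theorem isSquare_mul_trans {K : Type*} [Field K] {x y z : K} (hy : y ≠ 0)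
    (h1 : IsSquare (x * y)) (h2 : IsSquare (y * z)) : IsSquare (x * z) := by
  have h3 : IsSquare (y * y * (x * z)) := by
    have := h1.mul h2
    rwa [show x * y * (y * z) = y * y * (x * z) by ring] at this
  exact (isSquare_mul_iff_right (mul_ne_zero hy hy) (IsSquare.mul_self _)).1 h3

theorem norm_two_pos : 0 < ‖(2 : ℚ_[l])‖ := norm_pos_iff.2 two_ne_zero

theorem norm_two_sq_le_one : ‖(2 : ℚ_[l])‖ ^ 2 ≤ 1 := by
  have h2 : ‖(2 : ℚ_[l])‖ ≤ 1 := by exact_mod_cast Padic.norm_int_le_one (p := l) 2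
  exact pow_le_one₀ (norm_nonneg _) h2

theorem norm_eq_one_of_sub_lt {x y : ℚ_[l]} (hx : ‖x‖ = 1) (h : ‖x - y‖ < 1) : ‖y‖ = 1 := by
  have h1 : y = x + -(x - y) := by ring
  rw [h1, Padic.add_eq_max_of_ne (by rw [hx, norm_neg]; exact h.ne'), hx, norm_neg]
  exact max_eq_left h.le

/-- Up to squares, an element of even valuation is an integer prime to `ℓ`. -/
theorem exists_int_isSquare_mul {x : ℚ_[l]} (hx : x ≠ 0) (hv : Even x.valuation) :
    ∃ r : ℤ, ¬ (l : ℤ) ∣ r ∧ IsSquare (x * r) := by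
  obtain ⟨k, hk⟩ := hv
  have hl0 : (l : ℚ_[l]) ≠ 0 := by exact_mod_cast (Fact.out : l.Prime).ne_zero
  set c : ℚ_[l] := (l : ℚ_[l]) ^ (-k) with hc
  have hc0 : c ≠ 0 := zpow_ne_zero _ hl0
  have hcc : c * c ≠ 0 := mul_ne_zero hc0 hc0
  set u : ℚ_[l] := c * c * x with hu
  have hu0 : u ≠ 0 := mul_ne_zero hcc hx
  have hu1 : ‖u‖ = 1 := by
    rw [norm_eq_one_iff_valuation hu0, hu, Padic.valuation_mul hcc hx,
      Padic.valuation_mul hc0 hc0, hc, Padic.valuation_zpow, Padic.valuation_p, hk]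
    ring
  obtain ⟨r, hr⟩ := exists_int_norm_sub_lt hu1.le (sq_pos_of_pos (norm_two_pos (l := l)))
  have hr1 : ‖(r : ℚ_[l])‖ = 1 :=
    norm_eq_one_of_sub_lt hu1 (hr.trans_le norm_two_sq_le_one)
  refine ⟨r, norm_intCast_eq_one_iff_not_dvd.1 hr1, ?_⟩
  have hur : IsSquare (u * r) := by
    apply isSquare_mul_of_norm_sub_lt
    rw [hu1, mul_one]
    exact hr
  rw [hu, mul_assoc] at hur
  exact (isSquare_mul_iff_right hcc (IsSquare.mul_self _)).1 hur

/-- For a non-residue unit `n`, one of `x`, `n x` is a square if `x` has even valuation. -/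
theorem isSquare_or_isSquare_mul (hl : l ≠ 2) {n : ℤ} (hn : ¬ IsSquare (n : ZMod l))
    {x : ℚ_[l]} (hx : x ≠ 0) (hv : Even x.valuation) : IsSquare x ∨ IsSquare (n * x) := by
  have hn0 : ¬ (l : ℤ) ∣ n := by
    intro h
    rw [(ZMod.intCast_zmod_eq_zero_iff_dvd _ _).2 h] at hn
    exact hn (IsSquare.zero)
  obtain ⟨r, hr, hxr⟩ := exists_int_isSquare_mul hx hv
  have hr0 : (r : ℚ_[l]) ≠ 0 := by
    rintro h0
    have : r = 0 := by exact_mod_cast h0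
    exact hr (this ▸ dvd_zero _)
  by_cases h : IsSquare (r : ZMod l)
  · left
    exact (isSquare_iff_of_isSquare_mul hx hr0 hxr).2 (isSquare_intCast_of_zmod hl hr h)
  · right
    have h1 : legendreSym l (n * r) = 1 := by
      rw [legendreSym.mul, (legendreSym.eq_neg_one_iff l).2 hn, (legendreSym.eq_neg_one_iff l).2 h]
      norm_num
    have hnr : ¬ (l : ℤ) ∣ n * r := by
      intro h'
      rcases (Nat.prime_iff_prime_int.1 Fact.out).dvd_or_dvd h' with h' | h'
      exacts [hn0 h', hr h']
    have h2 := isSquare_intCast_of_zmod hl hnr ((legendreSym.eq_one_iff l (by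
      rwa [Ne, ZMod.intCast_zmod_eq_zero_iff_dvd])).1 h1)
    rw [Int.cast_mul, mul_comm] at h2
    rw [mul_comm]
    exact isSquare_mul_trans hr0 hxr h2

end PadicSquares
end TwoIsogenySelmer

namespace TwoIsogenySelmer

/-! ### The local images -/

/-- `d` lies in the image of `E(K) → Kˣ / Kˣ²`, `(X, Y) ↦ X`, for `E : Y² = X (X - a) (X - b)`.
The first two classes are the images of `O` and `(0, 0)`. -/
def LocalImage {K : Type*} [Field K] (a b d : K) : Prop :=
  IsSquare d ∨ IsSquare (a * b * d) ∨
    ∃ X : K, X ≠ 0 ∧ IsSquare (X * d) ∧ IsSquare (X * (X - a) * (X - b))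

section General

variable {K : Type*} [Field K] {a b d e : K}

theorem LocalImage.of_isSquare_mul (hd : d ≠ 0) (h : LocalImage a b d) (hde : IsSquare (d * e)) :
    LocalImage a b e := by
  rcases h with h | h | ⟨X, hX, h1, h2⟩
  · exact Or.inl ((isSquare_mul_iff_right hd h).1 hde)
  · exact Or.inr (Or.inl (isSquare_mul_trans hd h hde))
  · exact Or.inr (Or.inr ⟨X, hX, isSquare_mul_trans hd h1 hde, h2⟩)

theorem LocalImage.comm (h : LocalImage a b d) : LocalImage b a d := by
  rcases h with h | h | ⟨X, hX, h1, h2⟩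
  · exact Or.inl h
  · exact Or.inr (Or.inl (by rwa [mul_comm b a]))
  · exact Or.inr (Or.inr ⟨X, hX, h1, by rwa [mul_right_comm]⟩)

/-- Translation by the point `(0, 0)`. -/
theorem LocalImage.mul_left (ha : a ≠ 0) (hb : b ≠ 0) (h : LocalImage a b d) :
    LocalImage a b (a * b * d) := by
  rcases h with h | h | ⟨X, hX, h1, h2⟩
  · refine Or.inr (Or.inl ?_)
    rw [← mul_assoc]
    exact (IsSquare.mul_self _).mul h
  · exact Or.inl h
  · refine Or.inr (Or.inr ⟨a * b / X, div_ne_zero (mul_ne_zero ha hb) hX, ?_, ?_⟩)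
    · have : a * b / X * (a * b * d) = (a * b / X) * (a * b / X) * (X * d) := by field_simp
      rw [this]
      exact (IsSquare.mul_self _).mul h1
    · have : a * b / X * (a * b / X - a) * (a * b / X - b) =
          (a * b / (X * X)) * (a * b / (X * X)) * (X * (X - a) * (X - b)) := by
        field_simp
        ring
      rw [this]
      exact (IsSquare.mul_self _).mul h2

theorem localImage_of_isSquare_mul_left (ha : a ≠ 0) (h : IsSquare (a * d)) :
    LocalImage a b d :=
  Or.inr (Or.inr ⟨a, ha, h, by simp⟩)

theorem localImage_of_isSquare_mul_right (hb : b ≠ 0) (h : IsSquare (b * d)) :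
    LocalImage a b d :=
  Or.inr (Or.inr ⟨b, hb, h, by simp⟩)

end General

theorem localImage_real_iff {a b d : ℝ} (ha : 0 < a) (hb : 0 < b) (hd : d ≠ 0) :
    LocalImage a b d ↔ 0 < d := by
  refine ⟨fun h => ?_, fun h => Or.inl ⟨√d, (Real.mul_self_sqrt h.le).symm⟩⟩
  rcases h with h | h | ⟨X, hX, h1, h2⟩
  · exact lt_of_le_of_ne h.nonneg hd.symm
  · exact lt_of_le_of_ne (nonneg_of_mul_nonneg_right h.nonneg (mul_pos ha hb)) hd.symm
  · have hXp : 0 < X := by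
      by_contra hX'
      have hXn : X < 0 := lt_of_le_of_ne (not_lt.1 hX') hX
      have := h2.nonneg
      have h3 : 0 < (X - a) * (X - b) := mul_pos_of_neg_of_neg (by linarith) (by linarith)
      rw [mul_assoc] at this
      nlinarith
    exact lt_of_le_of_ne (nonneg_of_mul_nonneg_right h1.nonneg hXp) hd.symm

/-! ### Local images over `ℚ_ℓ`, mainly for odd `ℓ` -/

section Padic

variable {l : ℕ} [Fact l.Prime]

theorem padic_valuation_neg (x : ℚ_[l]) : (-x).valuation = x.valuation := by
  by_cases hx : x = 0
  · simp [hx]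
  · have : (-1 : ℚ_[l]).valuation = 0 := by
      rw [← norm_eq_one_iff_valuation (by norm_num)]
      simp
    rw [neg_eq_neg_one_mul, Padic.valuation_mul (by norm_num) hx, this, zero_add]

theorem valuation_sub_eq_of_lt {x y : ℚ_[l]} (hx : x ≠ 0) (h : ‖y‖ < ‖x‖) :
    x - y ≠ 0 ∧ (x - y).valuation = x.valuation := by
  have h1 : ‖x - y‖ = ‖x‖ := by
    rw [sub_eq_add_neg, Padic.add_eq_max_of_ne (by rw [norm_neg]; exact h.ne'), norm_neg]
    exact max_eq_left h.le
  have h0 : x - y ≠ 0 := norm_ne_zero_iff.1 (h1 ▸ norm_ne_zero_iff.2 hx)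
  refine ⟨h0, le_antisymm ?_ ?_⟩ <;>
  · apply not_lt.1
    rw [← norm_lt_norm_iff_valuation (by assumption) (by assumption), h1]
    exact lt_irrefl _

theorem valuation_sub_eq_of_gt {x y : ℚ_[l]} (hy : y ≠ 0) (h : ‖x‖ < ‖y‖) :
    x - y ≠ 0 ∧ (x - y).valuation = y.valuation := by
  obtain ⟨h1, h2⟩ := valuation_sub_eq_of_lt hy h
  rw [← neg_sub]
  refine ⟨neg_ne_zero.2 h1, ?_⟩
  rw [← h2, padic_valuation_neg]

theorem even_valuation_iff_of_isSquare_mul {x y : ℚ_[l]} (hx : x ≠ 0) (hy : y ≠ 0)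
    (h : IsSquare (x * y)) : Even x.valuation ↔ Even y.valuation := by
  have := even_valuation_of_isSquare h
  rw [Padic.valuation_mul hx hy] at this
  exact Int.even_add.1 this

/-- If `‖X‖ < 1` the factors `X - a`, `X - b` are units, so the product has the valuation of `X`; if
`‖X‖ > 1` all three factors have that valuation, and three times it is even. Only the unit property
of `a`, `b` matters, so `ℓ = 2` is covered as well. -/
theorem even_valuation_of_point {a b X : ℚ_[l]} (ha : ‖a‖ = 1) (hb : ‖b‖ = 1) (hX : X ≠ 0)
    (h : IsSquare (X * (X - a) * (X - b))) : Even X.valuation := by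
  have ha0 : a ≠ 0 := norm_ne_zero_iff.1 (by simp [ha])
  have hb0 : b ≠ 0 := norm_ne_zero_iff.1 (by simp [hb])
  have hav := (norm_eq_one_iff_valuation ha0).1 ha
  have hbv := (norm_eq_one_iff_valuation hb0).1 hb
  have hev := even_valuation_of_isSquare h
  rcases lt_trichotomy ‖X‖ 1 with h1 | h1 | h1
  · obtain ⟨h2, h3⟩ := valuation_sub_eq_of_gt ha0 (ha.symm ▸ h1)
    obtain ⟨h4, h5⟩ := valuation_sub_eq_of_gt hb0 (hb.symm ▸ h1)
    rw [Padic.valuation_mul (mul_ne_zero hX h2) h4, Padic.valuation_mul hX h2, h3, h5, hav,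
      hbv] at hev
    simpa using hev
  · rw [(norm_eq_one_iff_valuation hX).1 h1]
    exact Even.zero
  · obtain ⟨h2, h3⟩ := valuation_sub_eq_of_lt hX (ha.symm ▸ h1)
    obtain ⟨h4, h5⟩ := valuation_sub_eq_of_lt hX (hb.symm ▸ h1)
    rw [Padic.valuation_mul (mul_ne_zero hX h2) h4, Padic.valuation_mul hX h2, h3, h5] at hev
    rw [Int.even_iff] at *
    omega

theorem LocalImage.even_valuation {a b d : ℚ_[l]} (ha : ‖a‖ = 1) (hb : ‖b‖ = 1) (hd : d ≠ 0)
    (h : LocalImage a b d) : Even d.valuation := by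
  have ha0 : a ≠ 0 := norm_ne_zero_iff.1 (by simp [ha])
  have hb0 : b ≠ 0 := norm_ne_zero_iff.1 (by simp [hb])
  rcases h with h | h | ⟨X, hX, h1, h2⟩
  · exact even_valuation_of_isSquare h
  · rw [← even_valuation_iff_of_isSquare_mul (mul_ne_zero ha0 hb0) hd h,
      Padic.valuation_mul ha0 hb0, (norm_eq_one_iff_valuation ha0).1 ha,
      (norm_eq_one_iff_valuation hb0).1 hb]
    simp
  · rw [← even_valuation_iff_of_isSquare_mul hX hd h1]
    exact even_valuation_of_point ha hb hX h2

/-- The affine substitution `x ↦ (b - a) x + a` turns the sum into `χ(-1) J(χ, χ)`, and `J(χ, χ⁻¹) =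
-χ(-1)` with `χ⁻¹ = χ`. -/
theorem sum_quadraticChar_mul_sub {F : Type*} [Field F] [Fintype F] [DecidableEq F]
    (hF : ringChar F ≠ 2) {a b : F} (hab : a ≠ b) :
    ∑ x, quadraticChar F ((x - a) * (x - b)) = -1 := by
  have h1 := jacobiSum_nontrivial_inv (quadraticChar_ne_one hF)
  rw [(quadraticChar_isQuadratic F).inv] at h1
  have hba : b - a ≠ 0 := sub_ne_zero.2 hab.symm
  have h2 : ∑ x, quadraticChar F ((x - a) * (x - b)) =
      ∑ x, quadraticChar F (-1) * (quadraticChar F x * quadraticChar F (1 - x)) := by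
    rw [← Equiv.sum_comp ((Equiv.mulLeft₀ (b - a) hba).trans (Equiv.addRight a))]
    refine Finset.sum_congr rfl fun x _ => ?_
    have : ((Equiv.mulLeft₀ (b - a) hba).trans (Equiv.addRight a)) x = (b - a) * x + a := rfl
    rw [this, ← map_mul, ← map_mul]
    have : ((b - a) * x + a - a) * ((b - a) * x + a - b) =
        (b - a) ^ 2 * (-1 * (x * (1 - x))) := by ring
    rw [this, map_mul _ ((b - a) ^ 2), quadraticChar_sq_one' hba, one_mul]
  rw [h2, ← Finset.mul_sum]
  change _ * jacobiSum _ _ = _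
  rw [h1, mul_neg, ← sq, quadraticChar_sq_one (neg_ne_zero.2 one_ne_zero)]

/-- If `a b` is a square in a finite field, then `E` has a point with non-square abscissa. -/
theorem exists_nonsquare_point {F : Type*} [Field F] [Fintype F] (hF : ringChar F ≠ 2) {a b : F}
    (ha : a ≠ 0) (hb : b ≠ 0) (hab : a ≠ b) (hsq : IsSquare (a * b)) :
    ∃ X : F, ¬ IsSquare X ∧ IsSquare (X * (X - a) * (X - b)) := by
  classical
  by_contra! hcon
  -- Without such a point, a non-square `X` forces `χ((X - a)(X - b)) = 1 = -χ(X)`; for a non-zero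
  -- square the bound `-χ(X) = -1` is trivial; at `X = 0` the value is `χ(ab) = 1`. Summing over `X`
  -- gives `1 ≤ -1`.
  have key : ∀ X : F, -quadraticChar F X + (if X = 0 then 1 else 0) ≤
      quadraticChar F ((X - a) * (X - b)) := by
    intro X
    by_cases hX : X = 0
    · subst hX
      have : quadraticChar F (a * b) = 1 :=
        (quadraticChar_one_iff_isSquare (mul_ne_zero ha hb)).2 hsq
      simp [this]
    · rw [if_neg hX, add_zero]
      by_cases hXs : IsSquare X
      · rw [(quadraticChar_one_iff_isSquare hX).2 hXs]
        by_cases h0 : (X - a) * (X - b) = 0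
        · rw [h0, quadraticChar_zero]
          norm_num
        · rcases quadraticChar_dichotomy h0 with h | h <;> rw [h]
          norm_num
      · have h1 := quadraticChar_neg_one_iff_not_isSquare.2 (hcon X hXs)
        have h2 := quadraticChar_neg_one_iff_not_isSquare.2 hXs
        rw [mul_assoc, map_mul, h2] at h1
        rw [h2]
        linarith
  have h1 := Finset.sum_le_sum fun X (_ : X ∈ Finset.univ) => key X
  rw [sum_quadraticChar_mul_sub hF hab, Finset.sum_add_distrib, Finset.sum_neg_distrib,
    quadraticChar_sum_zero hF] at h1
  simp at h1

/-- Otherwise the successor of a square is always a square, and induction from `0` makes every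
residue a square. -/
theorem exists_not_isSquare_and_isSquare_sub_one (hl : l ≠ 2) :
    ∃ x : ZMod l, ¬ IsSquare x ∧ IsSquare (x - 1) := by
  by_contra! hcon
  have h1 : ∀ n : ℕ, IsSquare (n : ZMod l) := by
    intro n
    induction n with
    | zero => simp
    | succ n ih =>
      by_contra h
      refine hcon _ h ?_
      simpa using ih
  obtain ⟨x, hx⟩ := quadraticChar_exists_neg_one (F := ZMod l) (by rwa [ZMod.ringChar_zmod_n])
  rw [quadraticChar_neg_one_iff_not_isSquare] at hx
  obtain ⟨n, rfl⟩ := ZMod.natCast_zmod_surjective x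
  exact hx (h1 n)

theorem intCast_zmod_ne_zero {n : ℤ} (hn : ¬ (l : ℤ) ∣ n) : (n : ZMod l) ≠ 0 := by
  rwa [Ne, ZMod.intCast_zmod_eq_zero_iff_dvd]

theorem intCast_padic_ne_zero {n : ℤ} (hn : ¬ (l : ℤ) ∣ n) : (n : ℚ_[l]) ≠ 0 := by
  intro h
  have : n = 0 := by exact_mod_cast h
  exact hn (this ▸ dvd_zero _)

theorem not_dvd_of_not_isSquare {n : ℤ} (hn : ¬ IsSquare (n : ZMod l)) : ¬ (l : ℤ) ∣ n := by
  intro h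
  rw [(ZMod.intCast_zmod_eq_zero_iff_dvd _ _).2 h] at hn
  exact hn IsSquare.zero

/-- For odd `ℓ` the classes of even valuation are just those of `1` and `n`, so one non-residue unit
in the image suffices. -/
theorem localImage_of_nonresidue (hl : l ≠ 2) {a b d : ℚ_[l]} {n : ℤ}
    (hn : ¬ IsSquare (n : ZMod l)) (h : LocalImage a b n) (hd : d ≠ 0) (hv : Even d.valuation) :
    LocalImage a b d := by
  rcases isSquare_or_isSquare_mul hl hn hd hv with h1 | h1
  · exact Or.inl h1
  · exact h.of_isSquare_mul (intCast_padic_ne_zero (not_dvd_of_not_isSquare hn)) h1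

theorem not_isSquare_mul_zmod {m n : ℤ} (hm : ¬ IsSquare (m : ZMod l)) (h0 : (n : ZMod l) ≠ 0)
    (hn : IsSquare (n : ZMod l)) : ¬ IsSquare ((m * n : ℤ) : ZMod l) := by
  rw [Int.cast_mul, mul_comm, isSquare_mul_iff_right h0 hn]
  exact hm

/-- Good reduction at an odd prime: all classes of even valuation are local images. -/
theorem localImage_of_good_reduction (hl : l ≠ 2) {a b : ℤ} (ha : ¬ (l : ℤ) ∣ a)
    (hb : ¬ (l : ℤ) ∣ b) (hab : ¬ (l : ℤ) ∣ a - b) {d : ℚ_[l]} (hd : d ≠ 0)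
    (hv : Even d.valuation) : LocalImage (a : ℚ_[l]) b d := by
  have ha0 := intCast_zmod_ne_zero ha
  have hb0 := intCast_zmod_ne_zero hb
  by_cases hsq : IsSquare ((a * b : ℤ) : ZMod l)
  · have hab0 : (a : ZMod l) ≠ b := by
      have := intCast_zmod_ne_zero hab
      rwa [Int.cast_sub, sub_ne_zero] at this
    rw [Int.cast_mul] at hsq
    obtain ⟨X, hX, hXs⟩ :=
      exists_nonsquare_point (by rwa [ZMod.ringChar_zmod_n]) ha0 hb0 hab0 hsq
    obtain ⟨n, rfl⟩ := ZMod.intCast_surjective X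
    -- A point reducing to a `2`-torsion point cannot be lifted through a non-zero square residue,
    -- but then `a` (or `b`) is itself the required non-residue abscissa. If `ab` is a non-residue,
    -- the class of `(0, 0)` does the job instead.
    by_cases hna : (n : ZMod l) = a
    · rw [hna] at hX
      exact localImage_of_nonresidue hl hX (localImage_of_isSquare_mul_left
        (intCast_padic_ne_zero ha) (IsSquare.mul_self _)) hd hv
    by_cases hnb : (n : ZMod l) = b
    · rw [hnb] at hX
      exact localImage_of_nonresidue hl hX (localImage_of_isSquare_mul_right
        (intCast_padic_ne_zero hb) (IsSquare.mul_self _)) hd hv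
    refine localImage_of_nonresidue hl hX (Or.inr (Or.inr ⟨n, ?_, IsSquare.mul_self _, ?_⟩)) hd hv
    · exact intCast_padic_ne_zero (not_dvd_of_not_isSquare hX)
    · have hn0 : ((n * (n - a) * (n - b) : ℤ) : ZMod l) ≠ 0 := by
        push_cast
        refine mul_ne_zero (mul_ne_zero ?_ (sub_ne_zero.2 hna)) (sub_ne_zero.2 hnb)
        exact intCast_zmod_ne_zero (not_dvd_of_not_isSquare hX)
      rw [Ne, ZMod.intCast_zmod_eq_zero_iff_dvd] at hn0
      have := isSquare_intCast_of_zmod hl hn0 (by push_cast; exact hXs)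
      push_cast at this
      exact this
  · refine localImage_of_nonresidue hl hsq (Or.inr (Or.inl ?_)) hd hv
    rw [Int.cast_mul]
    exact IsSquare.mul_self _

/-- Multiplicative reduction with exactly one of `a`, `b` divisible by `ℓ`, to odd order: all
classes are local images. -/
theorem localImage_of_multiplicative_reduction (hl : l ≠ 2) {a b : ℤ}
    (ha : Odd (a : ℚ_[l]).valuation) (hla : (l : ℤ) ∣ a) (hb : ¬ (l : ℤ) ∣ b) {d : ℚ_[l]}
    (hd : d ≠ 0) : LocalImage (a : ℚ_[l]) b d := by
  have ha0 : (a : ℚ_[l]) ≠ 0 := by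
    rintro h
    simp [h] at ha
  have hb0 := intCast_padic_ne_zero hb
  -- Since `ab` has odd valuation, translation by `(0, 0)` exchanges classes of odd and of even
  -- valuation.
  suffices H : ∀ e : ℚ_[l], e ≠ 0 → Even e.valuation → LocalImage (a : ℚ_[l]) b e by
    rcases Int.even_or_odd d.valuation with hv | hv
    · exact H d hd hv
    · have h1 := (H (a * b * d) (mul_ne_zero (mul_ne_zero ha0 hb0) hd) (by
        rw [Padic.valuation_mul (mul_ne_zero ha0 hb0) hd, Padic.valuation_mul ha0 hb0,
          (norm_eq_one_iff_valuation hb0).1 (norm_intCast_eq_one_iff_not_dvd.2 hb), add_zero]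
        exact ha.add_odd hv)).mul_left ha0 hb0
      refine h1.of_isSquare_mul ?_ ⟨a * b * d, by ring⟩
      simp [ha0, hb0, hd]
  intro e he hv
  by_cases hbs : IsSquare (b : ZMod l)
  · obtain ⟨x, hx, hx1⟩ := exists_not_isSquare_and_isSquare_sub_one hl
    obtain ⟨n, rfl⟩ := ZMod.intCast_surjective x
    have hb1 := intCast_zmod_ne_zero hb
    have hn1 := intCast_zmod_ne_zero (not_dvd_of_not_isSquare hx)
    have hnb := not_isSquare_mul_zmod hx hb1 hbs
    have ha1 : (a : ZMod l) = 0 := (ZMod.intCast_zmod_eq_zero_iff_dvd _ _).2 hla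
    refine localImage_of_nonresidue hl hnb (Or.inr (Or.inr ⟨_, ?_, IsSquare.mul_self _, ?_⟩)) he hv
    · exact intCast_padic_ne_zero (not_dvd_of_not_isSquare hnb)
    · have h0 : ((n * b * (n * b - a) * (n * b - b) : ℤ) : ZMod l) =
          ((n * b) * (n * b)) * (b * (n - 1)) := by
        push_cast
        rw [ha1]
        ring
      have h1 : (n : ZMod l) - 1 ≠ 0 := by
        intro h
        rw [sub_eq_zero.1 h] at hx
        exact hx ⟨1, by simp⟩
      have h2 : ((n * b * (n * b - a) * (n * b - b) : ℤ) : ZMod l) ≠ 0 := by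
        rw [h0]
        exact mul_ne_zero (mul_ne_zero (mul_ne_zero hn1 hb1) (mul_ne_zero hn1 hb1))
          (mul_ne_zero hb1 h1)
      rw [Ne, ZMod.intCast_zmod_eq_zero_iff_dvd] at h2
      have := isSquare_intCast_of_zmod hl h2 (by
        rw [h0]
        exact (IsSquare.mul_self _).mul (hbs.mul hx1))
      push_cast at this ⊢
      exact this
  · exact localImage_of_nonresidue hl hbs (localImage_of_isSquare_mul_right hb0
      (IsSquare.mul_self _)) he hv

/-- The torsion points already suffice: `(0, 0)` has the class `ab`, that of the non-residue unit
`n`, and `(a, 0)` has odd valuation, so together they generate `ℚ_ℓˣ/ℚ_ℓˣ²`. -/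
theorem localImage_of_additive_reduction_of_nonresidue (hl : l ≠ 2) {a b d : ℚ_[l]}
    (ha : Odd a.valuation) (hb : b ≠ 0) {n : ℤ} (hn : ¬ IsSquare (n : ZMod l))
    (hnab : IsSquare (n * (a * b))) (hd : d ≠ 0) : LocalImage a b d := by
  have ha0 : a ≠ 0 := by
    rintro rfl
    simp at ha
  have hn0 := intCast_padic_ne_zero (not_dvd_of_not_isSquare hn)
  rcases Int.even_or_odd d.valuation with hv | hv
  · refine localImage_of_nonresidue hl hn (Or.inr (Or.inl ?_)) hd hv
    rwa [mul_comm]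
  · rcases isSquare_or_isSquare_mul hl hn (mul_ne_zero ha0 hd) (by
      rw [Padic.valuation_mul ha0 hd]
      exact ha.add_odd hv) with h | h
    · exact localImage_of_isSquare_mul_left ha0 h
    · refine localImage_of_isSquare_mul_right hb ?_
      have h1 : IsSquare (a * b * (a * d)) := by
        rw [mul_comm] at hnab
        exact isSquare_mul_trans hn0 hnab h
      rw [show a * b * (a * d) = a * a * (b * d) by ring] at h1
      exact (isSquare_mul_iff_right (mul_ne_zero ha0 ha0) (IsSquare.mul_self _)).1 h1

theorem isSquare_mul_of_lt (hl : l ≠ 2) {x y : ℚ_[l]} (h : ‖x - y‖ < ‖x‖) : IsSquare (x * y) := by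
  apply isSquare_mul_of_norm_sub_lt
  rwa [norm_two_of_odd hl, one_pow, one_mul]

/-- If `v(X) < 1`, both `X - a` and `X - b` have the class of `X`; if `v(X) > 1`, they have the
classes of `-a` and `-b`. Either way `(X - a)(X - b)` is a square, hence so is `X`. If `v(X) = 1`,
parity of the total valuation makes `X - a` or `X - b` have valuation above `1`, so `X` has the
class of `a` or of `b`, and these agree. -/
theorem isSquare_or_of_point (hl : l ≠ 2) {a b X : ℚ_[l]} (ha : a.valuation = 1)
    (hb : b.valuation = 1) (hab : IsSquare (a * b)) (hX : X ≠ 0)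
    (h : IsSquare (X * (X - a) * (X - b))) : IsSquare X ∨ IsSquare (X * a) := by
  have ha0 : a ≠ 0 := by
    rintro rfl
    simp at ha
  have hb0 : b ≠ 0 := by
    rintro rfl
    simp at hb
  by_cases hXa : X - a = 0
  · rw [sub_eq_zero.1 hXa]
    exact Or.inr (IsSquare.mul_self _)
  by_cases hXb : X - b = 0
  · rw [sub_eq_zero.1 hXb, mul_comm]
    exact Or.inr hab
  have hor : ‖a‖ < ‖X‖ ∨ ‖X‖ < ‖a‖ ∨ X.valuation = 1 := by
    rw [norm_lt_norm_iff_valuation ha0 hX, norm_lt_norm_iff_valuation hX ha0]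
    omega
  have habn : ‖a‖ = ‖b‖ := by
    rw [Padic.norm_eq_zpow_neg_valuation ha0, Padic.norm_eq_zpow_neg_valuation hb0, ha, hb]
  have key : IsSquare ((X - a) * (X - b)) → IsSquare X := by
    intro h'
    rw [mul_assoc, mul_comm] at h
    exact (isSquare_mul_iff_right (mul_ne_zero hXa hXb) h').1 h
  rcases hor with h1 | h1 | h1
  · left
    apply key
    refine isSquare_mul_trans hX (y := X) ?_ ?_
    · rw [mul_comm]
      apply isSquare_mul_of_lt hl
      simpa using h1
    · apply isSquare_mul_of_lt hl
      simpa [← habn] using h1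
  · left
    apply key
    have h2 : IsSquare (a * (a - X)) := isSquare_mul_of_lt hl (by simpa using h1)
    have h3 : IsSquare (b * (b - X)) := isSquare_mul_of_lt hl (by simpa [← habn] using h1)
    have h4 : IsSquare ((a - X) * (b - X)) :=
      isSquare_mul_trans hb0 (isSquare_mul_trans ha0 (by rwa [mul_comm]) hab) h3
    rwa [show (X - a) * (X - b) = (a - X) * (b - X) by ring]
  · right
    have hev := even_valuation_of_isSquare h
    rw [Padic.valuation_mul (mul_ne_zero hX hXa) hXb, Padic.valuation_mul hX hXa, h1] at hev
    have h2 : X.valuation < (X - a).valuation ∨ X.valuation < (X - b).valuation := by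
      have h3 := Padic.le_valuation_add (x := X) (y := -a) (by rwa [← sub_eq_add_neg])
      have h4 := Padic.le_valuation_add (x := X) (y := -b) (by rwa [← sub_eq_add_neg])
      rw [← sub_eq_add_neg, padic_valuation_neg] at h3 h4
      rw [Int.even_iff] at hev
      omega
    rcases h2 with h2 | h2
    · rw [← norm_lt_norm_iff_valuation hXa hX] at h2
      exact isSquare_mul_of_lt hl h2
    · rw [← norm_lt_norm_iff_valuation hXb hX] at h2
      exact isSquare_mul_trans hb0 (isSquare_mul_of_lt hl h2) (by rwa [mul_comm])

theorem localImage_iff_of_additive_reduction_of_isSquare (hl : l ≠ 2) {a b d : ℚ_[l]}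
    (ha : a.valuation = 1) (hb : b.valuation = 1) (hab : IsSquare (a * b)) :
    LocalImage a b d ↔ IsSquare d ∨ IsSquare (a * d) := by
  have ha0 : a ≠ 0 := by
    rintro rfl
    simp at ha
  have hb0 : b ≠ 0 := by
    rintro rfl
    simp at hb
  refine ⟨?_, fun h => h.elim Or.inl (localImage_of_isSquare_mul_left ha0)⟩
  rintro (h | h | ⟨X, hX, h1, h2⟩)
  · exact Or.inl h
  · exact Or.inl ((isSquare_mul_iff_right (mul_ne_zero ha0 hb0) hab).1 h)
  · rcases isSquare_or_of_point hl ha hb hab hX h2 with h3 | h3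
    · exact Or.inl ((isSquare_mul_iff_right hX h3).1 h1)
    · rw [mul_comm] at h3
      exact Or.inr (isSquare_mul_trans hX h3 h1)

end Padic
end TwoIsogenySelmer

namespace TwoIsogenySelmer

/-! ### The local image at `2` -/

section Two

theorem norm_two_padic : ‖(2 : ℚ_[2])‖ = 2⁻¹ := by exact_mod_cast Padic.norm_p (p := 2)

theorem norm_odd_padic_two {n : ℤ} (hn : n % 2 = 1) : ‖(n : ℚ_[2])‖ = 1 :=
  norm_intCast_eq_one_iff_not_dvd.2 (by push_cast; omega)

theorem norm_even_padic_two_le {n : ℤ} (hn : n % 2 = 0) : ‖(n : ℚ_[2])‖ ≤ 2⁻¹ := by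
  have := (Padic.norm_int_le_pow_iff_dvd (p := 2) n 1).2 (by norm_num; omega)
  simpa using this

theorem intCast_padic_two_ne_zero {n : ℤ} (hn : n % 2 = 1) : (n : ℚ_[2]) ≠ 0 :=
  intCast_padic_ne_zero (by push_cast; omega)

theorem isSquare_mul_of_norm_sub_lt_two {x y : ℚ_[2]} (h : ‖x - y‖ < ‖x‖ / 4) :
    IsSquare (x * y) := by
  apply isSquare_mul_of_norm_sub_lt
  rw [norm_two_padic]
  linarith

theorem norm_le_of_even_valuation {X : ℚ_[2]} (hX : X ≠ 0) (hv : Even X.valuation) :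
    ‖X‖ = 1 ∨ ‖X‖ ≤ 4⁻¹ ∨ 4 ≤ ‖X‖ := by
  obtain ⟨k, hk⟩ := hv
  have h2 : ∀ i j : ℤ, i ≤ j → (2 : ℝ) ^ i ≤ 2 ^ j := fun i j hij =>
    zpow_le_zpow_right₀ one_le_two hij
  rw [Padic.norm_eq_zpow_neg_valuation hX, hk, Nat.cast_ofNat]
  rcases lt_trichotomy k 0 with h | h | h
  · right; right
    exact le_trans (by norm_num) (h2 2 _ (by omega))
  · left
    simp [h]
  · right; left
    exact le_trans (h2 _ (-2) (by omega)) (by norm_num)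

theorem norm_sub_intCast_pos {X : ℚ_[2]} {a : ℤ} (h : X ≠ a) : 0 < ‖X - a‖ :=
  norm_pos_iff.2 (sub_ne_zero.2 h)

/-- The valuation of `X` is even. A unit `X` is replaced by an integer so near that the classes of
`X`, `X - a` and `X - b` persist. For `‖X‖ ≤ 1/4` the factor `(X - a)(X - b)` has the class of `ab`,
because `a + b` is even; for `‖X‖ ≥ 4` it has the class of `X²`. -/
theorem exists_int_odd_point {a b : ℤ} (ha : a % 2 = 1) (hb : b % 2 = 1) {X : ℚ_[2]} (hX : X ≠ 0)
    (h : IsSquare (X * (X - a) * (X - b))) :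
    IsSquare X ∨ IsSquare (a * b * X) ∨ ∃ n : ℤ, n % 2 = 1 ∧ IsSquare (X * n) ∧
      IsSquare ((n * (n - a) * (n - b) : ℤ) : ℚ_[2]) := by
  by_cases hXa : X = a
  · refine Or.inr (Or.inr ⟨a, ha, ?_, by simp⟩)
    rw [hXa]
    exact IsSquare.mul_self _
  by_cases hXb : X = b
  · refine Or.inr (Or.inr ⟨b, hb, ?_, by simp⟩)
    rw [hXb]
    exact IsSquare.mul_self _
  have han := norm_odd_padic_two ha
  have hbn := norm_odd_padic_two hb
  have ha0 := intCast_padic_two_ne_zero ha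
  have hb0 := intCast_padic_two_ne_zero hb
  have hab : ‖(a + b : ℚ_[2])‖ ≤ 2⁻¹ := by
    exact_mod_cast norm_even_padic_two_le (n := a + b) (by omega)
  have hprod : (X - a) * (X - b) ≠ 0 := mul_ne_zero (sub_ne_zero.2 hXa) (sub_ne_zero.2 hXb)
  rw [mul_assoc] at h
  rcases norm_le_of_even_valuation hX (even_valuation_of_point han hbn hX (by rwa [mul_assoc]))
    with h1 | h1 | h1
  · right; right
    have hXa' := norm_sub_intCast_pos hXa
    have hXb' := norm_sub_intCast_pos hXb
    obtain ⟨n, hn⟩ := exists_int_norm_sub_lt h1.le (ε := min (1 / 4) (min (‖X - a‖ / 4)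
      (‖X - b‖ / 4))) (by positivity)
    rw [lt_min_iff, lt_min_iff] at hn
    have hn1 : ‖(n : ℚ_[2])‖ = 1 := norm_eq_one_of_sub_lt h1 (by linarith [hn.1])
    have hXn : IsSquare (X * n) := isSquare_mul_of_norm_sub_lt_two (by rw [h1]; exact hn.1)
    refine ⟨n, ?_, hXn, ?_⟩
    · have := norm_intCast_eq_one_iff_not_dvd.1 hn1
      push_cast at this
      omega
    · have h2 : IsSquare ((X - a) * (n - a)) := isSquare_mul_of_norm_sub_lt_two (by
        rw [sub_sub_sub_cancel_right]; exact hn.2.1)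
      have h3 : IsSquare ((X - b) * (n - b)) := isSquare_mul_of_norm_sub_lt_two (by
        rw [sub_sub_sub_cancel_right]; exact hn.2.2)
      have h4 := hXn.mul (h2.mul h3)
      rw [show X * n * ((X - a) * (n - a) * ((X - b) * (n - b))) =
        X * ((X - a) * (X - b)) * (n * (n - a) * (n - b)) by ring] at h4
      push_cast
      exact (isSquare_mul_iff_right (mul_ne_zero hX hprod) h).1 h4
  · right; left
    have h2 : IsSquare (a * b * ((X - a) * (X - b))) := by
      apply isSquare_mul_of_norm_sub_lt_two
      rw [norm_mul, han, hbn, show (a * b - (X - a) * (X - b) : ℚ_[2]) = X * ((a + b) + -X) by ring,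
        norm_mul]
      have h3 : ‖(a + b : ℚ_[2]) + -X‖ ≤ 2⁻¹ := by
        refine (Padic.nonarchimedean _ _).trans (max_le hab ?_)
        rw [norm_neg]
        exact h1.trans (by norm_num)
      calc ‖X‖ * ‖(a + b : ℚ_[2]) + -X‖ ≤ 4⁻¹ * 2⁻¹ := by gcongr
        _ < _ := by norm_num
    rw [mul_comm X] at h
    exact isSquare_mul_trans hprod h2 h
  · left
    have h2 : IsSquare (X * X * ((X - a) * (X - b))) := by
      apply isSquare_mul_of_norm_sub_lt_two
      rw [show X * X - (X - a) * (X - b) = (a + b) * X + -(a * b) by ring, norm_mul X X]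
      refine (Padic.nonarchimedean _ _).trans_lt (max_lt ?_ ?_)
      · rw [norm_mul]
        calc ‖(a + b : ℚ_[2])‖ * ‖X‖ ≤ 2⁻¹ * ‖X‖ := by gcongr
          _ < _ := by nlinarith
      · rw [norm_neg, norm_mul, han, hbn]
        nlinarith
    have h3 := (isSquare_mul_iff_right (mul_ne_zero hX hX) (IsSquare.mul_self _)).1 h2
    rw [mul_comm] at h
    exact (isSquare_mul_iff_right hprod h3).1 h

theorem mul_emod_eight_iff {x y : ℤ} (hx : x % 2 = 1) (hy : y % 2 = 1) :
    (x * y) % 8 = 1 ↔ x % 8 = y % 8 := by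
  have h1 : x % 8 = 1 ∨ x % 8 = 3 ∨ x % 8 = 5 ∨ x % 8 = 7 := by omega
  have h2 : y % 8 = 1 ∨ y % 8 = 3 ∨ y % 8 = 5 ∨ y % 8 = 7 := by omega
  rw [Int.mul_emod]
  rcases h1 with h1 | h1 | h1 | h1 <;> rcases h2 with h2 | h2 | h2 | h2 <;> rw [h1, h2] <;> norm_num

theorem mul_emod_two {x y : ℤ} (hx : x % 2 = 1) (hy : y % 2 = 1) : (x * y) % 2 = 1 := by
  rw [Int.mul_emod, hx, hy]
  rfl

/-- For odd `d`, `d` is a local image at `2` iff `d ≡ 1`, `d ≡ a b` or `d ≡ n` modulo `8` for an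
integral abscissa `n`. -/
theorem localImage_two_iff {a b d : ℤ} (ha : a % 2 = 1) (hb : b % 2 = 1) (hd : d % 2 = 1) :
    LocalImage (a : ℚ_[2]) b d ↔ d % 8 = 1 ∨ d % 8 = (a * b) % 8 ∨
      ∃ n : ℤ, n % 8 = d % 8 ∧ IsSquare ((n * (n - a) * (n - b) : ℤ) : ℚ_[2]) := by
  have hab := mul_emod_two ha hb
  have hsq : IsSquare (a * b * d : ℚ_[2]) ↔ d % 8 = (a * b) % 8 := by
    rw [eq_comm, ← mul_emod_eight_iff hab hd]
    refine ⟨fun h => emod_eight_of_isSquare (mul_emod_two hab hd) (by exact_mod_cast h),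
      fun h => by exact_mod_cast isSquare_intCast_padic_two_of_zmod h⟩
  constructor
  · rintro (h | h | ⟨X, hX, h1, h2⟩)
    · exact Or.inl (emod_eight_of_isSquare hd h)
    · exact Or.inr (Or.inl (hsq.1 h))
    · rcases exists_int_odd_point ha hb hX h2 with h3 | h3 | ⟨n, hn, h3, h4⟩
      · exact Or.inl (emod_eight_of_isSquare hd ((isSquare_mul_iff_right hX h3).1 h1))
      · exact Or.inr (Or.inl (hsq.1 (isSquare_mul_trans hX h3 h1)))
      · refine Or.inr (Or.inr ⟨n, ?_, h4⟩)
        rw [← mul_emod_eight_iff hn hd]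
        apply emod_eight_of_isSquare (mul_emod_two hn hd)
        rw [Int.cast_mul]
        rw [mul_comm] at h3
        exact isSquare_mul_trans hX h3 h1
  · rintro (h | h | ⟨n, hn, h⟩)
    · exact Or.inl (isSquare_intCast_padic_two_of_zmod h)
    · exact Or.inr (Or.inl (hsq.2 h))
    · refine Or.inr (Or.inr ⟨n, intCast_padic_two_ne_zero (by omega), ?_, by exact_mod_cast h⟩)
      exact_mod_cast isSquare_intCast_padic_two_of_zmod
        ((mul_emod_eight_iff (by omega) hd).2 hn)

theorem isSquare_four_mul_iff {n : ℤ} : IsSquare ((4 * n : ℤ) : ℚ_[2]) ↔ IsSquare (n : ℚ_[2]) := by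
  rw [Int.cast_mul]
  exact isSquare_mul_iff_right (by norm_num) ⟨2, by norm_num⟩

/-- Expand the product: the square of the odd `u` is `1` modulo `8`, and the cross term `2 f u n` is
`2 f` modulo `4` because `u n` is odd. -/
theorem mul_sub_mul_emod_four {u f n : ℤ} (hu : u % 2 = 1) (hn : n % 2 = 1) :
    (u * (u - 2 * f) * n) % 4 = (n - 2 * f) % 4 := by
  obtain ⟨i, rfl⟩ : ∃ i, u = 2 * i + 1 := ⟨u / 2, by omega⟩
  obtain ⟨j, rfl⟩ : ∃ j, n = 2 * j + 1 := ⟨n / 2, by omega⟩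
  apply Int.emod_emod_of_dvd _ (dvd_refl 4) |>.symm.trans
  rw [Int.emod_emod_of_dvd _ (dvd_refl 4)]
  apply Int.ModEq.symm
  rw [Int.modEq_iff_dvd]
  exact ⟨(i * i + i) * (2 * j + 1) - f * (2 * i * j + i + j), by ring⟩

theorem mul_sub_mul_emod_eight {u g n : ℤ} (hu : u % 2 = 1) (hn : n % 2 = 1) :
    (u * (u - 4 * g) * n) % 8 = (n - 4 * g) % 8 := by
  obtain ⟨i, rfl⟩ : ∃ i, u = 2 * i + 1 := ⟨u / 2, by omega⟩
  obtain ⟨j, rfl⟩ : ∃ j, n = 2 * j + 1 := ⟨n / 2, by omega⟩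
  obtain ⟨k, hk⟩ : ∃ k, i * i + i = 2 * k := by
    obtain ⟨k, hk⟩ := Int.even_mul_succ_self i
    exact ⟨k, by linarith⟩
  apply Int.ModEq.symm
  rw [Int.modEq_iff_dvd]
  exact ⟨k * (2 * j + 1) - g * (2 * i * j + i + j), by linear_combination 4 * (2 * j + 1) * hk⟩

/-- `n` is the abscissa of a `2`-adic point, `b = a + 2 e`. -/
theorem isSquare_point_iff {a b e n u : ℤ} (hb : b = a + 2 * e) (hu : n = a + 2 * u) :
    IsSquare ((n * (n - a) * (n - b) : ℤ) : ℚ_[2]) ↔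
      IsSquare ((u * (u - e) * n : ℤ) : ℚ_[2]) := by
  rw [show n * (n - a) * (n - b) = 4 * (u * (u - e) * n) by subst hb hu; ring,
    isSquare_four_mul_iff]

theorem isSquare_point_iff' {a b f n w : ℤ} (hb : b = a + 4 * f) (hw : n = a + 4 * w) :
    IsSquare ((n * (n - a) * (n - b) : ℤ) : ℚ_[2]) ↔
      IsSquare ((w * (w - f) * n : ℤ) : ℚ_[2]) := by
  rw [isSquare_point_iff (e := 2 * f) (u := 2 * w) (by rw [hb]; ring) (by rw [hw]; ring),
    show 2 * w * (2 * w - 2 * f) * n = 4 * (w * (w - f) * n) by ring, isSquare_four_mul_iff]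

/-- The abscissas of odd points if `4 ∣ b - a`: the two cases `n ≡ a + 2` and `n ≡ a` mod `4`. -/
theorem point_cases {a f n : ℤ} (ha : a % 2 = 1) (hn : n % 2 = 1)
    (h : IsSquare ((n * (n - a) * (n - (a + 4 * f)) : ℤ) : ℚ_[2])) :
    (∃ u, u % 2 = 1 ∧ n = a + 2 * u ∧ (u * (u - 2 * f) * n) % 8 = 1) ∨
    (∃ w, n = a + 4 * w ∧ IsSquare ((w * (w - f) * n : ℤ) : ℚ_[2])) := by
  obtain ⟨u, hu⟩ : ∃ u, n = a + 2 * u := ⟨(n - a) / 2, by omega⟩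
  rcases Int.emod_two_eq_zero_or_one u with hu2 | hu2
  · right
    obtain ⟨w, rfl⟩ : ∃ w, u = 2 * w := ⟨u / 2, by omega⟩
    have hw : n = a + 4 * w := by omega
    exact ⟨w, hw, (isSquare_point_iff' rfl hw).1 h⟩
  · left
    rw [isSquare_point_iff (e := 2 * f) (by ring) hu] at h
    exact ⟨u, hu2, hu, emod_eight_of_isSquare
      (mul_emod_two (mul_emod_two hu2 (by omega)) hn) h⟩

/-- Exactly one of `u` and `u - D` is even. If `4` does not divide it, the value has valuation one
and is no square; so `n ≡ a` or `n ≡ b` modulo `8`, and only `O` and the torsion points contribute.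
-/
theorem localImage_two_iff_of_exponent_one {a D d : ℤ} (ha : a % 2 = 1) (hD : D % 2 = 1)
    (hd : d % 2 = 1) : LocalImage (a : ℚ_[2]) ((a + 2 * D : ℤ) : ℚ_[2]) d ↔
      d % 8 = 1 ∨ d % 8 = (a * (a + 2 * D)) % 8 ∨ d % 8 = a % 8 ∨ d % 8 = (a + 2 * D) % 8 := by
  rw [localImage_two_iff ha (by omega) hd]
  refine or_congr_right (or_congr_right ⟨?_, ?_⟩)
  · rintro ⟨n, hn, h⟩
    obtain ⟨u, hu⟩ : ∃ u, n = a + 2 * u := ⟨(n - a) / 2, by omega⟩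
    rw [isSquare_point_iff rfl hu] at h
    have hn2 : n % 2 = 1 := by omega
    rcases Int.emod_two_eq_zero_or_one u with hu2 | hu2
    · obtain ⟨w, rfl⟩ : ∃ w, u = 2 * w := ⟨u / 2, by omega⟩
      rcases Int.emod_two_eq_zero_or_one w with hw | hw
      · omega
      · rw [show 2 * w * (2 * w - D) * n = 2 * (w * (2 * w - D) * n) by ring] at h
        exact absurd h (not_isSquare_two_mul_odd
          (mul_emod_two (mul_emod_two hw (by omega)) hn2))
    · obtain ⟨w, hw⟩ : ∃ w, u = D + 2 * w := ⟨(u - D) / 2, by omega⟩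
      rcases Int.emod_two_eq_zero_or_one w with hw2 | hw2
      · omega
      · rw [show u * (u - D) * n = 2 * (u * w * n) by rw [hw]; ring] at h
        exact absurd h (not_isSquare_two_mul_odd (mul_emod_two (mul_emod_two hu2 hw2) hn2))
  · rintro (h | h)
    · exact ⟨a, h.symm, by simp⟩
    · exact ⟨a + 2 * D, h.symm, by simp⟩

theorem mul_add_emod_eight {a k : ℤ} (ha : a % 2 = 1) :
    (a * (a + 4 * k)) % 8 = (1 + 4 * k) % 8 := by
  have h1 := mul_sub_mul_emod_eight (g := -k) ha (n := 1) rfl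
  rw [show a * (a - 4 * -k) * 1 = a * (a + 4 * k) by ring] at h1
  rw [h1]
  congr 1
  ring

/-- Here `ab ≡ 5` modulo `8`, so `1` and `ab` give both classes `1` modulo `4`. One abscissa `n ≡ 3`
modulo `4`, namely `a` or `a + 2`, and its translate by `ab` give the other two. -/
theorem localImage_two_of_exponent_two {a D d : ℤ} (hD : D % 2 = 1) (hd : d % 2 = 1)
    (h : a % 4 = 3 ∨ D % 4 = 1 ∧ a % 8 = 5 ∨ D % 4 = 3 ∧ a % 8 = 1) :
    LocalImage (a : ℚ_[2]) ((a + 4 * D : ℤ) : ℚ_[2]) d := by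
  have ha : a % 2 = 1 := by omega
  rcases (by omega : d % 4 = 1 ∨ d % 4 = 3) with hd4 | hd4
  · rw [localImage_two_iff ha (by omega) hd, mul_add_emod_eight ha]
    omega
  have key : ∃ n : ℤ, n % 4 = 3 ∧
      IsSquare ((n * (n - a) * (n - (a + 4 * D)) : ℤ) : ℚ_[2]) := by
    by_cases ha4 : a % 4 = 3
    · exact ⟨a, ha4, by simp⟩
    · refine ⟨a + 2, by omega, ?_⟩
      rw [isSquare_point_iff (e := 2 * D) (u := 1) (by ring) (by ring)]
      apply isSquare_intCast_padic_two_of_zmod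
      have h1 : D % 4 = 1 ∧ a % 8 = 5 ∨ D % 4 = 3 ∧ a % 8 = 1 := by omega
      rcases h1 with ⟨h1, h2⟩ | ⟨h1, h2⟩
      · rw [one_mul, Int.mul_emod, show (1 - 2 * D) % 8 = 7 by omega,
          show (a + 2) % 8 = 7 by omega]
        rfl
      · rw [one_mul, Int.mul_emod, show (1 - 2 * D) % 8 = 3 by omega,
          show (a + 2) % 8 = 3 by omega]
        rfl
  obtain ⟨n, hn, hsq⟩ := key
  have hb : (a + 4 * D) % 2 = 1 := by omega
  by_cases hnd : n % 8 = d % 8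
  · exact (localImage_two_iff ha hb hd).2 (Or.inr (Or.inr ⟨n, hnd, hsq⟩))
  · have ha0 := intCast_padic_two_ne_zero ha
    have hb0 := intCast_padic_two_ne_zero hb
    have h1 : LocalImage (a : ℚ_[2]) ((a + 4 * D : ℤ) : ℚ_[2]) n :=
      (localImage_two_iff ha hb (by omega)).2 (Or.inr (Or.inr ⟨n, rfl, hsq⟩))
    refine (h1.mul_left ha0 hb0).of_isSquare_mul ?_ ?_
    · exact mul_ne_zero (mul_ne_zero ha0 hb0) (intCast_padic_two_ne_zero (by omega))
    · have hab := mul_emod_two ha hb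
      have := isSquare_intCast_padic_two_of_zmod ((mul_emod_eight_iff
        (x := a * (a + 4 * D) * n) (y := d) (mul_emod_two hab (by omega)) hd).2 (by
          rw [Int.mul_emod, mul_add_emod_eight ha, show (1 + 4 * D) % 8 = 5 by omega]
          rcases (by omega : n % 8 = 3 ∨ n % 8 = 7) with h8 | h8 <;> rw [h8] <;> omega))
      exact_mod_cast this

theorem localImage_two_iff_of_exponent_two {a D d : ℤ} (hd : d % 2 = 1)
    (h : D % 4 = 1 ∧ a % 8 = 1 ∨ D % 4 = 3 ∧ a % 8 = 5) :
    LocalImage (a : ℚ_[2]) ((a + 4 * D : ℤ) : ℚ_[2]) d ↔ d % 4 = 1 := by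
  have ha : a % 2 = 1 := by omega
  rw [localImage_two_iff ha (by omega) hd, mul_add_emod_eight ha]
  refine ⟨?_, by omega⟩
  rintro (h1 | h1 | ⟨n, hn, h1⟩)
  · omega
  · omega
  · rcases point_cases ha (by omega) h1 with ⟨u, hu, hnu, h2⟩ | ⟨w, hw, -⟩
    -- With `n = a + 2u`, the expression in `h2` is always `5` modulo `8`; the residues are checked
    -- one by one.
    · exfalso
      subst hnu
      have h3 : (D % 8 = 1 ∨ D % 8 = 5) ∧ a % 8 = 1 ∨ (D % 8 = 3 ∨ D % 8 = 7) ∧ a % 8 = 5 := by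
        omega
      have h4 : u % 8 = 1 ∨ u % 8 = 3 ∨ u % 8 = 5 ∨ u % 8 = 7 := by omega
      rcases h3 with ⟨h3 | h3, h5⟩ | ⟨h3 | h3, h5⟩ <;> rcases h4 with h4 | h4 | h4 | h4 <;>
      · simp [Int.mul_emod, Int.sub_emod, Int.add_emod, h3, h4, h5] at h2
    · omega

theorem localImage_two_of_exponent_three {a D d : ℤ} (hD : D % 2 = 1) (hd : d % 2 = 1)
    (ha : a % 4 = 3) : LocalImage (a : ℚ_[2]) ((a + 8 * D : ℤ) : ℚ_[2]) d := by
  rw [localImage_two_iff (by omega) (by omega) hd]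
  have h1 : d % 8 = 1 ∨ d % 8 = a % 8 ∨ d % 8 = 5 ∨ d % 8 = (a + 4) % 8 := by omega
  rcases h1 with h1 | h1 | h1 | h1
  · exact Or.inl h1
  · exact Or.inr (Or.inr ⟨a, h1.symm, by simp⟩)
  · right; right
    -- For `n = a ± 2` the value is `n + 4` modulo `8`, hence `1` precisely when `n ≡ 5`; this
    -- determines the sign.
    rcases (by omega : a % 8 = 3 ∨ a % 8 = 7) with ha8 | ha8
    · refine ⟨a + 2 * 1, by omega, ?_⟩
      rw [isSquare_point_iff (e := 4 * D) (u := 1) (by ring) rfl]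
      apply isSquare_intCast_padic_two_of_zmod
      rw [mul_sub_mul_emod_eight rfl (by omega)]
      omega
    · refine ⟨a + 2 * (-1), by omega, ?_⟩
      rw [isSquare_point_iff (e := 4 * D) (u := -1) (by ring) rfl]
      apply isSquare_intCast_padic_two_of_zmod
      rw [mul_sub_mul_emod_eight rfl (by omega)]
      omega
  · right; right
    have hDD : (D * D) % 8 = 1 := (mul_emod_eight_iff hD hD).2 rfl
    -- For `w = D` the value is `-n` and for `w = -D` it is `3 n` modulo `8`; the choice makes it
    -- `1` at `n ≡ a + 4`.
    rcases (by omega : a % 8 = 3 ∨ a % 8 = 7) with ha8 | ha8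
    · refine ⟨a + 4 * D, by omega, ?_⟩
      rw [isSquare_point_iff' (f := 2 * D) (w := D) (by ring) rfl]
      apply isSquare_intCast_padic_two_of_zmod
      rw [show D * (D - 2 * D) * (a + 4 * D) = D * D * (-(a + 4 * D)) by ring, Int.mul_emod, hDD]
      omega
    · refine ⟨a + 4 * (-D), by omega, ?_⟩
      rw [isSquare_point_iff' (f := 2 * D) (w := -D) (by ring) rfl]
      apply isSquare_intCast_padic_two_of_zmod
      rw [show -D * (-D - 2 * D) * (a + 4 * -D) = D * D * (3 * (a - 4 * D)) by ring, Int.mul_emod,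
        hDD]
      omega

/-- If `n ≡ a + 2` modulo `4`, the square condition forces `n ≡ 5` modulo `8`, against `n ≡ 3`
modulo `4`. If `n = a + 4w` with `w` odd, the value is `n + 2 ≡ 3` modulo `4`. Only `n ≡ a` modulo
`8` survives. -/
theorem localImage_two_iff_of_exponent_three {a D d : ℤ} (hD : D % 2 = 1) (hd : d % 2 = 1)
    (ha : a % 4 = 1) : LocalImage (a : ℚ_[2]) ((a + 8 * D : ℤ) : ℚ_[2]) d ↔
      d % 8 = 1 ∨ d % 8 = a % 8 := by
  rw [localImage_two_iff (by omega) (by omega) hd, show a + 8 * D = a + 4 * (2 * D) by ring,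
    mul_add_emod_eight (by omega)]
  constructor
  · rintro (h1 | h1 | ⟨n, hn, h1⟩)
    · omega
    · omega
    · rcases point_cases (by omega) (by omega) h1 with ⟨u, hu, hnu, h2⟩ | ⟨w, hw, h2⟩
      · rw [show 2 * (2 * D) = 4 * D by ring, mul_sub_mul_emod_eight hu (by omega)] at h2
        omega
      · rcases Int.emod_two_eq_zero_or_one w with hw2 | hw2
        · omega
        · have h3 := emod_eight_of_isSquare
            (mul_emod_two (mul_emod_two hw2 (by omega)) (by omega)) h2
          have h4 := mul_sub_mul_emod_four (f := D) hw2 (n := n) (by omega)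
          omega
  · rintro (h1 | h1)
    · exact Or.inl h1
    · exact Or.inr (Or.inr ⟨a, h1.symm, by simp⟩)

/-- For `n ≡ a + 2` modulo `4` the value is `n` modulo `8`, so the class is trivial. For `n ≡ a + 4`
modulo `8` it is `n + 4`, so `n ≡ 5`, possible only when `a ≡ 1`: this is the extra class. -/
theorem localImage_two_iff_of_exponent_four {a D d : ℤ} (hD : D % 2 = 1) (hd : d % 2 = 1)
    (ha : a % 2 = 1) : LocalImage (a : ℚ_[2]) ((a + 16 * D : ℤ) : ℚ_[2]) d ↔
      d % 8 = 1 ∨ d % 8 = a % 8 ∨ (a % 8 = 1 ∧ d % 8 = 5) := by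
  rw [localImage_two_iff (by omega) (by omega) hd, show a + 16 * D = a + 4 * (4 * D) by ring,
    mul_add_emod_eight (by omega)]
  constructor
  · rintro (h1 | h1 | ⟨n, hn, h1⟩)
    · omega
    · omega
    · rcases point_cases (by omega) (by omega) h1 with ⟨u, hu, hnu, h2⟩ | ⟨w, hw, h2⟩
      · rw [show 2 * (4 * D) = 4 * (2 * D) by ring, mul_sub_mul_emod_eight hu (by omega)] at h2
        omega
      · rcases Int.emod_two_eq_zero_or_one w with hw2 | hw2
        · omega
        · have h3 := emod_eight_of_isSquare
            (mul_emod_two (mul_emod_two hw2 (by omega)) (by omega)) h2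
          rw [mul_sub_mul_emod_eight hw2 (by omega)] at h3
          omega
  · rintro (h1 | h1 | ⟨h1, h2⟩)
    · exact Or.inl h1
    · exact Or.inr (Or.inr ⟨a, h1.symm, by simp⟩)
    · refine Or.inr (Or.inr ⟨a + 4 * 1, by omega, ?_⟩)
      rw [isSquare_point_iff' (f := 4 * D) (w := 1) rfl rfl]
      apply isSquare_intCast_padic_two_of_zmod
      rw [mul_sub_mul_emod_eight rfl (by omega)]
      omega

/-- Now the value is `n` modulo `8` in both non-trivial cases, so nothing new appears. `D` may be
even here, which lets it absorb any further power of `2`. -/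
theorem localImage_two_iff_of_five_le_exponent {a D d : ℤ} (hd : d % 2 = 1)
    (ha : a % 2 = 1) : LocalImage (a : ℚ_[2]) ((a + 32 * D : ℤ) : ℚ_[2]) d ↔
      d % 8 = 1 ∨ d % 8 = a % 8 := by
  rw [localImage_two_iff (by omega) (by omega) hd, show a + 32 * D = a + 4 * (8 * D) by ring,
    mul_add_emod_eight (by omega)]
  constructor
  · rintro (h1 | h1 | ⟨n, hn, h1⟩)
    · omega
    · omega
    · rcases point_cases (by omega) (by omega) h1 with ⟨u, hu, hnu, h2⟩ | ⟨w, hw, h2⟩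
      · rw [show 2 * (8 * D) = 4 * (4 * D) by ring, mul_sub_mul_emod_eight hu (by omega)] at h2
        omega
      · rcases Int.emod_two_eq_zero_or_one w with hw2 | hw2
        · omega
        · have h3 := emod_eight_of_isSquare
            (mul_emod_two (mul_emod_two hw2 (by omega)) (by omega)) h2
          rw [show 8 * D = 4 * (2 * D) by ring, mul_sub_mul_emod_eight hw2 (by omega)] at h3
          omega
  · rintro (h1 | h1)
    · exact Or.inl h1
    · exact Or.inr (Or.inr ⟨a, h1.symm, by simp⟩)

end Two
end TwoIsogenySelmer

namespace TwoIsogenySelmer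

/-! ### The set of extra vertices in terms of residues modulo `8` -/

section Table

theorem jacobiSym_neg_one_eq_one_iff {d : ℕ} (hd : d % 2 = 1) :
    jacobiSym (-1) d = 1 ↔ d % 4 = 1 := by
  rw [jacobiSym.at_neg_one (Nat.odd_iff.2 hd), ZMod.χ₄_nat_eq_if_mod_four]
  split_ifs <;> norm_num <;> omega

theorem jacobiSym_two_eq_one_iff {d : ℕ} (hd : d % 2 = 1) :
    jacobiSym 2 d = 1 ↔ d % 8 = 1 ∨ d % 8 = 7 := by
  rw [jacobiSym.at_two (Nat.odd_iff.2 hd), ZMod.χ₈_nat_eq_if_mod_eight]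
  split_ifs <;> norm_num <;> omega

theorem jacobiSym_neg_two_eq_one_iff {d : ℕ} (hd : d % 2 = 1) :
    jacobiSym (-2) d = 1 ↔ d % 8 = 1 ∨ d % 8 = 3 := by
  rw [jacobiSym.at_neg_two (Nat.odd_iff.2 hd), ZMod.χ₈'_nat_eq_if_mod_eight]
  split_ifs <;> norm_num <;> omega

/-- The supplementary laws for `-1`, `2`, `-2` turn the Jacobi conditions into residues of `d`, the
form in which the `2`-adic images were found. The same is done for each range of `m`. -/
theorem forall_extraVertices_one_iff {p D d : ℕ} (hp : p % 2 = 1) (hD : D % 2 = 1)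
    (hd : d % 2 = 1) :
    (∀ x ∈ extraVertices 1 p D, jacobiSym x d = 1) ↔
      (((p : ℤ) - D) % 8 = 0 ∨ ((p : ℤ) - D) % 8 = 6 →
        d % 8 = 1 ∨ p % 4 = 1 ∧ d % 8 = 3 ∨ p % 4 = 3 ∧ d % 8 = 7) := by
  have h8 : ((p : ℤ) - D) % 8 = 0 ∨ ((p : ℤ) - D) % 8 = 2 ∨ ((p : ℤ) - D) % 8 = 4 ∨
    ((p : ℤ) - D) % 8 = 6 := by omega
  have h4 : p % 4 = 1 ∨ p % 4 = 3 := by omega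
  rcases h8 with h1 | h1 | h1 | h1 <;> rcases h4 with h2 | h2 <;>
  · simp [h1, h2, extraVertices, GraphCase1, GraphCase2, GraphCase3,
      Nat.ModEq, Int.ModEq,
      jacobiSym_two_eq_one_iff hd,
      jacobiSym_neg_two_eq_one_iff hd]
    try omega

theorem forall_extraVertices_two_iff {p D d : ℕ} (hD : D % 2 = 1) (hpD : (p * D) % 2 = 1)
    (hd : d % 2 = 1) :
    (∀ x ∈ extraVertices 2 p D, jacobiSym x d = 1) ↔
      (D % 4 = 1 ∧ (p * D) % 8 = 1 ∨ D % 4 = 3 ∧ (p * D) % 8 = 5 → d % 4 = 1) := by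
  have h8 : (p * D) % 8 = 1 ∧ (p * D) % 4 = 1 ∨ (p * D) % 8 = 3 ∧ (p * D) % 4 = 3 ∨
    (p * D) % 8 = 5 ∧ (p * D) % 4 = 1 ∨ (p * D) % 8 = 7 ∧ (p * D) % 4 = 3 := by omega
  have h4 : D % 4 = 1 ∨ D % 4 = 3 := by omega
  rcases h4 with h3 | h3 <;> rcases h8 with ⟨h1, h2⟩ | ⟨h1, h2⟩ | ⟨h1, h2⟩ | ⟨h1, h2⟩ <;>
  · simp [h1, h2, h3, extraVertices, GraphCase1, GraphCase2, GraphCase3, GraphCase4,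
      Nat.ModEq, Int.ModEq,
      jacobiSym_neg_one_eq_one_iff hd]
    try omega

theorem forall_extraVertices_three_iff {p D d : ℕ} (hpD : (p * D) % 2 = 1)
    (hd : d % 2 = 1) :
    (∀ x ∈ extraVertices 3 p D, jacobiSym x d = 1) ↔
      ((p * D) % 4 = 1 → d % 8 = 1 ∨ d % 8 = (p * D) % 8) := by
  have h8 : (p * D) % 8 = 1 ∧ (p * D) % 4 = 1 ∨ (p * D) % 8 = 3 ∧ (p * D) % 4 = 3 ∨
    (p * D) % 8 = 5 ∧ (p * D) % 4 = 1 ∨ (p * D) % 8 = 7 ∧ (p * D) % 4 = 3 := by omega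
  rcases h8 with ⟨h1, h2⟩ | ⟨h1, h2⟩ | ⟨h1, h2⟩ | ⟨h1, h2⟩ <;>
  · simp [h1, h2, extraVertices, GraphCase1, GraphCase2, GraphCase3, GraphCase4, GraphCase5,
      Nat.ModEq, Int.ModEq,
      jacobiSym_neg_one_eq_one_iff hd, jacobiSym_two_eq_one_iff hd]
    try omega

theorem forall_extraVertices_four_iff {p D d : ℕ} (hpD : (p * D) % 2 = 1)
    (hd : d % 2 = 1) :
    (∀ x ∈ extraVertices 4 p D, jacobiSym x d = 1) ↔
      d % 8 = 1 ∨ d % 8 = (p * D) % 8 ∨ (p * D) % 8 = 1 ∧ d % 8 = 5 := by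
  have h8 : (p * D) % 8 = 1 ∧ (p * D) % 4 = 1 ∨ (p * D) % 8 = 3 ∧ (p * D) % 4 = 3 ∨
    (p * D) % 8 = 5 ∧ (p * D) % 4 = 1 ∨ (p * D) % 8 = 7 ∧ (p * D) % 4 = 3 := by omega
  rcases h8 with ⟨h1, h2⟩ | ⟨h1, h2⟩ | ⟨h1, h2⟩ | ⟨h1, h2⟩ <;>
  · simp [h1, h2, extraVertices, GraphCase1, GraphCase2, GraphCase3, GraphCase4,
      Nat.ModEq, Int.ModEq,
      jacobiSym_neg_one_eq_one_iff hd, jacobiSym_two_eq_one_iff hd,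
      jacobiSym_neg_two_eq_one_iff hd]
    try omega

theorem forall_extraVertices_of_five_le_iff {m p D d : ℕ} (hm : 5 ≤ m) (hpD : (p * D) % 2 = 1)
    (hd : d % 2 = 1) :
    (∀ x ∈ extraVertices m p D, jacobiSym x d = 1) ↔
      d % 8 = 1 ∨ d % 8 = (p * D) % 8 := by
  have hm1 : m ≠ 1 := by omega
  have hm2 : m ≠ 2 := by omega
  have hm3 : m ≠ 3 := by omega
  have hm4 : m ≠ 4 := by omega
  have hm3' : 3 ≤ m := by omega
  have hm4' : 4 ≤ m := by omega
  have h8 : (p * D) % 8 = 1 ∧ (p * D) % 4 = 1 ∨ (p * D) % 8 = 3 ∧ (p * D) % 4 = 3 ∨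
    (p * D) % 8 = 5 ∧ (p * D) % 4 = 1 ∨ (p * D) % 8 = 7 ∧ (p * D) % 4 = 3 := by omega
  rcases h8 with ⟨h1, h2⟩ | ⟨h1, h2⟩ | ⟨h1, h2⟩ | ⟨h1, h2⟩ <;>
  · simp [h1, h2, hm, hm1, hm2, hm3, hm4, hm3', hm4', extraVertices, GraphCase1, GraphCase2, GraphCase3, GraphCase4, GraphCase5,
      Nat.ModEq, Int.ModEq,
      jacobiSym_neg_one_eq_one_iff hd, jacobiSym_two_eq_one_iff hd,
      jacobiSym_neg_two_eq_one_iff hd]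
    try omega

/-- The local image at `2` is cut out by the extra vertices. -/
theorem localImage_two_iff_jacobiSym {m p D d : ℕ} (hm : 1 ≤ m) (hp : p % 2 = 1)
    (hD : D % 2 = 1) (hd : d % 2 = 1) :
    LocalImage ((p * D : ℕ) : ℚ_[2]) (((p + 2 ^ m) * D : ℕ) : ℚ_[2]) (d : ℚ_[2]) ↔
      ∀ x ∈ extraVertices m p D, jacobiSym x d = 1 := by
  have hcast : LocalImage ((p * D : ℕ) : ℚ_[2]) (((p + 2 ^ m) * D : ℕ) : ℚ_[2]) (d : ℚ_[2]) ↔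
      LocalImage (((p * D : ℕ) : ℤ) : ℚ_[2]) ((((p * D : ℕ) : ℤ) + 2 ^ m * D : ℤ) : ℚ_[2])
        ((d : ℤ) : ℚ_[2]) := by
    push_cast
    rw [add_mul]
  rw [hcast]
  have hpD : (p * D) % 2 = 1 := by rw [Nat.mul_mod, hp, hD]
  have hdZ : (d : ℤ) % 2 = 1 := by omega
  have hDZ : (D : ℤ) % 2 = 1 := by omega
  have haZ : ((p * D : ℕ) : ℤ) % 2 = 1 := by omega
  have hexp : m = 1 ∨ m = 2 ∨ m = 3 ∨ m = 4 ∨ 5 ≤ m := by omega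
  rcases hexp with rfl | rfl | rfl | rfl | hm5
  · rw [pow_one, localImage_two_iff_of_exponent_one haZ hDZ hdZ,
      forall_extraVertices_one_iff hp hD hd]
    clear hcast
    -- For `m = 1` the image consists of the classes `1`, `ab`, `a`, `b`; comparison with the table
    -- is a finite check over `p` and `D` modulo `8`.
    have hp8 : p % 8 = 1 ∨ p % 8 = 3 ∨ p % 8 = 5 ∨ p % 8 = 7 := by omega
    have hD8 : D % 8 = 1 ∨ D % 8 = 3 ∨ D % 8 = 5 ∨ D % 8 = 7 := by omega
    have hmul := Nat.mul_mod p D 8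
    have hmul2 := Int.mul_emod ((p * D : ℕ) : ℤ) ((p * D : ℕ) + 2 * D : ℤ) 8
    generalize p * D = a at *
    generalize (a : ℤ) * (a + 2 * D) = c at *
    rcases hp8 with h1 | h1 | h1 | h1 <;> rcases hD8 with h2 | h2 | h2 | h2 <;>
    · rw [h1, h2] at hmul
      have e1 : (a : ℤ) % 8 = (a % 8 : ℕ) := by omega
      have e2 : ((a : ℤ) + 2 * D) % 8 = ((a % 8 + 2 * (D % 8)) % 8 : ℕ) := by omega
      rw [e1, e2, hmul, h2] at hmul2
      rw [e1, e2, hmul, h2, hmul2]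
      norm_num
      omega
  · rw [show (2 : ℤ) ^ 2 = 4 by norm_num, forall_extraVertices_two_iff hD hpD hd]
    by_cases h : D % 4 = 1 ∧ (p * D) % 8 = 1 ∨ D % 4 = 3 ∧ (p * D) % 8 = 5
    · rw [localImage_two_iff_of_exponent_two hdZ (by omega)]
      omega
    · exact iff_of_true (localImage_two_of_exponent_two hDZ hdZ (by omega))
        fun h' => absurd h' h
  · rw [show (2 : ℤ) ^ 3 = 8 by norm_num, forall_extraVertices_three_iff hpD hd]
    by_cases h : (p * D) % 4 = 1
    · rw [localImage_two_iff_of_exponent_three hDZ hdZ (by omega)]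
      omega
    · exact iff_of_true (localImage_two_of_exponent_three hDZ hdZ (by omega))
        fun h' => absurd h' h
  · rw [show (2 : ℤ) ^ 4 = 16 by norm_num, localImage_two_iff_of_exponent_four hDZ hdZ haZ,
      forall_extraVertices_four_iff hpD hd]
    omega
  · rw [forall_extraVertices_of_five_le_iff hm5 hpD hd]
    obtain ⟨k, rfl⟩ : ∃ k, m = 5 + k := ⟨m - 5, by omega⟩
    rw [show (2 : ℤ) ^ (5 + k) * D = 32 * (2 ^ k * D) by rw [pow_add]; ring,
      localImage_two_iff_of_five_le_exponent hdZ haZ]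
    omega

end Table
end TwoIsogenySelmer

namespace TwoIsogenySelmer
open WeierstrassCurve

/-! ### The points of `E'_-` -/

/-- Put `X = d s²` and `Y = d s t` in `Y² = X (X - a)(X - b)`. The class of `(0, 0)`, where no
non-zero `X` is available, corresponds to `s = 0`. -/
theorem localImage_iff_quartic {K : Type*} [Field K] {a b d : K} (hd : d ≠ 0) :
    LocalImage a b d ↔
      IsSquare d ∨ ∃ s t : K, d * t ^ 2 = (d * s ^ 2 - a) * (d * s ^ 2 - b) := by
  constructor
  · rintro (h | ⟨u, hu⟩ | ⟨X, hX, ⟨u, hu⟩, ⟨Y, hY⟩⟩)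
    · exact Or.inl h
    · refine Or.inr ⟨0, u / d, ?_⟩
      field_simp
      linear_combination -hu
    · right
      have hu0 : u ≠ 0 := by
        rintro rfl
        simp [hX, hd] at hu
      have hXu : X = u ^ 2 / d := by
        field_simp
        linear_combination hu
      refine ⟨u / d, Y / u, ?_⟩
      have h1 : d * (u / d) ^ 2 = X := by
        rw [hXu]
        field_simp
      rw [h1]
      have h2 : d * (Y / u) ^ 2 = (Y * Y) * (d / u ^ 2) := by
        field_simp
      rw [h2, ← hY]
      have h3 : d / u ^ 2 = X⁻¹ := by
        rw [hXu]
        field_simp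
      rw [h3]
      field_simp
  · rintro (h | ⟨s, t, h⟩)
    · exact Or.inl h
    · by_cases hs : s = 0
      · subst hs
        refine Or.inr (Or.inl ⟨d * t, ?_⟩)
        linear_combination -d * h
      · refine Or.inr (Or.inr ⟨d * s ^ 2, by simp [hd, hs], ⟨d * s, by ring⟩,
          ⟨d * s * t, ?_⟩⟩)
        linear_combination (-d * s ^ 2) * h

theorem four_pow_eq {p q m D : ℕ} {K : Type*} [Field K] (h : Admissible p q m D) : (4 : K) ^ m * D ^ 2 = (q * D - p * D) ^ 2 := by
  have hqp : (q : K) - p = 2 ^ m := by rw [h.diff]; push_cast; ring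
  rw [← sub_mul, hqp, mul_pow, ← pow_mul, mul_comm m, pow_mul]
  norm_num

theorem some_congr {K : Type*} [Field K] {W : Affine K} {x y x' y' : K} {hxy : W.Nonsingular x y}
    (hx : x = x') (hy : y = y') :
    (.some x y hxy : W.Point) = .some x' y' (hx ▸ hy ▸ hxy) := by
  subst hx hy
  rfl

section Points

variable {p q m D : ℕ} {K : Type*} [Field K] [Algebra ℚ K]

theorem equation_curveE'_iff {x y : K} :
    ((curveE' (-1) p q m D)⁄K).toAffine.Equation x y ↔
      y ^ 2 = x ^ 3 + 2 * (p + q) * D * x ^ 2 + 4 ^ m * D ^ 2 * x := by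
  rw [curveE'_baseChange, Affine.equation_iff]
  simp

theorem four_pow_ne_zero (h : Admissible p q m D) : (4 : K) ^ m * D ^ 2 ≠ 0 := by
  have : CharZero K := algebraRat.charZero K
  have hD : (D : K) ≠ 0 := Nat.cast_ne_zero.mpr h.squarefree_D.ne_zero
  exact mul_ne_zero (pow_ne_zero _ (by norm_num)) (pow_ne_zero _ hD)

theorem nonsingular_curveE'_iff (h : Admissible p q m D) {x y : K} :
    ((curveE' (-1) p q m D)⁄K).toAffine.Nonsingular x y ↔
      y ^ 2 = x ^ 3 + 2 * (p + q) * D * x ^ 2 + 4 ^ m * D ^ 2 * x := by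
  have : CharZero K := algebraRat.charZero K
  have hp : (p : K) ≠ 0 := Nat.cast_ne_zero.mpr h.prime_p.ne_zero
  have hq : (q : K) ≠ 0 := Nat.cast_ne_zero.mpr h.prime_q.ne_zero
  have hD : (D : K) ≠ 0 := Nat.cast_ne_zero.mpr h.squarefree_D.ne_zero
  rw [← equation_curveE'_iff, ← Affine.equation_iff_nonsingular_of_Δ_ne_zero]
  rw [curveE'_baseChange]
  have h1 : (⟨0, -2 * (((-1 : ℤˣ) : ℤ) : K) * (p + q) * D, 0, 4 ^ m * D ^ 2, 0⟩ :
      WeierstrassCurve K).Δ =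
        16 * (4 ^ m * D ^ 2) ^ 2 * (4 * ((p + q) ^ 2 * D ^ 2 - 4 ^ m * D ^ 2)) := by
    simp only [WeierstrassCurve.Δ, WeierstrassCurve.b₂,
      WeierstrassCurve.b₄, WeierstrassCurve.b₆, WeierstrassCurve.b₈]
    push_cast
    ring
  have h2 : ((p + q) ^ 2 * D ^ 2 - 4 ^ m * D ^ 2 : K) = 4 * (p * q * D ^ 2) := by
    rw [four_pow_eq h]
    ring
  change (⟨0, -2 * (((-1 : ℤˣ) : ℤ) : K) * (p + q) * D, 0, 4 ^ m * D ^ 2, 0⟩ :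
      WeierstrassCurve K).Δ ≠ 0
  rw [h1, h2]
  have h16 : (16 : K) ≠ 0 := by norm_num
  have h4 : (4 : K) ≠ 0 := by norm_num
  exact mul_ne_zero (mul_ne_zero h16 (pow_ne_zero _ (four_pow_ne_zero h)))
    (mul_ne_zero h4 (mul_ne_zero h4 (mul_ne_zero (mul_ne_zero hp hq) (pow_ne_zero _ hD))))

variable (K) in
/-- The point `(0, 0)` of order two. -/
def pointT (h : Admissible p q m D) : ((curveE' (-1) p q m D)⁄K).toAffine.Point :=
  .some 0 0 ((nonsingular_curveE'_iff h).2 (by ring))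

theorem pointT_ne_zero (h : Admissible p q m D) : pointT K h ≠ 0 :=
  Affine.Point.some_ne_zero _

open scoped Classical in
theorem some_add_pointT (h : Admissible p q m D) {x y x' y' : K} (hx : x ≠ 0)
    {hxy : ((curveE' (-1) p q m D)⁄K).toAffine.Nonsingular x y}
    {hxy' : ((curveE' (-1) p q m D)⁄K).toAffine.Nonsingular x' y'}
    (hx' : x' = 4 ^ m * D ^ 2 / x) (hy' : y' = -(4 ^ m * D ^ 2 * y / x ^ 2)) :
    (.some x y hxy + pointT K h : ((curveE' (-1) p q m D)⁄K).toAffine.Point) =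
      .some x' y' hxy' := by
  have heq := (nonsingular_curveE'_iff h).1 hxy
  rw [pointT, Affine.Point.add_of_X_ne hx]
  have ha1 : ((curveE' (-1) p q m D)⁄K).a₁ = 0 := by rw [curveE'_baseChange]
  have ha2 : ((curveE' (-1) p q m D)⁄K).a₂ = 2 * (p + q) * D := by
    rw [curveE'_baseChange]
    push_cast
    ring
  have ha3 : ((curveE' (-1) p q m D)⁄K).a₃ = 0 := by rw [curveE'_baseChange]
  have hX : ((curveE' (-1) p q m D)⁄K).toAffine.addX x 0
      (((curveE' (-1) p q m D)⁄K).toAffine.slope x 0 y 0) = x' := by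
    rw [Affine.slope_of_X_ne hx, Affine.addX, ha1, ha2, hx']
    field_simp
    linear_combination x * heq
  have hY : ((curveE' (-1) p q m D)⁄K).toAffine.addY x 0 y
      (((curveE' (-1) p q m D)⁄K).toAffine.slope x 0 y 0) = y' := by
    rw [Affine.addY, Affine.negAddY, Affine.negY, hX, Affine.slope_of_X_ne hx, ha1, ha3, hx', hy']
    field_simp
    ring
  exact some_congr hX hY

open scoped Classical in
theorem map_pointT {F S L : Type*} [Field F] [Algebra ℚ F] [Field S] [Algebra ℚ S] [Field L]
    [Algebra ℚ L] [Algebra S F] [Algebra S L] [IsScalarTower ℚ S F] [IsScalarTower ℚ S L]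
    (h : Admissible p q m D) (f : F →ₐ[S] L) :
    Affine.Point.map (W' := (curveE' (-1) p q m D).toAffine) f (pointT F h) = pointT L h := by
  rw [pointT, Affine.Point.map_some]
  exact some_congr (map_zero f) (map_zero f)

/-- The conjugate of `x` under `w ↦ -w` is `4 ^ m D² / x`, so `x ≠ 0`. Dividing the cubic by `x²`
leaves `4 r² = x + 4 ^ m D² / x + 2 (p + q) D`, which is the sum of the conjugates. Here `r²` is the
abscissa of the image under the dual isogeny. -/
theorem exists_pointT_half (h : Admissible p q m D) {r w : K}
    (hrw : w ^ 2 = (r ^ 2 - p * D) * (r ^ 2 - q * D)) :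
    2 * r ^ 2 - (p * D + q * D) + 2 * w ≠ 0 ∧
      ((curveE' (-1) p q m D)⁄K).toAffine.Nonsingular (2 * r ^ 2 - (p * D + q * D) + 2 * w)
        (2 * r * (2 * r ^ 2 - (p * D + q * D) + 2 * w)) := by
  have h1 : (2 * r ^ 2 - (p * D + q * D) + 2 * w) * (2 * r ^ 2 - (p * D + q * D) - 2 * w) =
      4 ^ m * D ^ 2 := by
    rw [four_pow_eq h]
    linear_combination -4 * hrw
  refine ⟨left_ne_zero_of_mul (h1 ▸ four_pow_ne_zero h), ?_⟩
  rw [nonsingular_curveE'_iff h, ← h1]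
  ring

variable (r w : K) in
/-- The points of `E'` with `x ≠ 0`, parametrized by `r = y / (2 x)` and
`w = (x - 4 ^ m D² / x) / 4`. -/
def halfPoint (h : Admissible p q m D) (hrw : w ^ 2 = (r ^ 2 - p * D) * (r ^ 2 - q * D)) :
    ((curveE' (-1) p q m D)⁄K).toAffine.Point :=
  .some _ _ (exists_pointT_half h hrw).2

open scoped Classical in
-- In these coordinates translation by `T` is a simultaneous sign change, so twisting by `√d` just
-- means multiplying `r` and `w` by `√d`.
theorem halfPoint_add_pointT (h : Admissible p q m D) {r w : K}
    (hrw : w ^ 2 = (r ^ 2 - p * D) * (r ^ 2 - q * D)) :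
    halfPoint r w h hrw + pointT K h =
      halfPoint (-r) (-w) h (by rw [neg_sq, neg_sq, hrw]) := by
  obtain ⟨h0, -⟩ := exists_pointT_half h hrw
  have h1 : (2 * r ^ 2 - (p * D + q * D) + 2 * w) * (2 * r ^ 2 - (p * D + q * D) - 2 * w) =
      4 ^ m * D ^ 2 := by
    rw [four_pow_eq h]
    linear_combination -4 * hrw
  apply some_add_pointT h h0
  · rw [eq_div_iff h0, ← h1]
    ring
  · rw [← h1, show 2 * -r * (2 * (-r) ^ 2 - (p * D + q * D) + 2 * -w) =
      -(2 * r * (2 * r ^ 2 - (p * D + q * D) - 2 * w)) by ring]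
    generalize 2 * r ^ 2 - (p * D + q * D : K) + 2 * w = x at h0
    field_simp

open scoped Classical in
theorem exists_halfPoint (h : Admissible p q m D) {P : ((curveE' (-1) p q m D)⁄K).toAffine.Point}
    (hP0 : P ≠ 0) (hPT : P ≠ pointT K h) : ∃ r w hrw, P = halfPoint r w h hrw := by
  have : CharZero K := algebraRat.charZero K
  rcases P with _ | ⟨x, y, hxy⟩
  · exact absurd rfl hP0
  · have heq := (nonsingular_curveE'_iff h).1 hxy
    by_cases hx : x = 0
    · subst hx
      have hy : y = 0 := by simpa using heq
      subst hy
      exact absurd rfl hPT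
    · have h2 : (2 : K) ≠ 0 := two_ne_zero
      have h4 : (4 : K) ≠ 0 := by norm_num
      have h3 := four_pow_eq h (K := K)
      have hrx : 4 * (y / (2 * x)) ^ 2 * x = x ^ 2 + 2 * (p + q) * D * x + 4 ^ m * D ^ 2 := by
        field_simp
        linear_combination 4 * heq
      refine ⟨y / (2 * x), (x - 4 ^ m * D ^ 2 / x) / 4, ?_, some_congr ?_ ?_⟩
      · have hr : (y / (2 * x)) ^ 2 =
            (x ^ 2 + 2 * (p + q) * D * x + 4 ^ m * D ^ 2) / (4 * x) := by
          rw [← hrx]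
          field_simp
        rw [hr]
        field_simp
        rw [h3]
        ring
      · have hr : (y / (2 * x)) ^ 2 =
            (x ^ 2 + 2 * (p + q) * D * x + 4 ^ m * D ^ 2) / (4 * x) := by
          rw [← hrx]
          field_simp
        rw [hr]
        field_simp
        ring
      · have hr : (y / (2 * x)) ^ 2 =
            (x ^ 2 + 2 * (p + q) * D * x + 4 ^ m * D ^ 2) / (4 * x) := by
          rw [← hrx]
          field_simp
        rw [hr]
        field_simp
        ring

theorem halfPoint_inj (h : Admissible p q m D) {r w r' w' : K}
    {hrw : w ^ 2 = (r ^ 2 - p * D) * (r ^ 2 - q * D)}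
    {hrw' : w' ^ 2 = (r' ^ 2 - p * D) * (r' ^ 2 - q * D)}
    (heq : halfPoint r w h hrw = halfPoint r' w' h hrw') : r = r' ∧ w = w' := by
  have : CharZero K := algebraRat.charZero K
  obtain ⟨h1, h2⟩ := Affine.Point.some.inj heq
  rw [← h1] at h2
  have hr : r = r' := by
    have := mul_right_cancel₀ (exists_pointT_half h hrw).1 h2
    exact mul_left_cancel₀ two_ne_zero this
  subst hr
  exact ⟨rfl, mul_left_cancel₀ two_ne_zero (add_left_cancel h1)⟩

open scoped Classical in
theorem map_halfPoint {F S L : Type*} [Field F] [Algebra ℚ F] [Field S] [Algebra ℚ S] [Field L]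
    [Algebra ℚ L] [Algebra S F] [Algebra S L] [IsScalarTower ℚ S F] [IsScalarTower ℚ S L]
    (h : Admissible p q m D) (f : F →ₐ[S] L) {r w : F}
    (hrw : w ^ 2 = (r ^ 2 - p * D) * (r ^ 2 - q * D)) :
    Affine.Point.map (W' := (curveE' (-1) p q m D).toAffine) f (halfPoint r w h hrw) =
      halfPoint (f r) (f w) h (by
        have := congrArg f hrw
        simpa using this) := by
  rw [halfPoint, Affine.Point.map_some]
  exact some_congr (by simp [map_ofNat f 2]) (by simp [map_ofNat f 2])

end Points
end TwoIsogenySelmer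

namespace TwoIsogenySelmer
open WeierstrassCurve

/-! ### Quadratic characters as cocycles -/

instance isAlgClosure_QBar : IsAlgClosure ℚ QBar where
  isAlgClosed := inferInstance
  isAlgebraic := by convert! AlgebraicClosure.isAlgebraic ℚ

instance isAlgebraic_QBar : Algebra.IsAlgebraic ℚ QBar := isAlgClosure_QBar.isAlgebraic

instance normal_QBar : Normal ℚ QBar := IsAlgClosure.normal ℚ QBar

instance isGalois_QBar : IsGalois ℚ QBar where

theorem isGalois_algebraicClosure (L : Type*) [Field L] [CharZero L] :
    IsGalois L (AlgebraicClosure L) where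

noncomputable section Cocycles

open scoped Classical

variable {p q m D : ℕ}

theorem pointT_add_self {K : Type*} [Field K] [Algebra ℚ K] (h : Admissible p q m D) :
    pointT K h + pointT K h = 0 := by
  rw [pointT, Affine.Point.add_of_Y_eq rfl]
  rw [curveE'_baseChange]
  simp [Affine.negY]

theorem mem_kerPhiHat_iff {K : Type*} [Field K] [Algebra ℚ K] (h : Admissible p q m D)
    {P : ((curveE' (-1) p q m D)⁄K).toAffine.Point} :
    P ∈ kerPhiHat (-1) K h ↔ P = 0 ∨ P = pointT K h := by
  change phiHat h P = 0 ↔ _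
  rw [phiHat_eq_zero_iff]
  refine or_congr_right ⟨?_, ?_⟩
  · rintro ⟨_, rfl⟩
    rfl
  · rintro rfl
    exact ⟨_, rfl⟩

theorem apply_eq_or_eq_neg {F E : Type*} [Field F] [Field E] [Algebra F E] {δ : E} {d : F}
    (hδ : δ ^ 2 = algebraMap F E d) (σ : E ≃ₐ[F] E) : σ δ = δ ∨ σ δ = -δ := by
  have h1 : σ δ ^ 2 = δ ^ 2 := by rw [← map_pow, hδ, AlgEquiv.commutes]
  exact sq_eq_sq_iff_eq_or_eq_neg.1 h1

theorem isLocallyConstant_apply {F E : Type*} [Field F] [Field E] [Algebra F E]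
    [Algebra.IsIntegral F E] (δ : E) : IsLocallyConstant fun σ : E ≃ₐ[F] E => σ δ := by
  rw [IsLocallyConstant.iff_exists_open]
  intro σ
  refine ⟨(fun τ => σ⁻¹ * τ) ⁻¹' (MulAction.stabilizer (E ≃ₐ[F] E) δ : Set (E ≃ₐ[F] E)),
    (stabilizer_isOpen_of_isIntegral δ).preimage (continuous_const.mul continuous_id), ?_, ?_⟩
  · simp
  · intro τ hτ
    have h1 : (σ⁻¹ * τ) • δ = δ := hτ
    rw [mul_smul, inv_smul_eq_iff] at h1
    exact h1

/-- The cocycle `σ ↦ σ(δ) / δ ∈ {±1} ≅ E'[φ̂]` of a square root `δ` of a rational number. -/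
def quadCocycle (h : Admissible p q m D) {d : ℚ} {δ : QBar} (hδ0 : δ ≠ 0)
    (hδ : δ ^ 2 = algebraMap ℚ QBar d) :
    cocycles (curveE' (-1) p q m D) (kerPhiHat (-1) QBar h) where
  val σ := if σ δ = δ then 0 else pointT QBar h
  property := by
    refine ⟨fun σ => ?_, ?_, fun σ τ => ?_⟩
    · rw [mem_kerPhiHat_iff]
      dsimp only
      split_ifs
      exacts [Or.inl rfl, Or.inr rfl]
    · exact (isLocallyConstant_apply (F := ℚ) δ).comp fun x => if x = δ then 0 else pointT QBar h
    · have hneg : -δ ≠ δ := by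
        intro h1
        exact hδ0 (CharZero.neg_eq_self_iff.1 h1)
      rcases apply_eq_or_eq_neg hδ σ with hσ | hσ <;>
        rcases apply_eq_or_eq_neg hδ τ with hτ | hτ <;>
        simp [AlgEquiv.mul_apply, hσ, hτ, hneg, map_pointT, pointT_add_self]

theorem quadCocycle_apply (h : Admissible p q m D) {d : ℚ} {δ : QBar} (hδ0 : δ ≠ 0)
    (hδ : δ ^ 2 = algebraMap ℚ QBar d) (σ : QBar ≃ₐ[ℚ] QBar) :
    (quadCocycle h hδ0 hδ).1 σ = if σ δ = δ then 0 else pointT QBar h := rfl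

/-- The two sign characters agree exactly when every `σ` fixes `δ η`, that is, when this square root
of `d e` is rational. -/
theorem quadCocycle_eq_iff (h : Admissible p q m D) {d e : ℚ} {δ η : QBar} (hδ0 : δ ≠ 0)
    (hη0 : η ≠ 0) (hδ : δ ^ 2 = algebraMap ℚ QBar d) (hη : η ^ 2 = algebraMap ℚ QBar e) :
    quadCocycle h hδ0 hδ = quadCocycle h hη0 hη ↔ IsSquare (d * e) := by
  have hT := pointT_ne_zero (K := QBar) h
  have key : quadCocycle h hδ0 hδ = quadCocycle h hη0 hη ↔
      ∀ σ : QBar ≃ₐ[ℚ] QBar, σ (δ * η) = δ * η := by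
    rw [Subtype.ext_iff, funext_iff]
    refine forall_congr' fun σ => ?_
    rw [quadCocycle_apply, quadCocycle_apply, map_mul]
    have hδn : -δ ≠ δ := fun h1 => hδ0 (CharZero.neg_eq_self_iff.1 h1)
    have hηn : -η ≠ η := fun h1 => hη0 (CharZero.neg_eq_self_iff.1 h1)
    have hm : -(δ * η) ≠ δ * η := fun h1 => mul_ne_zero hδ0 hη0 (CharZero.neg_eq_self_iff.1 h1)
    rcases apply_eq_or_eq_neg hδ σ with hσ | hσ <;>
      rcases apply_eq_or_eq_neg hη σ with hτ | hτ <;>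
      simp only [hσ, hτ, hδn, hηn, hm, hT, hT.symm, neg_mul, mul_neg, neg_neg, if_true, if_false]
  rw [key, ← InfiniteGalois.mem_range_algebraMap_iff_fixed]
  have hsq : (δ * η) ^ 2 = algebraMap ℚ QBar (d * e) := by rw [mul_pow, hδ, hη, map_mul]
  constructor
  · rintro ⟨x, hx⟩
    refine ⟨x, ?_⟩
    apply (algebraMap ℚ QBar).injective
    rw [← hsq, ← hx, map_mul, sq]
  · rintro ⟨x, hx⟩
    rw [hx, map_mul, ← sq] at hsq
    rcases sq_eq_sq_iff_eq_or_eq_neg.1 hsq with h1 | h1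
    · exact ⟨x, h1.symm⟩
    · exact ⟨-x, by rw [map_neg, h1]⟩

/-- Quadratic Kummer theory by hand. The action on `{O, T}` is trivial, so `c` is a continuous
homomorphism to a group of order two; an element of the fixed field of its kernel, moved by some
`σ₀` outside the kernel, yields the root `δ = α - σ₀ α`, on which `σ` acts by the sign of `c σ`. -/
theorem exists_eq_quadCocycle (h : Admissible p q m D)
    (c : cocycles (curveE' (-1) p q m D) (kerPhiHat (-1) QBar h)) :
    ∃ (d : ℚ) (δ : QBar) (hδ0 : δ ≠ 0) (hδ : δ ^ 2 = algebraMap ℚ QBar d),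
      c = quadCocycle h hδ0 hδ := by
  obtain ⟨c, hc1, hc2, hc3⟩ := c
  have hfix : ∀ (σ : QBar ≃ₐ[ℚ] QBar) τ,
      Affine.Point.map (W' := (curveE' (-1) p q m D).toAffine) σ.toAlgHom (c τ) = c τ := by
    intro σ τ
    rcases (mem_kerPhiHat_iff h).1 (hc1 τ) with h1 | h1 <;> rw [h1]
    · exact map_zero _
    · exact map_pointT h _
  have hmul : ∀ σ τ, c (σ * τ) = c σ + c τ := fun σ τ => by rw [hc3, hfix]
  have hone : c 1 = 0 := by
    have := hmul 1 1
    rwa [mul_one, left_eq_add] at this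
  have hself : ∀ σ, c σ + c σ = 0 := by
    intro σ
    rcases (mem_kerPhiHat_iff h).1 (hc1 σ) with h1 | h1 <;> rw [h1]
    · exact add_zero _
    · exact pointT_add_self h
  have hinv : ∀ σ, c σ⁻¹ = c σ := by
    intro σ
    have h1 := hmul σ σ⁻¹
    rw [mul_inv_cancel, hone, ← hself σ] at h1
    exact (add_left_cancel h1).symm
  let H : Subgroup (QBar ≃ₐ[ℚ] QBar) :=
    { carrier := {σ | c σ = 0}
      mul_mem' := fun {σ τ} (h1 : c σ = 0) (h2 : c τ = 0) => by
        change c (σ * τ) = 0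
        rw [hmul, h1, h2, add_zero]
      one_mem' := hone
      inv_mem' := fun {σ} (h1 : c σ = 0) => by
        change c σ⁻¹ = 0
        rw [hinv, h1] }
  have hHclosed : IsClosed (H : Set (QBar ≃ₐ[ℚ] QBar)) := hc2.isClosed_fiber 0
  by_cases htriv : ∀ σ, c σ = 0
  · refine ⟨1, 1, one_ne_zero, by simp, Subtype.ext (funext fun σ => ?_)⟩
    rw [quadCocycle_apply]
    simp [htriv σ]
  · push Not at htriv
    obtain ⟨σ₀, hσ₀⟩ := htriv
    have hT : ∀ σ, c σ ≠ 0 → c σ = pointT QBar h := fun σ hσ =>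
      ((mem_kerPhiHat_iff h).1 (hc1 σ)).resolve_left hσ
    have hfixing := InfiniteGalois.fixingSubgroup_fixedField (k := ℚ) (K := QBar) ⟨H, hHclosed⟩
    -- The kernel is closed, so it is the whole fixing group of its fixed field; `σ₀` therefore
    -- moves some element of that field.
    have hα : ∃ α : QBar, (∀ σ, c σ = 0 → σ α = α) ∧ σ₀ α ≠ α := by
      by_contra! hcon
      apply hσ₀
      have : σ₀ ∈ (IntermediateField.fixedField H).fixingSubgroup := by
        rw [IntermediateField.mem_fixingSubgroup_iff]
        intro x hx
        refine hcon x fun σ hσ => ?_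
        rw [IntermediateField.mem_fixedField_iff] at hx
        exact hx σ hσ
      rw [hfixing] at this
      exact this
    obtain ⟨α, hα1, hα2⟩ := hα
    have hδ0 : α - σ₀ α ≠ 0 := sub_ne_zero.2 hα2.symm
    have hact0 : ∀ σ, c σ = 0 → σ (α - σ₀ α) = α - σ₀ α := by
      intro σ hσ
      have h1 : (σ₀⁻¹ * (σ * σ₀)) α = α := by
        apply hα1
        rw [hmul, hmul, hinv, hσ, zero_add, hself]
      have h2 : σ (σ₀ α) = σ₀ α := by
        have := congrArg σ₀ h1
        simpa [AlgEquiv.mul_apply, ← AlgEquiv.mul_apply σ₀ σ₀⁻¹] using this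
      rw [map_sub, hα1 σ hσ, h2]
    have hact1 : ∀ σ, c σ ≠ 0 → σ (α - σ₀ α) = -(α - σ₀ α) := by
      intro σ hσ
      have h1 : (σ₀⁻¹ * σ) α = α := by
        apply hα1
        rw [hmul, hinv, hT σ hσ, hT σ₀ hσ₀, pointT_add_self]
      have h2 : (σ * σ₀) α = α := by
        apply hα1
        rw [hmul, hT σ hσ, hT σ₀ hσ₀, pointT_add_self]
      have h3 : σ α = σ₀ α := by
        have := congrArg σ₀ h1
        simpa [AlgEquiv.mul_apply, ← AlgEquiv.mul_apply σ₀ σ₀⁻¹] using this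
      rw [AlgEquiv.mul_apply] at h2
      rw [map_sub, h3, h2, neg_sub]
    have hrat : (α - σ₀ α) ^ 2 ∈ Set.range (algebraMap ℚ QBar) := by
      rw [InfiniteGalois.mem_range_algebraMap_iff_fixed]
      intro σ
      rw [map_pow]
      by_cases hσ : c σ = 0
      · rw [hact0 σ hσ]
      · rw [hact1 σ hσ, neg_sq]
    obtain ⟨d, hd⟩ := hrat
    refine ⟨d, α - σ₀ α, hδ0, hd.symm, Subtype.ext (funext fun σ => ?_)⟩
    rw [quadCocycle_apply]
    change c σ = _
    by_cases hσ : c σ = 0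
    · rw [hact0 σ hσ, if_pos rfl, hσ]
    · rw [hact1 σ hσ, if_neg fun h1 => hδ0 (CharZero.neg_eq_self_iff.1 h1), hT σ hσ]

/-! ### Local triviality -/

/-- `ℚ̄` is normal over `ℚ`, so `τ` preserves its image under `ι`. -/
theorem exists_restrict {L : Type*} [Field L] [Algebra ℚ L] (ι : QBar →ₐ[ℚ] AlgebraicClosure L)
    (τ : AlgebraicClosure L ≃ₐ[L] AlgebraicClosure L) :
    ∃ σ : QBar ≃ₐ[ℚ] QBar, ∀ x, ι (σ x) = τ (ι x) := by
  let _ : Algebra QBar (AlgebraicClosure L) := ι.toRingHom.toAlgebra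
  have : @IsScalarTower ℚ QBar (AlgebraicClosure L) Algebra.toSMul Algebra.toSMul
      Algebra.toSMul := IsScalarTower.of_algebraMap_eq fun x => (ι.commutes x).symm
  let τ' : AlgebraicClosure L →ₐ[ℚ] AlgebraicClosure L := τ.toAlgHom.restrictScalars ℚ
  exact ⟨τ'.restrictNormal' QBar, fun x => τ'.restrictNormal_commutes QBar x⟩

/-- The point `P` must satisfy `τ P = P` or `τ P = P + T` according to the sign of `τ` on `ι δ`. If
`P` is `O` or `T`, the sign is always trivial and `d` is a square. Otherwise `τ` acts on `r`, `w`
and `ι δ` by a common sign, so `s = r / ι δ` and `t = w / ι δ` lie in `L` and solve the quartic;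
conversely such `s`, `t` give back `P`. -/
theorem locallyTrivial_quadCocycle_iff (h : Admissible p q m D) {d : ℚ} {δ : QBar} (hδ0 : δ ≠ 0)
    (hδ : δ ^ 2 = algebraMap ℚ QBar d) (L : Type) [Field L] [Algebra ℚ L] :
    LocallyTrivial (curveE' (-1) p q m D) L (quadCocycle h hδ0 hδ).1 ↔
      LocalImage ((p : L) * D) (q * D) (algebraMap ℚ L d) := by
  have hgal : IsGalois L (AlgebraicClosure L) :=
    have := algebraRat.charZero L
    isGalois_algebraicClosure L
  have hd0 : d ≠ 0 := by
    rintro rfl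
    apply hδ0
    simpa using hδ
  have hdL : algebraMap ℚ L d ≠ 0 := (map_ne_zero _).2 hd0
  have hεsq : ∀ ι : QBar →ₐ[ℚ] AlgebraicClosure L,
      ι δ ^ 2 = algebraMap L (AlgebraicClosure L) (algebraMap ℚ L d) := by
    intro ι
    rw [← map_pow, hδ, AlgHom.commutes, ← IsScalarTower.algebraMap_apply]
  have hε0 : ∀ ι : QBar →ₐ[ℚ] AlgebraicClosure L, ι δ ≠ 0 := fun ι => by simpa using hδ0
  rw [localImage_iff_quartic hdL]
  constructor
  · intro hloc
    let ι : QBar →ₐ[ℚ] AlgebraicClosure L := IsAlgClosed.lift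
    obtain ⟨P, hP⟩ := hloc ι
    by_cases htriv : P = 0 ∨ P = pointT _ h
    · left
      have hfixed : ∀ τ : AlgebraicClosure L ≃ₐ[L] AlgebraicClosure L, τ (ι δ) = ι δ := by
        intro τ
        obtain ⟨σ, hσ⟩ := exists_restrict ι τ
        have h1 := hP τ σ hσ
        have h2 : Affine.Point.map (W' := (curveE' (-1) p q m D).toAffine) τ.toAlgHom P = P := by
          rcases htriv with h3 | h3 <;> rw [h3]
          · exact map_zero _
          · exact map_pointT h _
        rw [h2, sub_self, quadCocycle_apply] at h1
        split_ifs at h1 with h3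
        · rw [← hσ, h3]
        · rw [map_pointT] at h1
          exact absurd h1 (pointT_ne_zero h)
      obtain ⟨x, hx⟩ := (InfiniteGalois.mem_range_algebraMap_iff_fixed (k := L) (ι δ)).2 hfixed
      refine ⟨x, (algebraMap L (AlgebraicClosure L)).injective ?_⟩
      rw [← hεsq ι, ← hx, map_mul, sq]
    · right
      push Not at htriv
      obtain ⟨r, w, hrw, rfl⟩ := exists_halfPoint h htriv.1 htriv.2
      have hact : ∀ τ : AlgebraicClosure L ≃ₐ[L] AlgebraicClosure L,
          (τ r = r ∧ τ w = w ∧ τ (ι δ) = ι δ) ∨ (τ r = -r ∧ τ w = -w ∧ τ (ι δ) = -ι δ) := by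
        intro τ
        obtain ⟨σ, hσ⟩ := exists_restrict ι τ
        have h1 := hP τ σ hσ
        rw [map_halfPoint, quadCocycle_apply] at h1
        rw [← hσ]
        rcases apply_eq_or_eq_neg hδ σ with h2 | h2
        · left
          rw [if_pos h2, map_zero, eq_comm, sub_eq_zero] at h1
          obtain ⟨h3, h4⟩ := halfPoint_inj h h1
          exact ⟨h3, h4, by rw [h2]⟩
        · right
          rw [if_neg (by
            rw [h2]
            exact fun h1 => hδ0 (CharZero.neg_eq_self_iff.1 h1)), map_pointT,
            eq_sub_iff_add_eq, add_comm, halfPoint_add_pointT] at h1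
          obtain ⟨h3, h4⟩ := halfPoint_inj h h1
          exact ⟨h3.symm, h4.symm, by rw [h2, map_neg]⟩
      obtain ⟨s, hs⟩ := (InfiniteGalois.mem_range_algebraMap_iff_fixed (k := L) (r / ι δ)).2 (by
        intro τ
        rw [map_div₀]
        rcases hact τ with ⟨h1, -, h2⟩ | ⟨h1, -, h2⟩ <;> rw [h1, h2]
        exact neg_div_neg_eq _ _)
      obtain ⟨t, ht⟩ := (InfiniteGalois.mem_range_algebraMap_iff_fixed (k := L) (w / ι δ)).2 (by
        intro τ
        rw [map_div₀]
        rcases hact τ with ⟨-, h1, h2⟩ | ⟨-, h1, h2⟩ <;> rw [h1, h2]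
        exact neg_div_neg_eq _ _)
      refine ⟨s, t, (algebraMap L (AlgebraicClosure L)).injective ?_⟩
      rw [eq_div_iff (hε0 ι)] at hs ht
      rw [← hs, ← ht, mul_pow, mul_pow, hεsq ι] at hrw
      simp only [map_mul, map_sub, map_pow, map_natCast]
      linear_combination hrw
  · rintro (⟨s, hs⟩ | ⟨s, t, hst⟩) ι
    · refine ⟨0, fun τ σ hσ => ?_⟩
      have h1 : ι δ = algebraMap L _ s ∨ ι δ = -algebraMap L _ s := by
        apply sq_eq_sq_iff_eq_or_eq_neg.1
        rw [hεsq, hs, map_mul, sq]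
      have h2 : τ (ι δ) = ι δ := by
        rcases h1 with h1 | h1 <;> simp [h1]
      rw [← hσ] at h2
      rw [quadCocycle_apply, if_pos (ι.injective h2)]
      simp
    · have hrw : (ι δ * algebraMap L _ t) ^ 2 =
          ((ι δ * algebraMap L _ s) ^ 2 - p * D) * ((ι δ * algebraMap L _ s) ^ 2 - q * D) := by
        have := congrArg (algebraMap L (AlgebraicClosure L)) hst
        simp only [map_mul, map_sub, map_pow, map_natCast] at this
        rw [mul_pow, mul_pow, hεsq]
        exact this
      refine ⟨halfPoint _ _ h hrw, fun τ σ hσ => ?_⟩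
      rw [quadCocycle_apply, map_halfPoint, eq_sub_iff_add_eq]
      rcases apply_eq_or_eq_neg hδ σ with h2 | h2
      · have h3 : τ.toAlgHom (ι δ) = ι δ := by
          change τ (ι δ) = _
          rw [← hσ, h2]
        rw [if_pos h2, map_zero, zero_add]
        congr 1 <;> rw [map_mul, h3, AlgHom.commutes]
      · have h3 : τ.toAlgHom (ι δ) = -ι δ := by
          change τ (ι δ) = _
          rw [← hσ, h2, map_neg]
        rw [h2, if_neg fun h1 => hδ0 (CharZero.neg_eq_self_iff.1 h1), map_pointT, add_comm,
          halfPoint_add_pointT]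
        congr 1 <;> rw [map_mul, h3, AlgHom.commutes, neg_mul]

end Cocycles
end TwoIsogenySelmer

namespace TwoIsogenySelmer

/-! ### The local conditions on a divisor of `p D` -/

section Arithmetic

theorem padicValNat_of_squarefree {n l : ℕ} (hn : Squarefree n) (hl : l.Prime) :
    padicValNat l n = if l ∣ n then 1 else 0 := by
  have : Fact l.Prime := ⟨hl⟩
  split_ifs with h
  · apply le_antisymm
    · rw [← Nat.factorization_def n hl]
      exact hn.natFactorization_le_one l
    · exact one_le_padicValNat_of_dvd hn.ne_zero h
  · exact padicValNat.eq_zero_of_not_dvd h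

theorem not_dvd_div_of_squarefree {n d l : ℕ} (hn : Squarefree n) (hd : d ∣ n) (hl : l.Prime)
    (hld : l ∣ d) : ¬ l ∣ n / d := by
  obtain ⟨e, rfl⟩ := hd
  have hd0 : d ≠ 0 := left_ne_zero_of_mul hn.ne_zero
  rw [Nat.mul_div_cancel_left _ (Nat.pos_of_ne_zero hd0)]
  intro h
  exact hl.not_isUnit (hn l (mul_dvd_mul hld h))

theorem isSquare_natCast_padic_iff_jacobiSym {l : ℕ} [Fact l.Prime] (hl : l ≠ 2) {n : ℕ}
    (hn : ¬ l ∣ n) : IsSquare (n : ℚ_[l]) ↔ jacobiSym n l = 1 := by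
  have hn' : ¬ (l : ℤ) ∣ (n : ℤ) := by exact_mod_cast hn
  have h1 := isSquare_intCast_iff_zmod hl hn'
  rw [Int.cast_natCast] at h1
  rw [h1, ← jacobiSym.legendreSym.to_jacobiSym, legendreSym.eq_one_iff l (intCast_zmod_ne_zero hn')]

/-- The condition at a prime `ℓ ∣ D` with `(pq / ℓ) = 1`. -/
theorem localImage_iff_of_dvd_of_jacobiSym_eq_one {p q N l d : ℕ} [Fact l.Prime] (hl : l ≠ 2)
    (hpN : Squarefree (p * N)) (hqN : Squarefree (q * N)) (hlN : l ∣ N)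
    (hJ : jacobiSym (p * q) l = 1) (hd : d ∣ p * N) :
    LocalImage ((p : ℚ_[l]) * N) (q * N) d ↔
      (¬ l ∣ d → jacobiSym d l = 1) ∧ (l ∣ d → jacobiSym (p * N / d : ℕ) l = 1) := by
  have hlp : l.Prime := Fact.out
  have hd0 : d ≠ 0 := ne_zero_of_dvd_ne_zero hpN.ne_zero hd
  have hdL : (d : ℚ_[l]) ≠ 0 := by exact_mod_cast hd0
  have hp : ¬ l ∣ p := fun h => hlp.not_isUnit (hpN l (mul_dvd_mul h hlN))
  have hq : ¬ l ∣ q := fun h => hlp.not_isUnit (hqN l (mul_dvd_mul h hlN))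
  have hva : ((p : ℚ_[l]) * N).valuation = 1 := by
    rw [← Nat.cast_mul, Padic.valuation_natCast, padicValNat_of_squarefree hpN hlp,
      if_pos (hlN.mul_left p)]
    rfl
  have hvb : ((q : ℚ_[l]) * N).valuation = 1 := by
    rw [← Nat.cast_mul, Padic.valuation_natCast, padicValNat_of_squarefree hqN hlp,
      if_pos (hlN.mul_left q)]
    rfl
  have hab : IsSquare ((p : ℚ_[l]) * N * (q * N)) := by
    have h1 : IsSquare ((p * q : ℕ) : ℚ_[l]) := by
      rw [isSquare_natCast_padic_iff_jacobiSym hl (hlp.not_dvd_mul hp hq)]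
      exact_mod_cast hJ
    rw [show (p : ℚ_[l]) * N * (q * N) = (p * q : ℕ) * (N * N) by push_cast; ring]
    exact h1.mul (IsSquare.mul_self _)
  rw [localImage_iff_of_additive_reduction_of_isSquare hl hva hvb hab]
  have hvd : (d : ℚ_[l]).valuation = if l ∣ d then 1 else 0 := by
    rw [Padic.valuation_natCast, padicValNat_of_squarefree (hpN.squarefree_of_dvd hd) hlp]
    split_ifs <;> rfl
  have ha0 : (p : ℚ_[l]) * N ≠ 0 := by
    intro h
    simp [h] at hva
  by_cases hld : l ∣ d
  · rw [if_pos hld] at hvd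
    have h1 : ¬ IsSquare (d : ℚ_[l]) := by
      intro h
      have := even_valuation_of_isSquare h
      rw [hvd] at this
      exact absurd this (by decide)
    -- Writing `p N = d e` gives `p N d = d² e`. The parity of the valuation of `d` decides which of
    -- the classes `1` and `a` it can have.
    have h2 : IsSquare ((p : ℚ_[l]) * N * d) ↔ IsSquare ((p * N / d : ℕ) : ℚ_[l]) := by
      obtain ⟨e, he⟩ := hd
      rw [← Nat.cast_mul, he, Nat.mul_div_cancel_left _ (Nat.pos_of_ne_zero hd0), Nat.cast_mul,
        mul_right_comm]
      exact isSquare_mul_iff_right (mul_ne_zero hdL hdL) (IsSquare.mul_self _)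
    rw [h2, isSquare_natCast_padic_iff_jacobiSym hl (not_dvd_div_of_squarefree hpN hd hlp hld)]
    tauto
  · rw [if_neg hld] at hvd
    have h1 : ¬ IsSquare ((p : ℚ_[l]) * N * d) := by
      intro h
      have := even_valuation_of_isSquare h
      rw [Padic.valuation_mul ha0 hdL, hva, hvd] at this
      exact absurd this (by decide)
    rw [isSquare_natCast_padic_iff_jacobiSym hl hld]
    tauto

/-- `ab = p q N²` has the class of the non-residue unit `p q`, and `a` has valuation one. -/
theorem localImage_of_dvd_of_jacobiSym_eq_neg_one {p q N l : ℕ} [Fact l.Prime] (hl : l ≠ 2)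
    (hpN : Squarefree (p * N)) (hqN : Squarefree (q * N)) (hlN : l ∣ N)
    (hJ : jacobiSym (p * q) l = -1) {d : ℚ_[l]} (hd : d ≠ 0) :
    LocalImage ((p : ℚ_[l]) * N) (q * N) d := by
  have hlp : l.Prime := Fact.out
  refine localImage_of_additive_reduction_of_nonresidue hl (n := (p * q : ℤ)) ?_ ?_ ?_ ?_ hd
  · rw [← Nat.cast_mul, Padic.valuation_natCast, padicValNat_of_squarefree hpN hlp,
      if_pos (hlN.mul_left p)]
    exact odd_one
  · exact_mod_cast hqN.ne_zero
  · rwa [← legendreSym.eq_neg_one_iff l, jacobiSym.legendreSym.to_jacobiSym]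
  · refine ⟨p * q * N, ?_⟩
    push_cast
    ring

theorem localImage_of_dvd_left {p q N l : ℕ} [Fact l.Prime] (hl : l ≠ 2)
    (hpN : Squarefree (p * N)) (hlp : l ∣ p * N) (hlq : ¬ l ∣ q * N) {d : ℚ_[l]} (hd : d ≠ 0) :
    LocalImage ((p : ℚ_[l]) * N) (q * N) d := by
  have hlp' : l.Prime := Fact.out
  have := localImage_of_multiplicative_reduction hl (a := (p * N : ℕ)) (b := (q * N : ℕ)) (d := d)
    (by
      rw [Int.cast_natCast, Padic.valuation_natCast, padicValNat_of_squarefree hpN hlp', if_pos hlp]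
      exact odd_one)
    (by exact_mod_cast hlp) (by exact_mod_cast hlq) hd
  push_cast at this
  exact this

/-- `d` is a local image at all places of `ℚ`. -/
def IsSelmer (p q N : ℕ) (d : ℚ) : Prop :=
  LocalImage ((p : ℝ) * N) (q * N) d ∧
    ∀ (l : ℕ) [Fact l.Prime], LocalImage ((p : ℚ_[l]) * N) (q * N) d

variable {p q m N : ℕ}

theorem Admissible.squarefree_p_mul (h : Admissible p q m N) :
    Squarefree (p * N) :=
  (Nat.squarefree_mul ((Nat.Prime.coprime_iff_not_dvd h.prime_p).2 h.not_dvd_p)).2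
    ⟨h.prime_p.prime.squarefree, h.squarefree_D⟩

theorem Admissible.squarefree_q_mul (h : Admissible p q m N) :
    Squarefree (q * N) :=
  (Nat.squarefree_mul ((Nat.Prime.coprime_iff_not_dvd h.prime_q).2 h.not_dvd_q)).2
    ⟨h.prime_q.prime.squarefree, h.squarefree_D⟩

theorem Admissible.p_ne_q (h : Admissible p q m N) : p ≠ q := by
  have := h.diff
  have h2 : 0 < 2 ^ m := by positivity
  omega

theorem Admissible.not_p_dvd (h : Admissible p q m N) : ¬ p ∣ q * N := by
  refine h.prime_p.not_dvd_mul (fun h1 => ?_) h.not_dvd_p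
  exact h.p_ne_q ((Nat.prime_dvd_prime_iff_eq h.prime_p h.prime_q).1 h1)

theorem Admissible.not_q_dvd (h : Admissible p q m N) : ¬ q ∣ p * N := by
  refine h.prime_q.not_dvd_mul (fun h1 => ?_) h.not_dvd_q
  exact h.p_ne_q ((Nat.prime_dvd_prime_iff_eq h.prime_q h.prime_p).1 h1).symm

/-- A divisor `d` of `p N` is positive and is a unit at the good primes, while `p`, `q` and the
primes of `N` with symbol `-1` impose nothing. Only `2` and the primes of `N` with symbol `1`
remain. -/
theorem isSelmer_iff (h : Admissible p q m N) {d : ℕ} (hd : d ∣ p * N)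
    (hres : ∀ l : ℕ, l.Prime → l ∣ N → jacobiSym (p * q) l = 1 ∨ jacobiSym (p * q) l = -1) :
    IsSelmer p q N d ↔
      (∀ l : ℕ, l.Prime → l ∣ N → jacobiSym (p * q) l = 1 →
        (¬ l ∣ d → jacobiSym d l = 1) ∧ (l ∣ d → jacobiSym (p * N / d : ℕ) l = 1)) ∧
      ∀ x ∈ extraVertices m p N, jacobiSym x d = 1 := by
  have hpN := h.squarefree_p_mul
  have hqN := h.squarefree_q_mul
  have hd0 : d ≠ 0 := ne_zero_of_dvd_ne_zero hpN.ne_zero hd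
  have hpN2 : (p * N) % 2 = 1 := Nat.odd_iff.1 (h.odd_p.mul h.odd_D)
  have hqN2 : (q * N) % 2 = 1 := Nat.odd_iff.1 (h.odd_q.mul h.odd_D)
  have hd2 : d % 2 = 1 := Nat.odd_iff.1 (Odd.of_dvd_nat (h.odd_p.mul h.odd_D) hd)
  have hne2 : ∀ l, l ∣ p * N → l ≠ 2 := by
    rintro l hl rfl
    omega
  have hne2' : ∀ l, l ∣ q * N → l ≠ 2 := by
    rintro l hl rfl
    omega
  have htwo : LocalImage ((p : ℚ_[2]) * N) (q * N) d ↔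
      ∀ x ∈ extraVertices m p N, jacobiSym x d = 1 := by
    rw [← localImage_two_iff_jacobiSym h.one_le_m (Nat.odd_iff.1 h.odd_p)
      (Nat.odd_iff.1 h.odd_D) hd2, ← h.diff]
    push_cast
    rfl
  constructor
  · rintro ⟨-, hloc⟩
    constructor
    · intro l hl hlN hJ
      have : Fact l.Prime := ⟨hl⟩
      rw [← localImage_iff_of_dvd_of_jacobiSym_eq_one (hne2 l (hlN.mul_left p)) hpN hqN hlN hJ hd]
      exact_mod_cast hloc l
    · rw [← htwo]
      exact_mod_cast hloc 2
  · rintro ⟨h1, h2⟩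
    constructor
    · exact Or.inl ⟨√d, by push_cast; exact (Real.mul_self_sqrt (Nat.cast_nonneg d)).symm⟩
    · intro l hlF
      have hl : l.Prime := hlF.out
      have hdl : (d : ℚ_[l]) ≠ 0 := by exact_mod_cast hd0
      push_cast
      by_cases hlN : l ∣ N
      · have hl2 := hne2 l (hlN.mul_left p)
        rcases hres l hl hlN with hJ | hJ
        · exact (localImage_iff_of_dvd_of_jacobiSym_eq_one hl2 hpN hqN hlN hJ hd).2
            (h1 l hl hlN hJ)
        · exact localImage_of_dvd_of_jacobiSym_eq_neg_one hl2 hpN hqN hlN hJ hdl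
      by_cases hlp : l ∣ p
      · obtain rfl := (Nat.prime_dvd_prime_iff_eq hl h.prime_p).1 hlp
        exact localImage_of_dvd_left (hne2 l (dvd_mul_right _ _)) hpN (dvd_mul_right _ _)
          h.not_p_dvd hdl
      by_cases hlq : l ∣ q
      · obtain rfl := (Nat.prime_dvd_prime_iff_eq hl h.prime_q).1 hlq
        exact (localImage_of_dvd_left (hne2' l (dvd_mul_right _ _)) hqN (dvd_mul_right _ _)
          h.not_q_dvd hdl).comm
      by_cases hl2 : l = 2
      · subst hl2
        exact htwo.2 h2
      · have := localImage_of_good_reduction hl2 (a := (p * N : ℕ)) (b := (q * N : ℕ))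
          (d := (d : ℚ_[l]))
          (by exact_mod_cast hl.not_dvd_mul hlp hlN) (by exact_mod_cast hl.not_dvd_mul hlq hlN)
          -- `a - b = -2 ^ m N`, so away from `2` and `N` the roots stay distinct modulo `ℓ`.
          (by
            rw [h.diff, show ((p * N : ℕ) : ℤ) - ((p + 2 ^ m) * N : ℕ) = -((2 ^ m * N : ℕ) : ℤ) by
              push_cast; ring, dvd_neg]
            intro h3
            have h4 : l ∣ 2 ^ m * N := by exact_mod_cast h3
            rcases hl.dvd_mul.1 h4 with h5 | h5
            · exact hl2 ((Nat.prime_dvd_prime_iff_eq hl Nat.prime_two).1 (hl.dvd_of_dvd_pow h5))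
            · exact hlN h5) hdl (by
            rw [Padic.valuation_natCast, padicValNat.eq_zero_of_not_dvd fun h3 =>
              hl.not_dvd_mul hlp hlN (h3.trans hd)]
            exact Even.zero)
        push_cast at this
        exact this

/-! ### Representing Selmer classes by divisors of `pD` -/

theorem IsSelmer.pos (h : Admissible p q m N) {d : ℚ} (hd0 : d ≠ 0) (hd : IsSelmer p q N d) :
    0 < d := by
  have hp : (0 : ℝ) < p := by exact_mod_cast h.prime_p.pos
  have hq : (0 : ℝ) < q := by exact_mod_cast h.prime_q.pos
  have hN : (0 : ℝ) < N := by exact_mod_cast Nat.pos_of_ne_zero h.squarefree_D.ne_zero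
  have := (localImage_real_iff (mul_pos hp hN) (mul_pos hq hN) (by exact_mod_cast hd0)).1 hd.1
  exact_mod_cast this

theorem IsSelmer.of_isSquare_mul {d e : ℚ} (hd0 : d ≠ 0) (hd : IsSelmer p q N d)
    (hde : IsSquare (d * e)) : IsSelmer p q N e := by
  obtain ⟨r, hr⟩ := hde
  refine ⟨hd.1.of_isSquare_mul (by exact_mod_cast hd0) ⟨r, by exact_mod_cast hr⟩, fun l _ =>
    (hd.2 l).of_isSquare_mul (by exact_mod_cast hd0) ⟨r, by exact_mod_cast hr⟩⟩

/-- Invariance under translation by the global class `p q` of the point `(0, 0)`. -/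
theorem IsSelmer.mul_left (h : Admissible p q m N) {d : ℚ} (hd0 : d ≠ 0) (hd : IsSelmer p q N d) :
    IsSelmer p q N (p * q * d) := by
  have hp := h.prime_p.ne_zero
  have hq := h.prime_q.ne_zero
  have hN := h.squarefree_D.ne_zero
  have h1 : IsSelmer p q N (p * N * (q * N) * d) := by
    constructor
    · push_cast
      exact hd.1.mul_left (by exact_mod_cast mul_ne_zero hp hN)
        (by exact_mod_cast mul_ne_zero hq hN)
    · intro l _
      push_cast
      exact (hd.2 l).mul_left (by exact_mod_cast mul_ne_zero hp hN)
        (by exact_mod_cast mul_ne_zero hq hN)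
  have hp' : (p : ℚ) ≠ 0 := by exact_mod_cast hp
  have hq' : (q : ℚ) ≠ 0 := by exact_mod_cast hq
  have hN' : (N : ℚ) ≠ 0 := by exact_mod_cast hN
  refine h1.of_isSquare_mul ?_ ⟨p * q * N * d, by ring⟩
  simp [hp', hq', hN', hd0]

/-- Outside `p q N` both `a` and `b` are units, so the class has even valuation, whereas a prime
divides a square-free number only once. The prime `2` is excluded in the same way. -/
theorem IsSelmer.dvd_of_squarefree {d : ℕ} (hd : Squarefree d)
    (hsel : IsSelmer p q N d) {l : ℕ} (hl : l.Prime) (hld : l ∣ d) : l ∣ q ∨ l ∣ p * N := by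
  have : Fact l.Prime := ⟨hl⟩
  by_contra! hcon
  have hN : ¬ l ∣ N := fun h1 => hcon.2 (h1.mul_left p)
  have h1 : LocalImage ((p * N : ℕ) : ℚ_[l]) ((q * N : ℕ) : ℚ_[l]) (d : ℚ_[l]) := by
    exact_mod_cast hsel.2 l
  have h2 := h1.even_valuation ((Padic.norm_natCast_eq_one_iff).2 ((hl.coprime_iff_not_dvd).2 hcon.2))
    ((Padic.norm_natCast_eq_one_iff).2 ((hl.coprime_iff_not_dvd).2 (hl.not_dvd_mul hcon.1 hN)))
    (by exact_mod_cast hd.ne_zero)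
  rw [Padic.valuation_natCast, padicValNat_of_squarefree hd hl, if_pos hld] at h2
  exact absurd h2 (by decide)

theorem eq_of_squarefree_of_isSquare_mul {d e : ℕ} (hd : Squarefree d) (he : Squarefree e)
    (hde : IsSquare (d * e)) : d = e := by
  rw [Nat.Squarefree.ext_iff hd he]
  intro l hl
  have : Fact l.Prime := ⟨hl⟩
  obtain ⟨r, hr⟩ := hde
  have hr0 : r ≠ 0 := by
    rintro rfl
    exact mul_ne_zero hd.ne_zero he.ne_zero hr
  have h1 := congrArg (padicValNat l) hr
  rw [padicValNat.mul hd.ne_zero he.ne_zero, padicValNat.mul hr0 hr0,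
    padicValNat_of_squarefree hd hl, padicValNat_of_squarefree he hl] at h1
  split_ifs at h1 <;> first | tauto | omega

theorem exists_squarefree_nat {d : ℚ} (hd : 0 < d) :
    ∃ n : ℕ, Squarefree n ∧ IsSquare (d * n) := by
  obtain ⟨a, b, hab, ha⟩ := Nat.sq_mul_squarefree (d.num.natAbs * d.den)
  refine ⟨a, ha, ?_⟩
  have hnum : ((d.num.natAbs : ℕ) : ℚ) = d.num := by
    rw [Nat.cast_natAbs, abs_of_nonneg (Rat.num_nonneg.2 hd.le)]
  have h1 : (b : ℚ) ^ 2 * a = d.num * d.den := by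
    rw [← hnum]
    exact_mod_cast hab
  have hden : (d.den : ℚ) ≠ 0 := by exact_mod_cast d.den_nz
  have hb : (b : ℚ) ≠ 0 := by
    rintro hb
    rw [hb] at h1
    have h2 : (d.num : ℚ) ≠ 0 := by exact_mod_cast (Rat.num_pos.2 hd).ne'
    exact mul_ne_zero h2 hden (by rw [← h1]; ring)
  refine ⟨d * d.den / b, ?_⟩
  have h3 : (d.num : ℚ) = d * d.den := (Rat.mul_den_eq_num d).symm
  rw [h3] at h1
  field_simp
  linear_combination h1

/-- Up to squares and the class `p q`, a Selmer class is a divisor of `p D`. -/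
theorem IsSelmer.exists_dvd (h : Admissible p q m N) {d : ℚ} (hd0 : d ≠ 0)
    (hd : IsSelmer p q N d) : ∃ e : ℕ, e ∣ p * N ∧ IsSelmer p q N e ∧
      (IsSquare (d * e) ∨ IsSquare (d * (p * q * e))) := by
  have key : ∀ n : ℕ, Squarefree n → ¬ q ∣ n → IsSelmer p q N n → n ∣ p * N := by
    intro n hn hqn hsel
    rw [← Nat.prod_primeFactors_of_squarefree hn]
    refine (Finset.prod_dvd_prod_of_subset _ _ _ fun l hl => ?_).trans
      (Nat.prod_primeFactors_dvd (p * N))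
    obtain ⟨hl1, hl2, -⟩ := Nat.mem_primeFactors.1 hl
    refine Nat.mem_primeFactors.2 ⟨hl1, ?_, h.squarefree_p_mul.ne_zero⟩
    refine (hsel.dvd_of_squarefree hn hl1 hl2).resolve_left fun h1 => hqn ?_
    rwa [← (Nat.prime_dvd_prime_iff_eq hl1 h.prime_q).1 h1]
  obtain ⟨a, ha, hsq⟩ := exists_squarefree_nat (hd.pos h hd0)
  have ha0 : (a : ℚ) ≠ 0 := by exact_mod_cast ha.ne_zero
  have hsel := hd.of_isSquare_mul hd0 hsq
  by_cases hqa : q ∣ a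
  · have hpq0 : (p * q * a : ℚ) ≠ 0 := by
      exact_mod_cast mul_ne_zero (mul_ne_zero h.prime_p.ne_zero h.prime_q.ne_zero) ha.ne_zero
    have hsel2 := hsel.mul_left h ha0
    obtain ⟨e, he, hsq2⟩ := exists_squarefree_nat (hsel2.pos h hpq0)
    have hsel3 := hsel2.of_isSquare_mul hpq0 hsq2
    -- If `q` divided both `a` and `e`, the square `p q a e` would have `q`-adic valuation `3`.
    have hqe : ¬ q ∣ e := by
      intro hqe
      have : Fact q.Prime := ⟨h.prime_q⟩
      obtain ⟨r, hr⟩ : IsSquare (p * q * a * e) := by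
        rw [← Rat.isSquare_natCast_iff]
        exact_mod_cast hsq2
      have hpqa : p * q * a ≠ 0 := by exact_mod_cast hpq0
      have hr0 : r ≠ 0 := by
        rintro rfl
        exact mul_ne_zero hpqa he.ne_zero hr
      have h1 := congrArg (padicValNat q) hr
      rw [padicValNat.mul hpqa he.ne_zero, padicValNat.mul hr0 hr0,
        padicValNat.mul (mul_ne_zero h.prime_p.ne_zero h.prime_q.ne_zero) ha.ne_zero,
        padicValNat.mul h.prime_p.ne_zero h.prime_q.ne_zero,
        padicValNat_of_squarefree ha h.prime_q, padicValNat_of_squarefree he h.prime_q,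
        if_pos hqa, if_pos hqe, padicValNat.self h.prime_q.one_lt,
        padicValNat.eq_zero_of_not_dvd fun h2 => h.not_q_dvd (h2.mul_right N)] at h1
      omega
    refine ⟨e, key e he hqe hsel3, hsel3, Or.inr ?_⟩
    refine isSquare_mul_trans ha0 hsq ?_
    rwa [show (a : ℚ) * (p * q * e) = p * q * a * e by ring]
  · exact ⟨a, key a ha hqa hsel, hsel, Or.inl hsq⟩

end Arithmetic
end TwoIsogenySelmer

namespace TwoIsogenySelmer
open WeierstrassCurve

/-! ### The order of the Selmer group -/

section Selmer

open scoped Classical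

variable {p q m N : ℕ}

/-- Both kernel points are rational, so `σ T - T` always vanishes and `H¹` is the group of cocycles
itself. -/
theorem coboundaries_eq_bot (h : Admissible p q m N) :
    coboundaries (curveE' (-1) p q m N) (kerPhiHat (-1) QBar h) = ⊥ := by
  rw [eq_bot_iff]
  rintro c ⟨T, hT, hc⟩
  rw [AddSubgroup.mem_bot]
  refine Subtype.ext (funext fun σ => ?_)
  rw [hc σ]
  rcases (mem_kerPhiHat_iff h).1 hT with rfl | rfl
  · simp
  · rw [map_pointT, sub_self]
    rfl

theorem card_selmerPhiHat (h : Admissible p q m N) :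
    Nat.card (selmerPhiHat (-1) h) =
      Nat.card (selmerCocycles (curveE' (-1) p q m N) (kerPhiHat (-1) QBar h)) := by
  refine (Nat.card_congr (AddSubgroup.equivMapOfInjective _ _ ?_).toEquiv).symm
  rw [injective_iff_map_eq_zero]
  intro c hc
  have h1 := (QuotientAddGroup.eq_zero_iff c).1 hc
  rwa [coboundaries_eq_bot, AddSubgroup.mem_bot] at h1

theorem quadCocycle_mem_selmerCocycles_iff (h : Admissible p q m N) {d : ℚ} {δ : QBar}
    (hδ0 : δ ≠ 0) (hδ : δ ^ 2 = algebraMap ℚ QBar d) :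
    quadCocycle h hδ0 hδ ∈ selmerCocycles (curveE' (-1) p q m N) (kerPhiHat (-1) QBar h) ↔
      IsSelmer p q N d := by
  refine and_congr ?_ (forall_congr' fun l => forall_congr' fun _ => ?_)
  · rw [locallyTrivial_quadCocycle_iff, eq_ratCast]
  · rw [locallyTrivial_quadCocycle_iff, eq_ratCast]

theorem exists_sqrt {d : ℚ} (hd : d ≠ 0) :
    ∃ δ : QBar, δ ≠ 0 ∧ δ ^ 2 = algebraMap ℚ QBar d := by
  obtain ⟨δ, hδ⟩ := IsAlgClosed.exists_pow_nat_eq (algebraMap ℚ QBar d) two_pos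
  refine ⟨δ, ?_, hδ⟩
  rintro rfl
  rw [zero_pow two_ne_zero, eq_comm, map_eq_zero] at hδ
  exact hd hδ

/-- Each Selmer class is represented exactly once as `d` or `p q d` with `d ∣ p N`; the Boolean
records whether the factor `p q` is present. -/
theorem card_selmerPhiHat_eq_two_mul (h : Admissible p q m N) :
    Nat.card (selmerPhiHat (-1) h) = 2 * {d : ℕ | d ∣ p * N ∧ IsSelmer p q N d}.ncard := by
  rw [card_selmerPhiHat]
  set S := {d : ℕ | d ∣ p * N ∧ IsSelmer p q N d} with hS
  have hp0 : (p : ℚ) ≠ 0 := by exact_mod_cast h.prime_p.ne_zero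
  have hq0 : (q : ℚ) ≠ 0 := by exact_mod_cast h.prime_q.ne_zero
  have hS0 : ∀ d : S, ((d : ℕ) : ℚ) ≠ 0 := fun d => by
    exact_mod_cast ne_zero_of_dvd_ne_zero h.squarefree_p_mul.ne_zero d.2.1
  let v : Bool × S → ℚ := fun x => (bif x.1 then (p * q : ℚ) else 1) * ((x.2 : ℕ) : ℚ)
  have hv0 : ∀ x, v x ≠ 0 := by
    rintro ⟨_ | _, d⟩
    · exact mul_ne_zero one_ne_zero (hS0 d)
    · exact mul_ne_zero (mul_ne_zero hp0 hq0) (hS0 d)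
  have hvsel : ∀ x, IsSelmer p q N (v x) := by
    rintro ⟨_ | _, d⟩
    · change IsSelmer p q N (1 * ((d : ℕ) : ℚ))
      rw [one_mul]
      exact d.2.2
    · exact d.2.2.mul_left h (hS0 d)
  choose δ hδ0 hδ using fun x => exists_sqrt (hv0 x)
  let f : Bool × S → selmerCocycles (curveE' (-1) p q m N) (kerPhiHat (-1) QBar h) := fun x =>
    ⟨quadCocycle h (hδ0 x) (hδ x), (quadCocycle_mem_selmerCocycles_iff h _ _).2 (hvsel x)⟩
  have hf : Function.Bijective f := by
    constructor
    · intro x y hxy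
      have h1 := (quadCocycle_eq_iff h (hδ0 x) (hδ0 y) (hδ x) (hδ y)).1 (congrArg Subtype.val hxy)
      have hsqf : ∀ d : S, Squarefree (d : ℕ) := fun d =>
        h.squarefree_p_mul.squarefree_of_dvd d.2.1
      -- The `q`-adic valuation of `p q d e` is `1`, so the two families of classes are disjoint.
      have hcross : ∀ d e : S, ¬ IsSquare ((p * q * (d : ℕ) * (e : ℕ) : ℕ) : ℚ) := by
        rintro d e hsq
        rw [Rat.isSquare_natCast_iff] at hsq
        obtain ⟨r, hr⟩ := hsq
        have : Fact q.Prime := ⟨h.prime_q⟩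
        have hpq := mul_ne_zero h.prime_p.ne_zero h.prime_q.ne_zero
        have hr0 : r ≠ 0 := by
          rintro rfl
          exact mul_ne_zero (mul_ne_zero hpq (hsqf d).ne_zero) (hsqf e).ne_zero hr
        have hnq : ∀ d : S, padicValNat q d = 0 := fun d =>
          padicValNat.eq_zero_of_not_dvd fun h2 => h.not_q_dvd (h2.trans d.2.1)
        have h2 := congrArg (padicValNat q) hr
        rw [padicValNat.mul (mul_ne_zero hpq (hsqf d).ne_zero) (hsqf e).ne_zero,
          padicValNat.mul hr0 hr0, padicValNat.mul hpq (hsqf d).ne_zero,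
          padicValNat.mul h.prime_p.ne_zero h.prime_q.ne_zero, hnq, hnq,
          padicValNat.self h.prime_q.one_lt,
          padicValNat.eq_zero_of_not_dvd fun h2 => h.not_q_dvd (h2.mul_right N)] at h2
        omega
      have hsame : ∀ d e : S, IsSquare (((d : ℕ) : ℚ) * (e : ℕ)) → d = e := by
        intro d e hsq
        apply Subtype.ext
        apply eq_of_squarefree_of_isSquare_mul (hsqf d) (hsqf e)
        rw [← Rat.isSquare_natCast_iff]
        exact_mod_cast hsq
      obtain ⟨_ | _, d⟩ := x <;> obtain ⟨_ | _, e⟩ := y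
      · rw [hsame d e (by simpa [v] using h1)]
      · refine absurd ?_ (hcross d e)
        convert! h1 using 1
        simp [v]
        ring
      · refine absurd ?_ (hcross d e)
        convert! h1 using 1
        simp [v]
      · rw [hsame d e]
        rw [show v (true, d) * v (true, e) =
          (p * q : ℚ) * (p * q) * (((d : ℕ) : ℚ) * (e : ℕ)) by simp [v]; ring] at h1
        exact (isSquare_mul_iff_right (mul_ne_zero (mul_ne_zero hp0 hq0) (mul_ne_zero hp0 hq0))
          (IsSquare.mul_self _)).1 h1
    · rintro ⟨c, hc⟩
      obtain ⟨d, η, hη0, hη, rfl⟩ := exists_eq_quadCocycle h c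
      have hd0 : d ≠ 0 := by
        rintro rfl
        rw [map_zero] at hη
        exact hη0 (pow_eq_zero_iff two_ne_zero |>.1 hη)
      obtain ⟨e, he1, he2, he3⟩ :=
        ((quadCocycle_mem_selmerCocycles_iff h _ _).1 hc).exists_dvd h hd0
      rcases he3 with he3 | he3
      · refine ⟨(false, ⟨e, he1, he2⟩), Subtype.ext ?_⟩
        refine (quadCocycle_eq_iff h (hδ0 _) hη0 (hδ _) hη).2 ?_
        rw [mul_comm]
        simpa [v] using he3
      · refine ⟨(true, ⟨e, he1, he2⟩), Subtype.ext ?_⟩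
        refine (quadCocycle_eq_iff h (hδ0 _) hη0 (hδ _) hη).2 ?_
        rw [mul_comm]
        simpa [v] using he3
  rw [← Nat.card_congr (Equiv.ofBijective f hf), Nat.card_prod, Nat.card_eq_fintype_card,
    Fintype.card_bool, Nat.card_coe_set_eq]

end Selmer
end TwoIsogenySelmer

/-! ### Parity of edge counts and products of Jacobi symbols -/

namespace TwoIsogenySelmer
open scoped Classical in
theorem prod_eq_one_iff_even_card {ι : Type*} (S : Finset ι) (f : ι → ℤ)
    (hf : ∀ i ∈ S, f i = 1 ∨ f i = -1) :
    ∏ i ∈ S, f i = 1 ↔ Even (S.filter fun i => f i = -1).card := by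
  have h1 : ∏ i ∈ S, f i = ∏ i ∈ S, if f i = -1 then (-1 : ℤ) else 1 :=
    Finset.prod_congr rfl fun i hi => by
      rcases hf i hi with h | h <;> simp [h]
  rw [h1, ← Finset.prod_filter, Finset.prod_const]
  exact neg_one_pow_eq_one_iff_even (by norm_num)

theorem jacobiSym_prod_left {ι : Type*} (S : Finset ι) (f : ι → ℤ) (b : ℕ) :
    jacobiSym (∏ i ∈ S, f i) b = ∏ i ∈ S, jacobiSym (f i) b := by
  induction S using Finset.cons_induction with
  | empty => simp [jacobiSym.one_left]
  | cons i S hi ih => rw [Finset.prod_cons, Finset.prod_cons, jacobiSym.mul_left, ih]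

theorem jacobiSym_prod_right {ι : Type*} (S : Finset ι) (f : ι → ℕ) (hf : ∀ i ∈ S, f i ≠ 0)
    (a : ℤ) : jacobiSym a (∏ i ∈ S, f i) = ∏ i ∈ S, jacobiSym a (f i) := by
  induction S using Finset.cons_induction with
  | empty => simp [jacobiSym.one_right]
  | cons i S hi ih =>
    rw [Finset.prod_cons, Finset.prod_cons,
      jacobiSym.mul_right' _ (hf i (Finset.mem_cons_self i S))
        (Finset.prod_ne_zero_iff.2 fun j hj => hf j (Finset.mem_cons_of_mem hj)),
      ih fun j hj => hf j (Finset.mem_cons_of_mem hj)]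

theorem eq_of_mem_extraVertices {m p N : ℕ} {x : ℤ} (hx : x ∈ extraVertices m p N) :
    x = -1 ∨ x = 2 ∨ x = -2 := by
  unfold extraVertices at hx
  split_ifs at hx <;> simp at hx <;> omega

section Graph

variable {p q m n s : ℕ} {D : Fin n → ℕ}

/-- The vertices of `g(-D)` that are prime divisors of `d`. -/
def divisorVertices (m p : ℕ) {n : ℕ} (D : Fin n → ℕ) (d : ℕ) : Set (gVertices m p D) :=
  {v | ∃ r : ℕ, r.Prime ∧ r ∣ d ∧ (v : ℤ) = r}

theorem prime_dvd_iff (hp : p.Prime) (hD : ∀ i, (D i).Prime) {r : ℕ} (hr : r.Prime) :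
    r ∣ p * ∏ i, D i ↔ r = p ∨ ∃ i, r = D i := by
  rw [hr.dvd_mul, Nat.prime_dvd_prime_iff_eq hr hp, hr.prime.dvd_finsetProd_iff]
  simp [Nat.prime_dvd_prime_iff_eq hr (hD _)]

theorem prime_mem_gVertices (hp : p.Prime) (hD : ∀ i, (D i).Prime) {r : ℕ} (hr : r.Prime)
    (hrd : r ∣ p * ∏ i, D i) : (r : ℤ) ∈ gVertices m p D := by
  rcases (prime_dvd_iff hp hD hr).1 hrd with rfl | ⟨i, rfl⟩
  · exact Or.inl (Or.inl rfl)
  · exact Or.inl (Or.inr ⟨i, rfl⟩)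

/-- The four kinds of edges become two, according to the source; the target is always a prime
divisor of `p D`, which is the form needed for a product over primes. -/
theorem gMinus_adj_iff (hp : p.Prime) (hD : ∀ i, (D i).Prime) {P Q : gVertices m p D} :
    (gMinus m p s D).Adj P Q ↔ ∃ r : ℕ, r.Prime ∧ r ∣ p * ∏ i, D i ∧ (Q : ℤ) = r ∧
      ((∃ i : Fin n, (i : ℕ) < s ∧ (P : ℤ) = D i ∧ jacobiSym r (D i) = -1) ∨
        ((P : ℤ) ∈ extraVertices m p (∏ i, D i) ∧ jacobiSym P r = -1)) := by
  constructor
  · have h1 := (prime_dvd_iff (D := D) hp hD hp).2 (Or.inl rfl)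
    have h2 := fun j => (prime_dvd_iff (D := D) hp hD (hD j)).2 (Or.inr ⟨j, rfl⟩)
    rintro (⟨i, j, hi, hP, hQ, hJ⟩ | ⟨i, hi, hP, hQ, hJ⟩ | ⟨k, hP, hQ, hJ⟩ | ⟨hP, hQ, hJ⟩)
    · exact ⟨D j, hD j, h2 j, hQ, Or.inl ⟨i, hi, hP, hJ⟩⟩
    · exact ⟨p, hp, h1, hQ, Or.inl ⟨i, hi, hP, hJ⟩⟩
    · exact ⟨D k, hD k, h2 k, hQ, Or.inr ⟨hP, hJ⟩⟩
    · exact ⟨p, hp, h1, hQ, Or.inr ⟨hP, hJ⟩⟩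
  · rintro ⟨r, hr, hrd, hQ, ⟨i, hi, hP, hJ⟩ | ⟨hP, hJ⟩⟩ <;>
      rcases (prime_dvd_iff hp hD hr).1 hrd with rfl | ⟨j, rfl⟩
    · exact Or.inr (Or.inl ⟨i, hi, hP, hQ, hJ⟩)
    · exact Or.inl ⟨i, j, hi, hP, hQ, hJ⟩
    · exact Or.inr (Or.inr (Or.inr ⟨hP, hQ, hJ⟩))
    · exact Or.inr (Or.inr (Or.inl ⟨j, hP, hQ, hJ⟩))

/-- If the arrows from `P` lead to the primes `r` with `f r = -1`, the number of those into the
prime divisors of `e` is even if and only if the product of the signs `f r` is `1`. -/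
theorem even_ncard_adj_iff (hp : p.Prime) (hD : ∀ i, (D i).Prime) {e : ℕ}
    (he0 : p * ∏ i, D i ≠ 0) (he : e ∣ p * ∏ i, D i)
    {S : Set (gVertices m p D)}
    (hS : ∀ (v : gVertices m p D) (r : ℕ), r.Prime → r ∣ p * ∏ i, D i → (v : ℤ) = r →
      (v ∈ S ↔ r ∣ e))
    {P : gVertices m p D} {f : ℕ → ℤ} (hf : ∀ r ∈ e.primeFactors, f r = 1 ∨ f r = -1)
    (hadj : ∀ Q, (gMinus m p s D).Adj P Q ↔
      ∃ r : ℕ, r.Prime ∧ r ∣ p * ∏ i, D i ∧ (Q : ℤ) = r ∧ f r = -1) :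
    Even {Q | Q ∈ S ∧ (gMinus m p s D).Adj P Q}.ncard ↔ ∏ r ∈ e.primeFactors, f r = 1 := by
  classical
  rw [prod_eq_one_iff_even_card _ _ hf, ← Set.ncard_coe_finset]
  have he1 : e ≠ 0 := ne_zero_of_dvd_ne_zero he0 he
  have hinj : Function.Injective fun v : gVertices m p D => (v : ℤ) := Subtype.val_injective
  rw [← Set.ncard_image_of_injective _ hinj,
    ← Set.ncard_image_of_injective (s := (↑(e.primeFactors.filter _) : Set ℕ))
      (f := fun r : ℕ => (r : ℤ)) Nat.cast_injective]
  suffices h : (fun v : gVertices m p D => (v : ℤ)) '' {Q | Q ∈ S ∧ (gMinus m p s D).Adj P Q} =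
      (fun r : ℕ => (r : ℤ)) '' ↑(e.primeFactors.filter fun r => f r = -1) by rw [h]
  ext x
  simp only [Set.mem_image, Set.mem_ofPred_eq, Finset.coe_filter, Nat.mem_primeFactors]
  constructor
  · rintro ⟨v, ⟨hv, hPv⟩, rfl⟩
    obtain ⟨r, hr, hrd, hvr, hfr⟩ := (hadj v).1 hPv
    exact ⟨r, ⟨⟨hr, (hS v r hr hrd hvr).1 hv, he1⟩, hfr⟩, hvr.symm⟩
  · rintro ⟨r, ⟨⟨hr, hre, -⟩, hfr⟩, rfl⟩
    have hrd := hre.trans he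
    refine ⟨⟨r, prime_mem_gVertices hp hD hr hrd⟩, ⟨?_, ?_⟩, rfl⟩
    · exact (hS _ r hr hrd rfl).2 hre
    · exact (hadj _).2 ⟨r, hr, hrd, rfl, hfr⟩

theorem two_lt_of_prime_dvd (h : Admissible p q m (∏ i, D i)) {r : ℕ} (hr : r.Prime) (hrd : r ∣ p * ∏ i, D i) : 2 < r := by
  have h1 : Odd r := (h.odd_p.mul h.odd_D).of_dvd_nat hrd
  have h2 := hr.two_le
  rcases h1 with ⟨k, hk⟩
  omega

theorem notMem_extraVertices_of_prime (h : Admissible p q m (∏ i, D i)) {r : ℕ}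
    (hr : r.Prime) (hrd : r ∣ p * ∏ i, D i) :
    (r : ℤ) ∉ extraVertices m p (∏ i, D i) := by
  intro h1
  have := eq_of_mem_extraVertices h1
  have := two_lt_of_prime_dvd h hr hrd
  omega

/-- Multiplicativity in the numerator: `(e / Dᵢ)` is the product of `(r / Dᵢ)` over primes `r ∣ e`,
none of which vanishes since `Dᵢ ∤ e`. -/
theorem even_ncard_adj_iff_of_eq (h : Admissible p q m (∏ i, D i))
    (hD : ∀ i, (D i).Prime) {e : ℕ} (he : e ∣ p * ∏ i, D i)
    {S : Set (gVertices m p D)}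
    (hS : ∀ (v : gVertices m p D) (r : ℕ), r.Prime → r ∣ p * ∏ i, D i → (v : ℤ) = r →
      (v ∈ S ↔ r ∣ e))
    {P : gVertices m p D} {i : Fin n} (hi : (i : ℕ) < s) (hP : (P : ℤ) = D i) (hie : ¬ D i ∣ e) :
    Even {Q | Q ∈ S ∧ (gMinus m p s D).Adj P Q}.ncard ↔ jacobiSym e (D i) = 1 := by
  have hsq := h.squarefree_p_mul
  have hiN : D i ∣ p * ∏ i, D i := (prime_dvd_iff h.prime_p hD (hD i)).2 (Or.inr ⟨i, rfl⟩)
  rw [even_ncard_adj_iff h.prime_p hD hsq.ne_zero he hS (f := fun r => jacobiSym r (D i))]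
  · conv_rhs => rw [← Nat.prod_primeFactors_of_squarefree (hsq.squarefree_of_dvd he)]
    rw [Nat.cast_prod, jacobiSym_prod_left]
  · intro r hr
    rw [Nat.mem_primeFactors] at hr
    apply jacobiSym.eq_one_or_neg_one
    rw [Int.gcd_natCast_natCast]
    refine (Nat.coprime_primes hr.1 (hD i)).2 ?_
    rintro rfl
    exact hie hr.2.1
  · intro Q
    rw [gMinus_adj_iff h.prime_p hD]
    refine exists_congr fun r => and_congr_right fun hr => and_congr_right fun hrd =>
      and_congr_right fun _ => ⟨?_, fun h1 => Or.inl ⟨i, hi, hP, h1⟩⟩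
    rintro (⟨j, -, hj, hJ⟩ | ⟨h1, -⟩)
    · rw [hP] at hj
      rwa [Nat.cast_injective hj]
    · rw [hP] at h1
      exact absurd h1 (notMem_extraVertices_of_prime h (hD i) hiN)

/-- Here the multiplicativity is in the denominator; the symbols are non-zero because every prime `r
∣ e` is odd. -/
theorem even_ncard_adj_iff_of_mem_extraVertices (h : Admissible p q m (∏ i, D i))
    (hD : ∀ i, (D i).Prime) {e : ℕ} (he : e ∣ p * ∏ i, D i)
    {S : Set (gVertices m p D)}
    (hS : ∀ (v : gVertices m p D) (r : ℕ), r.Prime → r ∣ p * ∏ i, D i → (v : ℤ) = r →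
      (v ∈ S ↔ r ∣ e))
    {P : gVertices m p D} (hP : (P : ℤ) ∈ extraVertices m p (∏ i, D i)) :
    Even {Q | Q ∈ S ∧ (gMinus m p s D).Adj P Q}.ncard ↔ jacobiSym P e = 1 := by
  have hsq := h.squarefree_p_mul
  rw [even_ncard_adj_iff h.prime_p hD hsq.ne_zero he hS (f := fun r => jacobiSym P r)]
  · conv_rhs => rw [← Nat.prod_primeFactors_of_squarefree (hsq.squarefree_of_dvd he)]
    rw [jacobiSym_prod_right]
    exact fun r hr => (Nat.prime_of_mem_primeFactors hr).ne_zero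
  · intro r hr
    rw [Nat.mem_primeFactors] at hr
    have h2 := two_lt_of_prime_dvd h hr.1 (hr.2.1.trans he)
    apply jacobiSym.eq_one_or_neg_one
    rw [Int.gcd_comm, Int.gcd_eq_natAbs_gcd_natAbs, Int.natAbs_natCast]
    refine (hr.1.coprime_iff_not_dvd).2 fun h3 => ?_
    have h4 := Nat.le_of_dvd (by rcases eq_of_mem_extraVertices hP with h | h | h <;> omega) h3
    rcases eq_of_mem_extraVertices hP with h | h | h <;> omega
  · intro Q
    rw [gMinus_adj_iff h.prime_p hD]
    refine exists_congr fun r => and_congr_right fun hr => and_congr_right fun hrd =>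
      and_congr_right fun _ => ⟨?_, fun h1 => Or.inr ⟨hP, h1⟩⟩
    rintro (⟨j, -, hj, -⟩ | ⟨-, h1⟩)
    · rw [hj] at hP
      exact absurd hP (notMem_extraVertices_of_prime h (hD j)
        ((prime_dvd_iff h.prime_p hD (hD j)).2 (Or.inr ⟨j, rfl⟩)))
    · exact h1

/-- Such vertices, namely `p` and the `Dᵢ` with `(pq / Dᵢ) = -1` in the application, have no
outgoing edges. -/
theorem even_ncard_adj_of_forall_ne (h : Admissible p q m (∏ i, D i))
    (hD : ∀ i, (D i).Prime) (S : Set (gVertices m p D)) {P : gVertices m p D}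
    (hP1 : ∀ i : Fin n, (i : ℕ) < s → (P : ℤ) ≠ D i)
    (hP2 : (P : ℤ) ∉ extraVertices m p (∏ i, D i)) :
    Even {Q | Q ∈ S ∧ (gMinus m p s D).Adj P Q}.ncard := by
  have h1 : {Q | Q ∈ S ∧ (gMinus m p s D).Adj P Q} = ∅ := by
    refine Set.eq_empty_of_forall_notMem fun Q hQ => ?_
    obtain ⟨r, -, -, -, ⟨i, hi, hPi, -⟩ | ⟨h2, -⟩⟩ := (gMinus_adj_iff h.prime_p hD).1 hQ.2
    · exact hP1 i hi hPi
    · exact hP2 h2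
  rw [h1, Set.ncard_empty]
  exact Even.zero

theorem mem_divisorVertices_iff {d r : ℕ} (hr : r.Prime) {v : gVertices m p D}
    (hv : (v : ℤ) = r) : v ∈ divisorVertices m p D d ↔ r ∣ d := by
  refine ⟨?_, fun h1 => ⟨r, hr, h1, hv⟩⟩
  rintro ⟨r', -, h1, h2⟩
  rwa [Nat.cast_injective (hv.symm.trans h2)]

/-- The part `V₁` is the set of primes of `d`; the other part is the set of primes of `p D / d`
together with the extra vertices, which receive no edges. So a vertex `Dᵢ ∣ d`, `i < s`, sees
`((pD/d) / Dᵢ)`, a vertex `Dᵢ ∤ d` sees `(d / Dᵢ)`, and an extra vertex `x` sees `(x / d)`. -/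
theorem isSelmer_iff_isEvenPartition (h : Admissible p q m (∏ i, D i))
    (hD : ∀ i, (D i).Prime)
    (hres : ∀ i : Fin n, (i : ℕ) < s → jacobiSym (p * q) (D i) = 1)
    (hnonres : ∀ i : Fin n, s ≤ (i : ℕ) → jacobiSym (p * q) (D i) = -1)
    {d : ℕ} (hd : d ∣ p * ∏ i, D i) :
    IsSelmer p q (∏ i, D i) d ↔
      IsEvenPartition (gMinus m p s D) (divisorVertices m p D d) (divisorVertices m p D d)ᶜ := by
  have hsq := h.squarefree_p_mul
  have hdiv : ∀ l : ℕ, l.Prime → (l ∣ ∏ i, D i ↔ ∃ i, l = D i) := fun l hl => by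
    rw [hl.prime.dvd_finsetProd_iff]
    simp [Nat.prime_dvd_prime_iff_eq hl (hD _)]
  have hS : ∀ (v : gVertices m p D) (r : ℕ), r.Prime → r ∣ p * ∏ i, D i → (v : ℤ) = r →
      (v ∈ divisorVertices m p D d ↔ r ∣ d) := fun v r hr _ hv => mem_divisorVertices_iff hr hv
  have hS' : ∀ (v : gVertices m p D) (r : ℕ), r.Prime → r ∣ p * ∏ i, D i → (v : ℤ) = r →
      (v ∈ (divisorVertices m p D d)ᶜ ↔ r ∣ (p * ∏ i, D i) / d) := by
    intro v r hr hrd hv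
    rw [Set.mem_compl_iff, mem_divisorVertices_iff hr hv]
    refine ⟨fun h1 => ?_, fun h1 h2 => not_dvd_div_of_squarefree hsq hd hr h2 h1⟩
    rw [← Nat.mul_div_cancel' hd] at hrd
    exact (hr.dvd_mul.1 hrd).resolve_left h1
  rw [isSelmer_iff h hd fun l hl hlN => by
    obtain ⟨i, rfl⟩ := (hdiv l hl).1 hlN
    exact (lt_or_ge (i : ℕ) s).imp (hres i) (hnonres i)]
  have hext : ∀ v : gVertices m p D, (v : ℤ) ∈ extraVertices m p (∏ i, D i) →
      v ∈ (divisorVertices m p D d)ᶜ := by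
    rintro v hv ⟨r, hr, hrd, hvr⟩
    rw [hvr] at hv
    exact notMem_extraVertices_of_prime h hr (hrd.trans hd) hv
  constructor
  · rintro ⟨h1, h2⟩
    replace h1 := fun (i : Fin n) (hi : (i : ℕ) < s) =>
      h1 (D i) (hD i) ((hdiv _ (hD i)).2 ⟨i, rfl⟩) (hres i hi)
    refine ⟨isCompl_compl, fun P hP => ?_, fun P hP => ?_⟩
    · have hPe : (P : ℤ) ∉ extraVertices m p (∏ i, D i) := fun h3 => hext P h3 hP
      by_cases hPi : ∃ i : Fin n, (i : ℕ) < s ∧ (P : ℤ) = D i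
      · obtain ⟨i, hi, hPi⟩ := hPi
        have hid := (mem_divisorVertices_iff (hD i) hPi).1 hP
        exact (even_ncard_adj_iff_of_eq h hD (Nat.div_dvd_of_dvd hd) hS' hi hPi
          (not_dvd_div_of_squarefree hsq hd (hD i) hid)).2 ((h1 i hi).2 hid)
      · push Not at hPi
        exact even_ncard_adj_of_forall_ne h hD _ hPi hPe
    · by_cases hPe : (P : ℤ) ∈ extraVertices m p (∏ i, D i)
      · exact (even_ncard_adj_iff_of_mem_extraVertices h hD hd hS hPe).2 (h2 _ hPe)
      by_cases hPi : ∃ i : Fin n, (i : ℕ) < s ∧ (P : ℤ) = D i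
      · obtain ⟨i, hi, hPi⟩ := hPi
        have hid : ¬ D i ∣ d := fun h3 => hP ((mem_divisorVertices_iff (hD i) hPi).2 h3)
        exact (even_ncard_adj_iff_of_eq h hD hd hS hi hPi hid).2 ((h1 i hi).1 hid)
      · push Not at hPi
        exact even_ncard_adj_of_forall_ne h hD _ hPi hPe
  · rintro ⟨-, h1, h2⟩
    refine ⟨fun l hl hlN hJ => ?_, fun x hx => ?_⟩
    · obtain ⟨i, rfl⟩ := (hdiv l hl).1 hlN
      have hi : (i : ℕ) < s := by
        by_contra! hi
        rw [hnonres i hi] at hJ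
        norm_num at hJ
      have hv := prime_mem_gVertices (m := m) h.prime_p hD hl (hlN.mul_left p)
      have hmem := mem_divisorVertices_iff (m := m) (p := p) (D := D) (d := d)
        (v := ⟨_, hv⟩) hl rfl
      refine ⟨fun hid => ?_, fun hid => ?_⟩
      · exact (even_ncard_adj_iff_of_eq h hD hd hS hi rfl hid).1 (h2 ⟨_, hv⟩ fun h3 => hid (hmem.1 h3))
      · exact (even_ncard_adj_iff_of_eq h hD (Nat.div_dvd_of_dvd hd) hS' hi rfl
          (not_dvd_div_of_squarefree hsq hd hl hid)).1 (h1 ⟨_, hv⟩ (hmem.2 hid))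
    · have hv : x ∈ gVertices m p D := Or.inr hx
      exact (even_ncard_adj_iff_of_mem_extraVertices h hD hd hS (P := ⟨x, hv⟩) hx).1
        (h2 ⟨x, hv⟩ (hext _ hx))

/-- Excluding `-1`, `2`, `-2` from `V₁` leaves only prime divisors of the square-free number `p D`;
their product is the unique divisor corresponding to `V₁`. -/
theorem ncard_selmer_eq_ncard_isEvenPartition (h : Admissible p q m (∏ i, D i))
    (hD : ∀ i, (D i).Prime)
    (hres : ∀ i : Fin n, (i : ℕ) < s → jacobiSym (p * q) (D i) = 1)
    (hnonres : ∀ i : Fin n, s ≤ (i : ℕ) → jacobiSym (p * q) (D i) = -1) :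
    {d : ℕ | d ∣ p * ∏ i, D i ∧ IsSelmer p q (∏ i, D i) d}.ncard =
      {V : Set (gVertices m p D) × Set (gVertices m p D) |
        IsEvenPartition (gMinus m p s D) V.1 V.2 ∧
          ∀ v ∈ V.1, (v : ℤ) ≠ -1 ∧ (v : ℤ) ≠ 2 ∧ (v : ℤ) ≠ -2}.ncard := by
  classical
  have hsq := h.squarefree_p_mul
  let g : ℕ → Set (gVertices m p D) × Set (gVertices m p D) := fun d =>
    (divisorVertices m p D d, (divisorVertices m p D d)ᶜ)
  have hg : Set.InjOn g {d : ℕ | d ∣ p * ∏ i, D i ∧ IsSelmer p q (∏ i, D i) d} := by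
    rintro d ⟨hd, -⟩ e ⟨he, -⟩ hde
    rw [Nat.Squarefree.ext_iff (hsq.squarefree_of_dvd hd) (hsq.squarefree_of_dvd he)]
    have hde1 : divisorVertices m p D d = divisorVertices m p D e := congrArg Prod.fst hde
    have key : ∀ a b r : ℕ, a ∣ p * ∏ i, D i → r.Prime →
        divisorVertices m p D a = divisorVertices m p D b → r ∣ a → r ∣ b := by
      intro a b r ha hr hab hra
      have hv := prime_mem_gVertices (m := m) h.prime_p hD hr (hra.trans ha)
      have h1 : (⟨r, hv⟩ : gVertices m p D) ∈ divisorVertices m p D a := ⟨r, hr, hra, rfl⟩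
      rw [hab] at h1
      exact (mem_divisorVertices_iff hr rfl).1 h1
    exact fun r hr => ⟨key d e r hd hr hde1, key e d r he hr hde1.symm⟩
  rw [← hg.ncard_image]
  congr 1
  ext ⟨V₁, V₂⟩
  constructor
  · rintro ⟨d, ⟨hd, hsel⟩, hde⟩
    obtain ⟨rfl, rfl⟩ := Prod.mk.inj hde
    refine ⟨(isSelmer_iff_isEvenPartition h hD hres hnonres hd).1 hsel, ?_⟩
    rintro v ⟨r, hr, hrd, hvr⟩
    have := two_lt_of_prime_dvd h hr (hrd.trans hd)
    omega
  · rintro ⟨hV, hV1⟩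
    obtain rfl : V₁ᶜ = V₂ := hV.1.compl_eq
    let T : Finset ℕ := (p * ∏ i, D i).primeFactors.filter fun r : ℕ =>
      ∃ v ∈ V₁, (v : ℤ) = r
    have hT : ∀ r ∈ T, r.Prime := fun r hr =>
      Nat.prime_of_mem_primeFactors (Finset.mem_filter.1 hr).1
    have hdvd : ∏ r ∈ T, r ∣ p * ∏ i, D i :=
      (Finset.prod_dvd_prod_of_subset _ _ _ (Finset.filter_subset _ _)).trans
        (Nat.prod_primeFactors_dvd _)
    have hdiv : divisorVertices m p D (∏ r ∈ T, r) = V₁ := by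
      ext v
      constructor
      · rintro ⟨r, hr, hrd, hvr⟩
        have hrT : r ∈ T := by
          rw [← Nat.primeFactors_prod hT]
          exact Nat.mem_primeFactors.2 ⟨hr, hrd, ne_zero_of_dvd_ne_zero hsq.ne_zero hdvd⟩
        obtain ⟨w, hw, hwr⟩ := (Finset.mem_filter.1 hrT).2
        rwa [Subtype.ext (hvr.trans hwr.symm)]
      · intro hv
        have hr : ∃ r : ℕ, r.Prime ∧ r ∣ p * ∏ i, D i ∧ (v : ℤ) = r := by
          rcases v.2 with (h1 | ⟨i, h1⟩) | h1
          · exact ⟨p, h.prime_p, dvd_mul_right _ _, h1⟩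
          · exact ⟨D i, hD i, (prime_dvd_iff h.prime_p hD (hD i)).2 (Or.inr ⟨i, rfl⟩), h1.symm⟩
          · have := hV1 v hv
            have := eq_of_mem_extraVertices h1
            omega
        obtain ⟨r, hr, hrd, hvr⟩ := hr
        refine ⟨r, hr, Finset.dvd_prod_of_mem (fun r => r) ?_, hvr⟩
        exact Finset.mem_filter.2 ⟨Nat.mem_primeFactors.2 ⟨hr, hrd, hsq.ne_zero⟩, v, hv, hvr⟩
    refine ⟨∏ r ∈ T, r, ⟨hdvd, ?_⟩, ?_⟩
    · rw [isSelmer_iff_isEvenPartition h hD hres hnonres hdvd, hdiv]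
      exact hV
    · simp only [g, hdiv]

end Graph

end TwoIsogenySelmer

open TwoIsogenySelmer in
theorem theorem1p4 (p q m n s : ℕ) (D : Fin n → ℕ)
    (h : Admissible p q m (∏ i, D i))
    (hD : ∀ i, (D i).Prime)
    (hs : s ≤ n)
    (hres : ∀ i : Fin n, (i : ℕ) < s → jacobiSym (p * q) (D i) = 1)
    (hnonres : ∀ i : Fin n, s ≤ (i : ℕ) → jacobiSym (p * q) (D i) = -1) :
    Nat.card (selmerPhiHat (-1) h) =
      2 * {V : Set (gVertices m p D) × Set (gVertices m p D) |
        IsEvenPartition (gMinus m p s D) V.1 V.2 ∧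
          ∀ v ∈ V.1, (v : ℤ) ≠ -1 ∧ (v : ℤ) ≠ 2 ∧ (v : ℤ) ≠ -2}.ncard := by
  rw [card_selmerPhiHat_eq_two_mul h,
    ncard_selmer_eq_ncard_isEvenPartition h hD hres hnonres]
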